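/- Let $\mathbf{k}$ be a field. Let $\mathbf{LFP}_{\mathbf{k}}$ denote the locally finitely presentable $\mathbf{k}$-linear categories, with $\mathbf{k}$-linear functors preserving all small colimits (cocontinuous functors) as morphisms; compact objects are the finitely presentable ones, and $\mathbf{LFP}_{\mathbf{k}}^{prop}$ has the same objects and those morphisms that preserve compact objects. A tensor category $\mathcal{A}\in\mathbf{LFP}_{\mathbf{k}}^{prop}$ is a category in $\mathbf{LFP}_{\mathbf{k}}$ with a monoidal structure whose tensor product is $\mathbf{k}$-bilinear, cocontinuous in each variable and preserves compact objects, whose unit is compact, and in which every compact object has a left and a right dual. A right (resp. left) $\mathcal{A}$-module category in $\mathbf{LFP}_{\mathbf{k}}^{prop}$ is a category in $\mathbf{LFP}_{\mathbf{k}}$ with a right (resp. left) action of the monoidal category $\mathcal{A}$ (coherently associative and unital up to isomorphism) that is $\mathbf{k}$-bilinear, cocontinuous in each variable, and sends pairs of compact objects to compact objects. Let $\mathcal{A}$ be such a tensor category, $\mathcal{C}$ a right and $\mathcal{D}$ a left $\mathcal{A}$-module category in $\mathbf{LFP}_{\mathbf{k}}^{prop}$. The Deligne--Kelly tensor product $\mathcal{C}\boxtimes\mathcal{D}\in\mathbf{LFP}_{\mathbf{k}}$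 is characterized by a universal functor $\mathcal{C}\times\mathcal{D}\to\mathcal{C}\boxtimes\mathcal{D}$, $\mathbf{k}$-bilinear and cocontinuous in each variable: for every $\mathcal{E}\in\mathbf{LFP}_{\mathbf{k}}$, restriction along it is an equivalence from the category of cocontinuous $\mathbf{k}$-linear functors $\mathcal{C}\boxtimes\mathcal{D}\to\mathcal{E}$ to the category of functors $\mathcal{C}\times\mathcal{D}\to\mathcal{E}$ that are $\mathbf{k}$-bilinear and cocontinuous in each variable. An $\mathcal{A}$-balanced functor is such a functor $F:\mathcal{C}\times\mathcal{D}\to\mathcal{E}$ together with isomorphisms $F(m\otimes X,n)\cong F(m,X\otimes n)$, natural in $m\in\mathcal{C}$, $X\in\mathcal{A}$, $n\in\mathcal{D}$ and compatible with the associativity and unit isomorphisms of the two actions; morphisms of balanced functors are the natural transformations compatible with these isomorphisms. The relative tensor product $\mathcal{C}\boxtimes_{\mathcal{A}}\mathcal{D}\in\mathbf{LFP}_{\mathbf{k}}$ is characterized by a universal balanced functor $\mathcal{C}\times\mathcal{D}\to\mathcal{C}\boxtimes_{\mathcal{A}}\mathcal{D}$: restriction along it is, for every $\mathcal{E}\in\mathbf{LFP}_{\mathbf{k}}$,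 an equivalence from cocontinuous $\mathbf{k}$-linear functors $\mathcal{C}\boxtimes_{\mathcal{A}}\mathcal{D}\to\mathcal{E}$ to $\mathcal{A}$-balanced functors $\mathcal{C}\times\mathcal{D}\to\mathcal{E}$. Let $$\mu:\mathcal{C}\boxtimes\mathcal{D}\to\mathcal{C}\boxtimes_{\mathcal{A}}\mathcal{D}$$ be the canonical functor, i.e. the cocontinuous $\mathbf{k}$-linear functor, unique up to isomorphism, whose restriction to $\mathcal{C}\times\mathcal{D}$ is isomorphic to the functor underlying the universal balanced functor. Then $\mu$ has a right adjoint, and this right adjoint $\mu^R$ is monadic: for every adjunction $\mu\dashv\mu^R$, the comparison functor from $\mathcal{C}\boxtimes_{\mathcal{A}}\mathcal{D}$ to the category of modules over the monad $\mu^R\mu$ on $\mathcal{C}\boxtimes\mathcal{D}$ is an equivalence. Moreover, if $\mathcal{A}$, $\mathcal{C}$ and $\mathcal{D}$ are abelian, then so is $\mathcal{C}\boxtimes_{\mathcal{A}}\mathcal{D}$. -/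

import Mathlib

/-!
Categories in `LFP_k`, for a field `k : Type w`, are categories `C : Type (w + 1)` with hom-sets in
`Type w`, carrying `[Preadditive C] [Linear k C] [IsLocallyFinitelyPresentable.{w} C]`; "small"
means `w`-small. Compact objects are the finitely presentable ones.
-/

universe w

open CategoryTheory Limits MonoidalCategory
open scoped MonoidalLeftAction MonoidalRightAction

namespace RelTensor

section LFP

variable (k : Type w) [Field k]

/-- Morphisms in `LFP_k`: `k`-linear functors preserving all small colimits. -/
structure IsCocontinuousLinear {C E : Type (w + 1)} [Category.{w} C] [Category.{w} E]
    [Preadditive C] [Preadditive E] [Linear k C] [Linear k E] (F : C ⥤ E) : Prop where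
  additive : F.Additive
  linear : F.Linear k
  preservesColimits : PreservesColimitsOfSize.{w, w} F

/-- Functors of two variables which are `k`-bilinear and preserve small colimits in each
variable separately. -/
structure IsBicocontinuousBilinear {C D E : Type (w + 1)}
    [Category.{w} C] [Category.{w} D] [Category.{w} E]
    [Preadditive C] [Preadditive D] [Preadditive E] [Linear k C] [Linear k D] [Linear k E]
    (F : C ⥤ D ⥤ E) : Prop where
  right : ∀ c : C, IsCocontinuousLinear k (F.obj c)
  left : ∀ d : D, IsCocontinuousLinear k (F.flip.obj d)

/-- A functor of two variables sending pairs of compact objects to compact objects. -/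
def PreservesCompactPairs {C D E : Type (w + 1)}
    [Category.{w} C] [Category.{w} D] [Category.{w} E] (F : C ⥤ D ⥤ E) : Prop :=
  ∀ (c : C) (d : D), IsFinitelyPresentable.{w} c → IsFinitelyPresentable.{w} d →
    IsFinitelyPresentable.{w} ((F.obj c).obj d)

/-- The category of morphisms of `LFP_k` from `C` to `E`, with all natural transformations. -/
abbrev CocontinuousFunctor (C E : Type (w + 1)) [Category.{w} C] [Category.{w} E]
    [Preadditive C] [Preadditive E] [Linear k C] [Linear k E] : Type (w + 1) :=
  ObjectProperty.FullSubcategory (fun F : C ⥤ E => IsCocontinuousLinear k F)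

/-- The category of `k`-bilinear functors `C × D → E` (in curried form) which preserve small
colimits in each variable. -/
abbrev BilinearFunctor (C D E : Type (w + 1))
    [Category.{w} C] [Category.{w} D] [Category.{w} E]
    [Preadditive C] [Preadditive D] [Preadditive E] [Linear k C] [Linear k D] [Linear k E] :
    Type (w + 1) :=
  ObjectProperty.FullSubcategory (fun F : C ⥤ D ⥤ E => IsBicocontinuousBilinear k F)

variable {k}

lemma IsCocontinuousLinear.comp {C D E : Type (w + 1)}
    [Category.{w} C] [Category.{w} D] [Category.{w} E]
    [Preadditive C] [Preadditive D] [Preadditive E] [Linear k C] [Linear k D] [Linear k E]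
    {F : C ⥤ D} {G : D ⥤ E} (hF : IsCocontinuousLinear k F) (hG : IsCocontinuousLinear k G) :
    IsCocontinuousLinear k (F ⋙ G) := by
  have := hF.additive
  have := hF.linear
  have := hF.preservesColimits
  have := hG.additive
  have := hG.linear
  have := hG.preservesColimits
  exact ⟨inferInstance, inferInstance, inferInstance⟩

/-- The functor `(c, d) ↦ G (T (c, d))` is bilinear and cocontinuous in each variable. -/
lemma IsBicocontinuousBilinear.comp {C D P E : Type (w + 1)}
    [Category.{w} C] [Category.{w} D] [Category.{w} P] [Category.{w} E]
    [Preadditive C] [Preadditive D] [Preadditive P] [Preadditive E]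
    [Linear k C] [Linear k D] [Linear k P] [Linear k E]
    {T : C ⥤ D ⥤ P} {G : P ⥤ E}
    (hT : IsBicocontinuousBilinear k T) (hG : IsCocontinuousLinear k G) :
    IsBicocontinuousBilinear k ((Functor.postcompose₂.obj G).obj T) :=
  ⟨fun c => (hT.right c).comp hG, fun d => (hT.left d).comp hG⟩

/-- Restriction along a bilinear functor `T : C × D → P`, i.e. the functor `G ↦ G ∘ T` from
cocontinuous linear functors `P → E` to bilinear functors `C × D → E`. -/
def restrictBilinear {C D P : Type (w + 1)} [Category.{w} C] [Category.{w} D] [Category.{w} P]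
    [Preadditive C] [Preadditive D] [Preadditive P] [Linear k C] [Linear k D] [Linear k P]
    (T : BilinearFunctor k C D P)
    (E : Type (w + 1)) [Category.{w} E] [Preadditive E] [Linear k E] :
    CocontinuousFunctor k P E ⥤ BilinearFunctor k C D E :=
  ObjectProperty.lift _
    (ObjectProperty.ι _ ⋙ Functor.postcompose₂.flip.obj T.obj)
    (fun G => T.property.comp G.property)

/-- `T : C × D → P` exhibits `P` as the Deligne-Kelly tensor product `C ⊠ D`: for every `E` in
`LFP_k`, restriction along `T` is an equivalence from cocontinuous linear functors `P → E`
to functors `C × D → E` that are bilinear and cocontinuous in each variable. -/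
def IsDeligneKellyTensor {C D P : Type (w + 1)}
    [Category.{w} C] [Category.{w} D] [Category.{w} P]
    [Preadditive C] [Preadditive D] [Preadditive P] [Linear k C] [Linear k D] [Linear k P]
    (T : BilinearFunctor k C D P) : Prop :=
  ∀ (E : Type (w + 1)) [Category.{w} E] [Preadditive E] [Linear k E]
    [IsLocallyFinitelyPresentable.{w} E], (restrictBilinear T E).IsEquivalence

end LFP

section Tensor

variable (k : Type w) [Field k]

/-- The conditions making a `k`-linear, locally finitely presentable monoidal category `A` a
tensor category: it is an algebra in `LFP_k^prop` (the tensor product is bilinear, cocontinuous in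
each variable, and preserves compact objects, and the unit is compact), and it is rigid, i.e. every
compact object has a left and a right dual. -/
structure IsTensorCategory (A : Type (w + 1)) [Category.{w} A] [Preadditive A] [Linear k A]
    [MonoidalCategory A] : Prop where
  tensor : IsBicocontinuousBilinear k (curriedTensor A)
  tensor_compact : PreservesCompactPairs (curriedTensor A)
  unit_compact : IsFinitelyPresentable.{w} (𝟙_ A)
  left_dual : ∀ X : A, IsFinitelyPresentable.{w} X → Nonempty (HasLeftDual X)
  right_dual : ∀ X : A, IsFinitelyPresentable.{w} X → Nonempty (HasRightDual X)

/-- A right action of `A` on `C` is a right module category structure in `LFP_k^prop` when the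
action functor is bilinear, cocontinuous in each variable, and preserves compact objects. -/
structure IsRightModuleCategory (A C : Type (w + 1)) [Category.{w} A] [Category.{w} C]
    [Preadditive A] [Preadditive C] [Linear k A] [Linear k C]
    [MonoidalCategory A] [MonoidalRightAction A C] : Prop where
  action : IsBicocontinuousBilinear k (MonoidalRightAction.curriedAction A C)
  action_compact : PreservesCompactPairs (MonoidalRightAction.curriedAction A C)

/-- A left action of `A` on `D` is a left module category structure in `LFP_k^prop` when the
action functor is bilinear, cocontinuous in each variable, and preserves compact objects. -/
structure IsLeftModuleCategory (A D : Type (w + 1)) [Category.{w} A] [Category.{w} D]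
    [Preadditive A] [Preadditive D] [Linear k A] [Linear k D]
    [MonoidalCategory A] [MonoidalLeftAction A D] : Prop where
  action : IsBicocontinuousBilinear k (MonoidalLeftAction.curriedAction A D)
  action_compact : PreservesCompactPairs (MonoidalLeftAction.curriedAction A D)

end Tensor

section Balanced

/-- A balancing on a functor `F : C × D → E`, for a right action of `A` on `C` and a left action
of `A` on `D`: isomorphisms `F (m ⊗ X, n) ≅ F (m, X ⊗ n)`, natural in `m`, `X` and `n`, and
coherent with the associativity and unit isomorphisms of the two actions. -/
structure Balancing (A : Type (w + 1)) {C D E : Type (w + 1)}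
    [Category.{w} A] [Category.{w} C] [Category.{w} D] [Category.{w} E]
    [MonoidalCategory A] [MonoidalRightAction A C] [MonoidalLeftAction A D]
    (F : C ⥤ D ⥤ E) where
  iso (m : C) (X : A) (n : D) : (F.obj (m ⊙ᵣ X)).obj n ≅ (F.obj m).obj (X ⊙ₗ n)
  naturality_left {m m' : C} (f : m ⟶ m') (X : A) (n : D) :
    (F.map (f ⊵ᵣ X)).app n ≫ (iso m' X n).hom = (iso m X n).hom ≫ (F.map f).app (X ⊙ₗ n)
  naturality_middle (m : C) {X X' : A} (f : X ⟶ X') (n : D) :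
    (F.map (m ⊴ᵣ f)).app n ≫ (iso m X' n).hom = (iso m X n).hom ≫ (F.obj m).map (f ⊵ₗ n)
  naturality_right (m : C) (X : A) {n n' : D} (f : n ⟶ n') :
    (F.obj (m ⊙ᵣ X)).map f ≫ (iso m X n').hom = (iso m X n).hom ≫ (F.obj m).map (X ⊴ₗ f)
  pentagon (m : C) (X Y : A) (n : D) :
    (iso m (X ⊗ Y) n).hom ≫ (F.obj m).map (αₗ X Y n).hom =
      (F.map (αᵣ m X Y).hom).app n ≫ (iso (m ⊙ᵣ X) Y n).hom ≫ (iso m X (Y ⊙ₗ n)).hom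
  unit (m : C) (n : D) :
    (iso m (𝟙_ A) n).hom ≫ (F.obj m).map (λₗ n).hom = (F.map (ρᵣ m).hom).app n

variable (k : Type w) [Field k]

/-- `A`-balanced functors `C × D → E`, bilinear and cocontinuous in each variable. -/
structure BalancedFunctor (A C D E : Type (w + 1))
    [Category.{w} A] [Category.{w} C] [Category.{w} D] [Category.{w} E]
    [Preadditive C] [Preadditive D] [Preadditive E] [Linear k C] [Linear k D] [Linear k E]
    [MonoidalCategory A] [MonoidalRightAction A C] [MonoidalLeftAction A D] where
  functor : C ⥤ D ⥤ E
  bilinear : IsBicocontinuousBilinear k functor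
  balancing : Balancing A functor

variable {k}

namespace BalancedFunctor

variable {A C D E : Type (w + 1)}
  [Category.{w} A] [Category.{w} C] [Category.{w} D] [Category.{w} E]
  [Preadditive C] [Preadditive D] [Preadditive E] [Linear k C] [Linear k D] [Linear k E]
  [MonoidalCategory A] [MonoidalRightAction A C] [MonoidalLeftAction A D]

/-- Morphisms of balanced functors: natural transformations compatible with the balancings. -/
@[ext]
structure Hom (F G : BalancedFunctor k A C D E) where
  natTrans : F.functor ⟶ G.functor
  comm : ∀ (m : C) (X : A) (n : D),
    (natTrans.app (m ⊙ᵣ X)).app n ≫ (G.balancing.iso m X n).hom =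
      (F.balancing.iso m X n).hom ≫ (natTrans.app m).app (X ⊙ₗ n)

instance : Category.{w + 1} (BalancedFunctor k A C D E) where
  Hom := Hom
  id F := ⟨𝟙 F.functor, fun m X n => by simp⟩
  comp f g := ⟨f.natTrans ≫ g.natTrans, fun m X n => by
    simp only [NatTrans.comp_app, Category.assoc]
    rw [g.comm, ← Category.assoc, f.comm, Category.assoc]⟩
  id_comp f := Hom.ext (Category.id_comp f.natTrans)
  comp_id f := Hom.ext (Category.comp_id f.natTrans)
  assoc f g h := Hom.ext (Category.assoc f.natTrans g.natTrans h.natTrans)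

variable {Q : Type (w + 1)} [Category.{w} Q] [Preadditive Q] [Linear k Q]

/-- The composite of a balanced functor `S : C × D → Q` with a functor `G : Q → E`, with the
balancing obtained by applying `G`. -/
def postcompose (S : BalancedFunctor k A C D Q) (G : CocontinuousFunctor k Q E) :
    BalancedFunctor k A C D E where
  functor := (Functor.postcompose₂.obj G.obj).obj S.functor
  bilinear := S.bilinear.comp G.property
  balancing :=
    { iso := fun m X n => G.obj.mapIso (S.balancing.iso m X n)
      naturality_left := fun f X n => by
        simpa using congrArg G.obj.map (S.balancing.naturality_left f X n)
      naturality_middle := fun m _ _ f n => by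
        simpa using congrArg G.obj.map (S.balancing.naturality_middle m f n)
      naturality_right := fun m X _ _ f => by
        simpa using congrArg G.obj.map (S.balancing.naturality_right m X f)
      pentagon := fun m X Y n => by
        simpa using congrArg G.obj.map (S.balancing.pentagon m X Y n)
      unit := fun m n => by
        simpa using congrArg G.obj.map (S.balancing.unit m n) }

variable (E) in
/-- Restriction along a balanced functor `S : C × D → Q`, i.e. the functor `G ↦ G ∘ S` from
cocontinuous linear functors `Q → E` to balanced functors `C × D → E`. -/
def restrict (S : BalancedFunctor k A C D Q) :
    CocontinuousFunctor k Q E ⥤ BalancedFunctor k A C D E where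
  obj G := S.postcompose G
  map f :=
    { natTrans := (Functor.postcompose₂.map f.hom).app S.functor
      comm := fun m X n => (f.hom.naturality (S.balancing.iso m X n).hom).symm }
  map_id _ := rfl
  map_comp _ _ := rfl

/-- `S : C × D → Q` exhibits `Q` as the relative tensor product `C ⊠_A D`: for every `E` in
`LFP_k`, restriction along `S` is an equivalence from cocontinuous linear functors `Q → E` to
`A`-balanced functors `C × D → E`. -/
def IsRelativeTensor (S : BalancedFunctor k A C D Q) : Prop :=
  ∀ (E : Type (w + 1)) [Category.{w} E] [Preadditive E] [Linear k E]
    [IsLocallyFinitelyPresentable.{w} E], (S.restrict E).IsEquivalence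

end BalancedFunctor

/-- `μ : C ⊠ D → C ⊠_A D` is the canonical functor: the morphism of `LFP_k`, unique up to
isomorphism, whose restriction along the universal bilinear functor `T : C × D → C ⊠ D` is the
bilinear functor underlying the universal balanced functor `S : C × D → C ⊠_A D`. -/
def IsCanonicalFunctor {A C D P Q : Type (w + 1)}
    [Category.{w} A] [Category.{w} C] [Category.{w} D] [Category.{w} P] [Category.{w} Q]
    [Preadditive C] [Preadditive D] [Preadditive P] [Preadditive Q]
    [Linear k C] [Linear k D] [Linear k P] [Linear k Q]
    [MonoidalCategory A] [MonoidalRightAction A C] [MonoidalLeftAction A D]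
    (T : BilinearFunctor k C D P) (S : BalancedFunctor k A C D Q)
    (μ : CocontinuousFunctor k P Q) : Prop :=
  Nonempty ((restrictBilinear T Q).obj μ ≅ ⟨S.functor, S.bilinear⟩)

end Balanced

/-- A preadditive category is abelian (for its given preadditive structure). -/
def IsAbelian (C : Type (w + 1)) [Category.{w} C] [h : Preadditive C] : Prop :=
  ∃ a : Abelian C, a.toPreadditive = h

end RelTensor

/-! Write `T` and `S` for the universal functors to `P = C ⊠ D` and `Q = C ⊠_A D`. The right adjoint
of `μ` should be given by the coend $\mu^R S(m,n)=\int^{X}T(m\otimes X^*,X\otimes n)$ over compact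
`X`. To avoid choosing duals functorially, the coend is replaced by `N (m, n)`, the colimit of `T (m
⊙ X', X ⊙ n)` over all pairings `X' ⊗ X ⟶ 𝟙` of compact objects. A dual of `B` is terminal among the
objects paired with `B`, so a morphism out of `N (m, n)` amounts to a family of morphisms out of `T
(c, B ⊙ n)`, one for each `φ : c ⊙ B ⟶ m`, compatible in `c` and `B`
(`balancedCompletion_exists_desc`). In this form there are evident maps `N (m, Y ⊙ n) ⟶ N (m ⊙ Y,
n)` for compact `Y`; they are invertible because `Y` has a left dual (`isIso_hom_of_exactPairing`),
and they extend to all of `A` since compact objects are dense. So `N` is balanced and equals `R ∘ S`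
for a cocontinuous `R : Q ⥤ P`. The component `B = 𝟙` gives the unit, the balancing of `S` gives the
counit, and the triangle identities are checked on objects `T (m, n)` and `S (m, n)`
(`exists_adjunction`).

For monadicity, `R` is cocontinuous, so by the crude monadicity theorem it only has to reflect
isomorphisms. On `S (m, n) ≅ μ T (m, n)` the counit is split by the unit, hence the canonical fork
`μRμR ⇉ μR ⟶ 𝟭` is a coequalizer there. Its coequalizer functor is cocontinuous, so the universal
property of `S` makes the fork a coequalizer everywhere (`isIso_desc_counit`). The identity of `Q`
is thus built from functors that factor through `R`.

For abelianness any one model of `C ⊠ D` suffices. With `a` and `b` small models of the compact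
objects of `C` and `D`, the model consists of the presheaves of modules on `a × b` that are bilinear
and left exact in each variable ("bilex"). They are the local objects for a small set of morphisms
between compact presheaves, hence form a locally finitely presentable category, and its universal
property follows from Kan extension (`exists_isDeligneKellyTensor`). If `C` and `D` are abelian,
bilex presheaves are exactly the bilinear sheaves for the topology of pairs of epimorphisms, and
these are closed under kernels, cokernels and finite products in an abelian category of sheaves
(`BilexCat.abelian`). Finally `R` is exact and reflects isomorphisms, so it reflects invertibility
of the coimage-image comparison. -/

namespace RelTensor

/-! ### Dual pairs acting on module categories -/

section ActionCoherence

open MonoidalRightAction in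
/-- Acting on `m` by a pairing `X' ⊗ X ⟶ 𝟙`. -/
def contractRight {A C : Type*} [Category* A] [Category* C] [MonoidalCategory A]
    [MonoidalRightAction A C] (m : C) {X' X : A} (e : X' ⊗ X ⟶ 𝟙_ A) :
    (m ⊙ᵣ X') ⊙ᵣ X ⟶ m :=
  (αᵣ m X' X).inv ≫ m ⊴ᵣ e ≫ (ρᵣ m).hom

/-- The transpose of `c ⊙ᵣ B ⟶ m` along an exact pairing. -/
def transposeRight {A C : Type*} [Category* A] [Category* C] [MonoidalCategory A]
    [MonoidalRightAction A C] {c m : C} {B : A} (B' : A) [ExactPairing B B'] (φ : c ⊙ᵣ B ⟶ m) :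
    c ⟶ m ⊙ᵣ B' :=
  (ρᵣ c).inv ≫ c ⊴ᵣ (η_ B B') ≫ (αᵣ c B B').hom ≫ φ ⊵ᵣ B'

variable {A C D : Type*} [Category* A] [Category* C] [Category* D] [MonoidalCategory A]
  [MonoidalRightAction A C] [MonoidalLeftAction A D]

open MonoidalRightAction in
lemma contractRight_naturality {m m' : C} (f : m ⟶ m') {X' X : A} (e : X' ⊗ X ⟶ 𝟙_ A) :
    (f ⊵ᵣ X') ⊵ᵣ X ≫ contractRight m' e = contractRight m e ≫ f := by
  have h : (f ⊵ᵣ X') ⊵ᵣ X = (αᵣ m X' X).inv ≫ f ⊵ᵣ (X' ⊗ X) ≫ (αᵣ m' X' X).hom := by simp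
  simp only [contractRight, h, Category.assoc, Iso.hom_inv_id_assoc]
  rw [← action_exchange_assoc, unit_actionHomRight]
  simp

open MonoidalRightAction in
lemma contractRight_dinaturality (m : C) {X' X Y' Y : A} (f : X' ⟶ Y') (g : X ⟶ Y)
    (e : Y' ⊗ Y ⟶ 𝟙_ A) :
    contractRight m ((f ⊗ₘ g) ≫ e) =
      (m ⊴ᵣ f) ⊵ᵣ X ≫ (m ⊙ᵣ Y') ⊴ᵣ g ≫ contractRight m e := by
  simp only [contractRight, MonoidalCategory.tensorHom_def, actionHomRight_comp,
    actionHomRight_whiskerRight,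
    whiskerRight_actionHomLeft, Category.assoc, Iso.inv_hom_id_assoc]

lemma transposeRight_naturality {c c' m : C} (f : c' ⟶ c) {B : A} (B' : A) [ExactPairing B B']
    (φ : c ⊙ᵣ B ⟶ m) :
    f ≫ transposeRight B' φ = transposeRight B' (f ⊵ᵣ B ≫ φ) := by
  simp only [transposeRight, MonoidalRightAction.comp_actionHomLeft]
  rw [← MonoidalRightAction.actionUnitIso_inv_naturality_assoc,
    ← MonoidalRightAction.action_exchange_assoc]
  simp

lemma transposeRight_comp {c m m' : C} {B : A} (B' : A) [ExactPairing B B']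
    (φ : c ⊙ᵣ B ⟶ m) (h : m ⟶ m') :
    transposeRight B' (φ ≫ h) = transposeRight B' φ ≫ h ⊵ᵣ B' := by
  simp [transposeRight]

open MonoidalRightAction in
/-- Associativity coherence for two actions by pairings. -/
lemma transposeRight_id_contractRight (c : C) {B : A} (B' : A) [ExactPairing B B'] :
    transposeRight B' (𝟙 (c ⊙ᵣ B)) ⊵ᵣ B ≫ contractRight (c ⊙ᵣ B) (ε_ B B') = 𝟙 _ := by
  -- The four identities put every factor in the form `c ⊴ᵣ _`; what remains is the zigzag identity
  -- of the pairing, acted on by `c`.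
  have h₁ : (ρᵣ[A] c).inv ⊵ᵣ B = c ⊴ᵣ (λ_ B).inv ≫ (αᵣ c (𝟙_ A) B).hom := by
    rw [← cancel_epi (c ⊴ᵣ (λ_ B).hom), actionHomRight_hom_inv_assoc, actionHom_leftUnitor,
      Category.assoc, hom_inv_actionHomLeft, Category.comp_id]
  have h₂ : (αᵣ c B B').hom ⊵ᵣ B ≫ (αᵣ (c ⊙ᵣ B) B' B).inv =
      (αᵣ c (B ⊗ B') B).inv ≫ c ⊴ᵣ (α_ B B' B).hom ≫ (αᵣ c B (B' ⊗ B)).hom := by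
    rw [Iso.comp_inv_eq, Category.assoc, Category.assoc, actionHom_associator,
      Iso.inv_hom_id_assoc]
  have h₃ : (αᵣ c B (𝟙_ A)).hom ≫ (ρᵣ (c ⊙ᵣ B)).hom = c ⊴ᵣ (ρ_ B).hom :=
    (actionHom_rightUnitor B c).symm
  have h₄ : (c ⊴ᵣ η_ B B') ⊵ᵣ B =
      (αᵣ c (𝟙_ A) B).inv ≫ c ⊴ᵣ (η_ B B' ▷ B) ≫ (αᵣ c (B ⊗ B') B).hom := by
    simp
  simp only [transposeRight, contractRight, id_actionHomLeft, Category.comp_id,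
    comp_actionHomLeft, Category.assoc, h₁, reassoc_of% h₂, h₄, Iso.hom_inv_id_assoc,
    action_actionHomRight, h₃]
  simp only [← actionHomRight_comp]
  rw [ExactPairing.evaluation_coevaluation_assoc]
  simp

/-- Half of the adjunction between acting by `B` and by `B'`: the transpose of `φ` is that of the
identity followed by `φ`, and contraction is natural. -/
lemma transposeRight_contractRight {c m : C} {B : A} (B' : A) [ExactPairing B B']
    (φ : c ⊙ᵣ B ⟶ m) :
    transposeRight B' φ ⊵ᵣ B ≫ contractRight m (ε_ B B') = φ := by
  have := transposeRight_comp B' (𝟙 (c ⊙ᵣ B)) φ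
  rw [Category.id_comp] at this
  rw [this, MonoidalRightAction.comp_actionHomLeft, Category.assoc, contractRight_naturality,
    ← Category.assoc, transposeRight_id_contractRight, Category.id_comp]

-- The other zigzag, on the right module side; with `leftAction_zigzag` it gives the two composites
-- in `isIso_hom_of_exactPairing`.
open MonoidalRightAction in
lemma contractRight_transposeRight (m : C) {Y : A} (X : A) [ExactPairing X Y] :
    (ρᵣ (m ⊙ᵣ Y)).inv ≫ (m ⊙ᵣ Y) ⊴ᵣ (η_ X Y) ≫ (αᵣ (m ⊙ᵣ Y) X Y).hom ≫
      contractRight m (ε_ X Y) ⊵ᵣ Y = 𝟙 _ := by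
  have h₁ : (ρᵣ (m ⊙ᵣ Y)).inv = m ⊴ᵣ (ρ_ Y).inv ≫ (αᵣ m Y (𝟙_ A)).hom := by
    rw [← cancel_epi (m ⊴ᵣ (ρ_ Y).hom), actionHomRight_hom_inv_assoc, actionHom_rightUnitor,
      Category.assoc, Iso.hom_inv_id, Category.comp_id]
  have h₂ : (αᵣ (m ⊙ᵣ Y) X Y).hom ≫ (αᵣ m Y X).inv ⊵ᵣ Y =
      (αᵣ m Y (X ⊗ Y)).inv ≫ m ⊴ᵣ (α_ Y X Y).inv ≫ (αᵣ m (Y ⊗ X) Y).hom := by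
    rw [← cancel_mono ((αᵣ m Y X).hom ⊵ᵣ Y), Category.assoc, Category.assoc, Category.assoc,
      inv_hom_actionHomLeft, Category.comp_id, ← actionHom_associator,
      actionHomRight_inv_hom_assoc, Iso.inv_hom_id_assoc]
  have h₃ : (αᵣ m (𝟙_ A) Y).hom ≫ (ρᵣ[A] m).hom ⊵ᵣ Y = m ⊴ᵣ (λ_ Y).hom :=
    (actionHom_leftUnitor Y m).symm
  have h₄ : (m ⊴ᵣ ε_ X Y) ⊵ᵣ Y =
      (αᵣ m (Y ⊗ X) Y).inv ≫ m ⊴ᵣ (ε_ X Y ▷ Y) ≫ (αᵣ m (𝟙_ A) Y).hom := by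
    simp
  simp only [contractRight, comp_actionHomLeft, Category.assoc, h₁, reassoc_of% h₂, h₄,
    Iso.hom_inv_id_assoc, action_actionHomRight, h₃]
  simp only [← actionHomRight_comp]
  rw [ExactPairing.coevaluation_evaluation_assoc]
  simp

open MonoidalLeftAction in
lemma leftAction_zigzag (n : D) {Y : A} (X : A) [ExactPairing X Y] :
    Y ⊴ₗ ((λₗ n).inv ≫ (η_ X Y) ⊵ₗ n ≫ (αₗ X Y n).hom) ≫ (αₗ Y X (Y ⊙ₗ n)).inv ≫
      (ε_ X Y) ⊵ₗ (Y ⊙ₗ n) ≫ (λₗ (Y ⊙ₗ n)).hom = 𝟙 _ := by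
  have h₁ : Y ⊴ₗ (λₗ[A] n).inv = (ρ_ Y).inv ⊵ₗ n ≫ (αₗ Y (𝟙_ A) n).hom := by
    rw [← cancel_epi ((ρ_ Y).hom ⊵ₗ n), hom_inv_actionHomLeft_assoc, rightUnitor_actionHom,
      Category.assoc, actionHomRight_hom_inv, Category.comp_id]
  have h₂ : Y ⊴ₗ (αₗ X Y n).hom ≫ (αₗ Y X (Y ⊙ₗ n)).inv =
      (αₗ Y (X ⊗ Y) n).inv ≫ (α_ Y X Y).inv ⊵ₗ n ≫ (αₗ (Y ⊗ X) Y n).hom := by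
    rw [Iso.comp_inv_eq, Category.assoc, Category.assoc, ← associator_actionHom,
      inv_hom_actionHomLeft_assoc, Iso.inv_hom_id_assoc]
  have h₃ : (αₗ (𝟙_ A) Y n).hom ≫ (λₗ[A] (Y ⊙ₗ n)).hom = (λ_ Y).hom ⊵ₗ n :=
    (leftUnitor_actionHom Y n).symm
  have h₄ : Y ⊴ₗ (η_ X Y ⊵ₗ n) =
      (αₗ Y (𝟙_ A) n).inv ≫ (Y ◁ η_ X Y) ⊵ₗ n ≫ (αₗ Y (X ⊗ Y) n).hom := by
    simp
  simp only [actionHomRight_comp, Category.assoc, h₁, reassoc_of% h₂, h₄,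
    Iso.hom_inv_id_assoc, actionHomLeft_action, h₃]
  simp only [← comp_actionHomLeft]
  rw [ExactPairing.coevaluation_evaluation_assoc]
  simp

/-- The morphism `X' ⟶ B'` corresponding to a pairing `X' ⊗ B ⟶ 𝟙`. -/
def pairingToDual {X' B : A} (B' : A) [ExactPairing B B'] (e : X' ⊗ B ⟶ 𝟙_ A) : X' ⟶ B' :=
  (ρ_ X').inv ≫ X' ◁ (η_ B B') ≫ (α_ X' B B').inv ≫ e ▷ B' ≫ (λ_ B').hom

/-- Every pairing with `B` factors through the evaluation, so the index category of pairings is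
controlled by the triples `(B', B, ε)`. The proof slides `e` past `ε` and then uses the zigzag for
`B`. -/
lemma pairingToDual_evaluation {X' B : A} (B' : A) [ExactPairing B B'] (e : X' ⊗ B ⟶ 𝟙_ A) :
    pairingToDual B' e ▷ B ≫ ε_ B B' = e := by
  have h : η_ B B' ▷ B ≫ (α_ B B' B).hom ≫ B ◁ ε_ B B' = (λ_ B).hom ≫ (ρ_ B).inv :=
    ExactPairing.evaluation_coevaluation B B'
  calc pairingToDual B' e ▷ B ≫ ε_ B B' =
      X' ◁ (λ_ B).inv ≫ X' ◁ (η_ B B' ▷ B ≫ (α_ B B' B).hom ≫ B ◁ ε_ B B') ≫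
        (α_ X' B (𝟙_ A)).inv ≫ e ▷ 𝟙_ A ≫ (λ_ (𝟙_ A)).hom := by
        have := whisker_exchange e (ε_ B B')
        simp only [pairingToDual, comp_whiskerRight, Category.assoc, whiskerLeft_comp]
        rw [show e ▷ B' ▷ B ≫ (λ_ B').hom ▷ B ≫ ε_ B B' =
          (α_ (X' ⊗ B) B' B).hom ≫ (X' ⊗ B) ◁ ε_ B B' ≫ e ▷ 𝟙_ A ≫ (λ_ (𝟙_ A)).hom by
            rw [reassoc_of% this]; simp]
        monoidal
    _ = e := by rw [h]; simp [unitors_equal]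

open MonoidalRightAction in
lemma transposeRight_contractRight_eq (m : C) {X' B : A} (B' : A) [ExactPairing B B']
    (e : X' ⊗ B ⟶ 𝟙_ A) :
    transposeRight B' (contractRight m e) = m ⊴ᵣ pairingToDual B' e := by
  have h₁ : (αᵣ (m ⊙ᵣ X') B B').hom ≫ (αᵣ m X' B).inv ⊵ᵣ B' =
      (αᵣ m X' (B ⊗ B')).inv ≫ m ⊴ᵣ (α_ X' B B').inv ≫ (αᵣ m (X' ⊗ B) B').hom := by
    rw [← cancel_mono ((αᵣ m X' B).hom ⊵ᵣ B'), Category.assoc, Category.assoc, Category.assoc,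
      inv_hom_actionHomLeft, Category.comp_id, ← actionHom_associator,
      actionHomRight_inv_hom_assoc, Iso.inv_hom_id_assoc]
  have h₂ : (ρᵣ (m ⊙ᵣ X')).inv = m ⊴ᵣ (ρ_ X').inv ≫ (αᵣ m X' (𝟙_ A)).hom := by
    rw [← cancel_epi (m ⊴ᵣ (ρ_ X').hom), actionHomRight_hom_inv_assoc, actionHom_rightUnitor,
      Category.assoc, Iso.hom_inv_id, Category.comp_id]
  have h₃ : (αᵣ m (𝟙_ A) B').hom ≫ (ρᵣ[A] m).hom ⊵ᵣ B' = m ⊴ᵣ (λ_ B').hom :=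
    (actionHom_leftUnitor B' m).symm
  have h₄ : (m ⊴ᵣ e) ⊵ᵣ B' =
      (αᵣ m (X' ⊗ B) B').inv ≫ m ⊴ᵣ (e ▷ B') ≫ (αᵣ m (𝟙_ A) B').hom := by
    simp
  simp only [transposeRight, contractRight, pairingToDual, comp_actionHomLeft, Category.assoc,
    reassoc_of% h₁, h₂, h₄, Iso.hom_inv_id_assoc, action_actionHomRight, h₃,
    actionHomRight_comp]

end ActionCoherence

/-! ### Functors of two variables and colimits of cocontinuous functors -/

section Bimap

variable {C D E : Type*} [Category* C] [Category* D] [Category* E]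

/-- The action of a functor of two variables on a pair of morphisms. -/
def bimap (T : C ⥤ D ⥤ E) {c c' : C} {d d' : D} (f : c ⟶ c') (g : d ⟶ d') :
    (T.obj c).obj d ⟶ (T.obj c').obj d' :=
  (T.map f).app d ≫ (T.obj c').map g

variable (T : C ⥤ D ⥤ E) {c c' c'' : C} {d d' d'' : D}

@[simp] lemma bimap_id_right (f : c ⟶ c') : bimap T f (𝟙 d) = (T.map f).app d := by simp [bimap]

@[simp] lemma bimap_id_left (g : d ⟶ d') : bimap T (𝟙 c) g = (T.obj c).map g := by simp [bimap]

lemma bimap_comp (f : c ⟶ c') (f' : c' ⟶ c'') (g : d ⟶ d') (g' : d' ⟶ d'') :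
    bimap T (f ≫ f') (g ≫ g') = bimap T f g ≫ bimap T f' g' := by
  simp [bimap]

lemma app_bimap (f : c ⟶ c') (f' : c' ⟶ c'') (g : d ⟶ d') :
    (T.map f).app d ≫ bimap T f' g = bimap T (f ≫ f') g := by
  simp [bimap]

lemma map_bimap (f : c ⟶ c') (g : d ⟶ d') (g' : d' ⟶ d'') :
    (T.obj c).map g ≫ bimap T f g' = bimap T f (g ≫ g') := by
  simp [bimap]

lemma bimap_app (f : c ⟶ c') (f' : c' ⟶ c'') (g : d ⟶ d') :
    bimap T f g ≫ (T.map f').app d' = bimap T (f ≫ f') g := by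
  simp [bimap]

lemma bimap_map (f : c ⟶ c') (g : d ⟶ d') (g' : d' ⟶ d'') :
    bimap T f g ≫ (T.obj c').map g' = bimap T f (g ≫ g') := by
  simp [bimap]

end Bimap

section ColimitOfCocontinuous

variable {k : Type w} [Field k] {C E : Type (w + 1)} [Category.{w} C] [Category.{w} E]
  [Preadditive C] [Preadditive E] [Linear k C] [Linear k E]

/-- A pointwise colimit of cocontinuous linear functors is cocontinuous and linear. -/
lemma IsCocontinuousLinear.comp_colim {J : Type*} [Category* J] [HasColimitsOfShape J E]
    (F : C ⥤ J ⥤ E) (hF : ∀ j, IsCocontinuousLinear k (F ⋙ (evaluation J E).obj j)) :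
    IsCocontinuousLinear k (F ⋙ colim) where
  additive := ⟨fun {X Y f g} => by
    refine colimit.hom_ext fun j => ?_
    have := (hF j).additive.map_add (f := f) (g := g)
    dsimp at this
    simp [this]⟩
  linear := ⟨fun {X Y} f r => by
    refine colimit.hom_ext fun j => ?_
    have := (hF j).linear.map_smul f r
    dsimp at this
    simp [this]⟩
  preservesColimits := by
    have : PreservesColimitsOfSize.{w, w} F := ⟨fun {K} _ =>
      preservesColimitsOfShape_of_evaluation F K
        fun j => (hF j).preservesColimits.preservesColimitsOfShape⟩
    infer_instance

lemma IsCocontinuousLinear.of_iso {F G : C ⥤ E} (hF : IsCocontinuousLinear k F) (e : F ≅ G) :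
    IsCocontinuousLinear k G where
  additive := ⟨fun {X Y f g} => by
    have := hF.additive
    have h (f : X ⟶ Y) : G.map f = e.inv.app X ≫ F.map f ≫ e.hom.app Y := by simp
    simp only [h, F.map_add, Preadditive.add_comp, Preadditive.comp_add]⟩
  linear := ⟨fun {X Y} f r => by
    have := hF.linear
    have h (f : X ⟶ Y) : G.map f = e.inv.app X ≫ F.map f ≫ e.hom.app Y := by simp
    simp only [h, F.map_smul, Linear.smul_comp, Linear.comp_smul]⟩
  preservesColimits :=
    have := hF.preservesColimits
    ⟨fun {_} _ => preservesColimitsOfShape_of_natIso e⟩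

end ColimitOfCocontinuous

/-! ### The bifunctor `N` as a colimit over pairings -/

section Pairings

variable (A : Type (w + 1)) [Category.{w} A] [MonoidalCategory A]

/-- The full subcategory of compact objects. -/
abbrev Compacts (A : Type (w + 1)) [Category.{w} A] : Type (w + 1) :=
  (ObjectProperty.isFinitelyPresentable.{w} A).FullSubcategory

/-- The tensor product of a pair of compact objects. -/
@[simps]
def compactTensor : Compacts A × Compacts A ⥤ A where
  obj z := z.1.obj ⊗ z.2.obj
  map f := f.1.hom ⊗ₘ f.2.hom

/-- The category of pairs of compact objects `X'`, `X` with a pairing `X' ⊗ X ⟶ 𝟙`. -/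
abbrev Pairing : Type (w + 1) := CostructuredArrow (compactTensor A) (𝟙_ A)

variable {A}

/-- The pairing given by `e : X' ⊗ X ⟶ 𝟙`. -/
abbrev Pairing.mk {X' X : A} (hX' : IsFinitelyPresentable.{w} X')
    (hX : IsFinitelyPresentable.{w} X) (e : X' ⊗ X ⟶ 𝟙_ A) : Pairing A :=
  CostructuredArrow.mk (S := compactTensor A)
    (Y := ((⟨X', hX'⟩, ⟨X, hX⟩) : Compacts A × Compacts A)) e

/-- A morphism of pairings. -/
abbrev Pairing.homMk {X' X Y' Y : A} {hX' : IsFinitelyPresentable.{w} X'}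
    {hX : IsFinitelyPresentable.{w} X} {hY' : IsFinitelyPresentable.{w} Y'}
    {hY : IsFinitelyPresentable.{w} Y} {e : X' ⊗ X ⟶ 𝟙_ A} {e' : Y' ⊗ Y ⟶ 𝟙_ A}
    (f : X' ⟶ Y') (g : X ⟶ Y) (h : (f ⊗ₘ g) ≫ e' = e) :
    Pairing.mk hX' hX e ⟶ Pairing.mk hY' hY e' :=
  CostructuredArrow.homMk (ObjectProperty.homMk f, ObjectProperty.homMk g) h

variable {C D P : Type (w + 1)} [Category.{w} C] [Category.{w} D] [Category.{w} P]
  [MonoidalRightAction A C] [MonoidalLeftAction A D]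

/-- The functor `(X', X, e) ↦ T (m ⊙ X', X ⊙ n)` at fixed `m` and `n`. -/
def pairingDiagramObj (T : C ⥤ D ⥤ P) (m : C) (n : D) : Pairing A ⥤ P where
  obj e := (T.obj (m ⊙ᵣ e.left.1.obj)).obj (e.left.2.obj ⊙ₗ n)
  map f := bimap T (m ⊴ᵣ f.left.1.hom) (f.left.2.hom ⊵ₗ n)
  map_id e := by
    change bimap T (m ⊴ᵣ 𝟙 _) (𝟙 _ ⊵ₗ n) = _
    rw [MonoidalRightAction.actionHomRight_id, MonoidalLeftAction.id_actionHomLeft, bimap_id_left,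
      CategoryTheory.Functor.map_id]
  map_comp f g := by
    rw [← bimap_comp, ← MonoidalRightAction.actionHomRight_comp,
      ← MonoidalLeftAction.comp_actionHomLeft]
    rfl

variable (A) in
/-- The functor `(X', X, e) ↦ T (m ⊙ X', X ⊙ n)`. -/
def pairingDiagram (T : C ⥤ D ⥤ P) : C ⥤ D ⥤ Pairing A ⥤ P where
  obj m :=
    { obj n := pairingDiagramObj T m n
      map g := { app e := (T.obj (m ⊙ᵣ e.left.1.obj)).map (e.left.2.obj ⊴ₗ g)
                 naturality _ _ f := by
                  dsimp only [pairingDiagramObj]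
                  rw [bimap_map, map_bimap, MonoidalLeftAction.action_exchange] }
      map_id n := by
        ext e
        exact ((T.obj _).congr_map (MonoidalLeftAction.actionHomRight_id _ _)).trans
          ((T.obj _).map_id _)
      map_comp f g := by
        ext e
        exact ((T.obj _).congr_map (MonoidalLeftAction.actionHomRight_comp _ _ _)).trans
          ((T.obj _).map_comp _ _) }
  map f := { app n := { app e := (T.map (f ⊵ᵣ e.left.1.obj)).app (e.left.2.obj ⊙ₗ n)
                        naturality _ _ f := by
                          dsimp only [pairingDiagramObj]
                          rw [bimap_app, app_bimap, MonoidalRightAction.action_exchange] }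
             naturality _ _ g := by
              ext e
              exact (T.map (f ⊵ᵣ e.left.1.obj)).naturality (e.left.2.obj ⊴ₗ g) }
  map_id m := by
    ext n e
    exact NatTrans.congr_app ((T.congr_map
      (MonoidalRightAction.id_actionHomLeft e.left.1.obj m)).trans (T.map_id _)) _
  map_comp f g := by
    ext n e
    exact NatTrans.congr_app ((T.congr_map
      (MonoidalRightAction.comp_actionHomLeft f g e.left.1.obj)).trans (T.map_comp _ _)) _

variable [IsLocallyFinitelyPresentable.{w} A]

instance : EssentiallySmall.{w} (Compacts A × Compacts A) :=
  EssentiallySmall.mk' ((equivSmallModel.{w} (Compacts A)).prod (equivSmallModel.{w} (Compacts A)))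

instance (E : Type (w + 1)) [Category.{w} E] [HasColimitsOfSize.{w, w} E] :
    HasColimitsOfShape (Pairing A) E :=
  hasColimitsOfShape_of_essentiallySmall.{w} _ _

variable [HasColimitsOfSize.{w, w} P]

variable (A) in
/-- The bifunctor `N (m, n) = colim T (m ⊙ X', X ⊙ n)` over all pairings `X' ⊗ X ⟶ 𝟙`. -/
noncomputable def balancedCompletion (T : C ⥤ D ⥤ P) : C ⥤ D ⥤ P :=
  pairingDiagram A T ⋙ (Functor.whiskeringRight D _ _).obj colim

/-- For each fixed pairing the diagram is `T` precomposed with actions by fixed objects, hence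
cocontinuous in each variable, and colimits commute with colimits. -/
lemma balancedCompletion_bilinear {k : Type w} [Field k] [Preadditive A] [Linear k A]
    [Preadditive C] [Preadditive D] [Preadditive P] [Linear k C] [Linear k D] [Linear k P]
    (hC : IsRightModuleCategory k A C) (hD : IsLeftModuleCategory k A D)
    {T : C ⥤ D ⥤ P} (hT : IsBicocontinuousBilinear k T) :
    IsBicocontinuousBilinear k (balancedCompletion A T) where
  right m := IsCocontinuousLinear.comp_colim _ fun e =>
    (hD.action.right e.left.2.obj).comp (hT.right (m ⊙ᵣ e.left.1.obj))
  left n := IsCocontinuousLinear.comp_colim ((pairingDiagram A T).flip.obj n) fun e =>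
    (hC.action.right e.left.1.obj).comp (hT.left (e.left.2.obj ⊙ₗ n))

/-- The inclusion of the component of a pairing. -/
noncomputable def pairingι (T : C ⥤ D ⥤ P) (m : C) (n : D) {X' X : A}
    (hX' : IsFinitelyPresentable.{w} X') (hX : IsFinitelyPresentable.{w} X) (e : X' ⊗ X ⟶ 𝟙_ A) :
    (T.obj (m ⊙ᵣ X')).obj (X ⊙ₗ n) ⟶ ((balancedCompletion A T).obj m).obj n :=
  colimit.ι (((pairingDiagram A T).obj m).obj n) (Pairing.mk hX' hX e)

variable (T : C ⥤ D ⥤ P) {m m' : C} {n n' : D} {X' X Y' Y : A}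
    (hX' : IsFinitelyPresentable.{w} X') (hX : IsFinitelyPresentable.{w} X)
    (hY' : IsFinitelyPresentable.{w} Y') (hY : IsFinitelyPresentable.{w} Y)

lemma pairingι_w (f : X' ⟶ Y') (g : X ⟶ Y) (e : Y' ⊗ Y ⟶ 𝟙_ A) (e' : X' ⊗ X ⟶ 𝟙_ A)
    (h : (f ⊗ₘ g) ≫ e = e') :
    bimap T (m ⊴ᵣ f) (g ⊵ₗ n) ≫ pairingι T m n hY' hY e = pairingι T m n hX' hX e' :=
  colimit.w (((pairingDiagram A T).obj m).obj n)
    (Pairing.homMk (hX' := hX') (hX := hX) (hY' := hY') (hY := hY) f g h)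

lemma pairingι_naturality_left (f : m ⟶ m') (e : X' ⊗ X ⟶ 𝟙_ A) :
    pairingι T m n hX' hX e ≫ ((balancedCompletion A T).map f).app n =
      (T.map (f ⊵ᵣ X')).app (X ⊙ₗ n) ≫ pairingι T m' n hX' hX e :=
  colimit.ι_map (((pairingDiagram A T).map f).app n) (Pairing.mk hX' hX e)

lemma pairingι_naturality_right (g : n ⟶ n') (e : X' ⊗ X ⟶ 𝟙_ A) :
    pairingι T m n hX' hX e ≫ ((balancedCompletion A T).obj m).map g =
      (T.obj (m ⊙ᵣ X')).map (X ⊴ₗ g) ≫ pairingι T m n' hX' hX e :=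
  colimit.ι_map (((pairingDiagram A T).obj m).map g) (Pairing.mk hX' hX e)

end Pairings

/-! ### Duals are compact -/

section Duals

attribute [local instance] Cardinal.fact_isRegular_aleph0

variable {k : Type w} [Field k] {A : Type (w + 1)} [Category.{w} A] [Preadditive A] [Linear k A]
  [MonoidalCategory A] (hA : IsTensorCategory k A)

-- Tensoring with `B'` on the left is left adjoint to tensoring with `B`, which preserves filtered
-- colimits; so it preserves compact objects, and `B' ≅ B' ⊗ 𝟙`.
include hA in
lemma IsTensorCategory.isFinitelyPresentable_of_exactPairing [IsLocallyFinitelyPresentable.{w} A]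
    (B B' : A) [ExactPairing B B'] :
    IsFinitelyPresentable.{w} B' := by
  have := hA.unit_compact
  have := (hA.tensor.right B).preservesColimits
  have : (tensorLeft B).IsCardinalAccessible Cardinal.aleph0.{w} :=
    ⟨fun J _ _ => inferInstanceAs (PreservesColimitsOfShape J ((curriedTensor A).obj B))⟩
  have : IsCardinalPresentable (B' ⊗ 𝟙_ A) Cardinal.aleph0.{w} :=
    (tensorLeftAdjunction B B').isCardinalPresentable_leftAdjoint_obj Cardinal.aleph0 (𝟙_ A)
  exact isCardinalPresentable_of_iso (ρ_ B') _

end Duals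

/-! ### The components of `N` indexed by `c ⊙ B ⟶ m` -/

section BalancedInclusions

variable {k : Type w} [Field k] {A C D P : Type (w + 1)} [Category.{w} A] [Category.{w} C]
  [Category.{w} D] [Category.{w} P]
  [MonoidalCategory A] [MonoidalRightAction A C] [MonoidalLeftAction A D]
  [IsLocallyFinitelyPresentable.{w} A] [HasColimitsOfSize.{w, w} P]

/-- The morphism `T (c, B ⊙ n) ⟶ N (m, n)` given by `c ⊙ B ⟶ m` and a dual `B'` of `B`. -/
noncomputable def balancedιAux (T : C ⥤ D ⥤ P) {c m : C} (n : D) {B B' : A} [ExactPairing B B']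
    (hB : IsFinitelyPresentable.{w} B) (hB' : IsFinitelyPresentable.{w} B') (φ : c ⊙ᵣ B ⟶ m) :
    (T.obj c).obj (B ⊙ₗ n) ⟶ ((balancedCompletion A T).obj m).obj n :=
  (T.map (transposeRight B' φ)).app (B ⊙ₗ n) ≫ pairingι T m n hB' hB (ε_ B B')

variable (T : C ⥤ D ⥤ P)

/-- By `pairingToDual_evaluation` the pairing maps to `(B', B, ε)`, and the transpose of its
contraction is the corresponding map `X' ⟶ B'`. In particular the choice of `B'` is immaterial. -/
lemma pairingι_eq_balancedιAux (m : C) (n : D) {X' B B' : A} [ExactPairing B B']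
    (hX' : IsFinitelyPresentable.{w} X') (hB : IsFinitelyPresentable.{w} B)
    (hB' : IsFinitelyPresentable.{w} B') (e : X' ⊗ B ⟶ 𝟙_ A) :
    pairingι T m n hX' hB e = balancedιAux T n hB hB' (contractRight m e) := by
  rw [balancedιAux, transposeRight_contractRight_eq,
    ← pairingι_w T hX' hB hB' hB (pairingToDual B' e) (𝟙 B) (ε_ B B') e
      (by rw [tensorHom_id, pairingToDual_evaluation]),
    MonoidalLeftAction.id_actionHomLeft, bimap_id_right]

lemma app_balancedιAux {c c' m : C} (n : D) {B B' : A} [ExactPairing B B']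
    (hB : IsFinitelyPresentable.{w} B) (hB' : IsFinitelyPresentable.{w} B')
    (f : c' ⟶ c) (φ : c ⊙ᵣ B ⟶ m) :
    (T.map f).app (B ⊙ₗ n) ≫ balancedιAux T n hB hB' φ =
      balancedιAux T n hB hB' (f ⊵ᵣ B ≫ φ) := by
  rw [balancedιAux, balancedιAux, ← transposeRight_naturality, T.map_comp, NatTrans.comp_app,
    Category.assoc]

variable [Preadditive A] [Linear k A] (hA : IsTensorCategory k A)

/-- The morphism `T (c, B ⊙ n) ⟶ N (m, n)` given by `c ⊙ B ⟶ m`, for a compact object `B`. -/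
noncomputable def balancedι {c m : C} (n : D) {B : A} (hB : IsFinitelyPresentable.{w} B)
    (φ : c ⊙ᵣ B ⟶ m) :
    (T.obj c).obj (B ⊙ₗ n) ⟶ ((balancedCompletion A T).obj m).obj n :=
  letI : HasRightDual B := Classical.choice (hA.right_dual B hB)
  balancedιAux T n hB
    (hA.isFinitelyPresentable_of_exactPairing B (HasRightDual.rightDual B)) φ

lemma app_balancedι {c c' m : C} (n : D) {B : A} (hB : IsFinitelyPresentable.{w} B)
    (f : c' ⟶ c) (φ : c ⊙ᵣ B ⟶ m) :
    (T.map f).app (B ⊙ₗ n) ≫ balancedι T hA n hB φ = balancedι T hA n hB (f ⊵ᵣ B ≫ φ) := by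
  apply app_balancedιAux

lemma pairingι_eq_balancedι (m : C) (n : D) {X' B : A} (hX' : IsFinitelyPresentable.{w} X')
    (hB : IsFinitelyPresentable.{w} B) (e : X' ⊗ B ⟶ 𝟙_ A) :
    pairingι T m n hX' hB e = balancedι T hA n hB (contractRight m e) := by
  apply pairingι_eq_balancedιAux

/-- Compatibility in `B`. The chosen duals of `B` and `B₁` are unrelated, so the comparison passes
through the pairing of `B₁'` with `B` induced by `g`, which `pairingι_eq_balancedι` rewrites in
terms of `B` alone. -/
lemma map_balancedι {c m : C} (n : D) {B B₁ : A} (hB : IsFinitelyPresentable.{w} B)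
    (hB₁ : IsFinitelyPresentable.{w} B₁) (g : B ⟶ B₁) (φ : c ⊙ᵣ B₁ ⟶ m) :
    (T.obj c).map (g ⊵ₗ n) ≫ balancedι T hA n hB₁ φ = balancedι T hA n hB (c ⊴ᵣ g ≫ φ) := by
  let _ : HasRightDual B₁ := Classical.choice (hA.right_dual B₁ hB₁)
  have hB' : IsFinitelyPresentable.{w} (HasRightDual.rightDual B₁) :=
    hA.isFinitelyPresentable_of_exactPairing B₁ _
  change (T.obj c).map (g ⊵ₗ n) ≫ balancedιAux T n hB₁ hB' φ = _
  have h := pairingι_w T (m := m) (n := n) hB' hB hB' hB₁ (𝟙 _) g (ε_ B₁ _) _ rfl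
  rw [MonoidalRightAction.actionHomRight_id, bimap_id_left] at h
  rw [balancedιAux, NatTrans.naturality_assoc, h, pairingι_eq_balancedι T hA, app_balancedι,
    contractRight_dinaturality, MonoidalRightAction.actionHomRight_id,
    MonoidalRightAction.id_actionHomLeft, Category.id_comp,
    ← MonoidalRightAction.action_exchange_assoc, transposeRight_contractRight]

lemma balancedι_naturality_left {c m m' : C} (n : D) {B : A} (hB : IsFinitelyPresentable.{w} B)
    (φ : c ⊙ᵣ B ⟶ m) (h : m ⟶ m') :
    balancedι T hA n hB φ ≫ ((balancedCompletion A T).map h).app n =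
      balancedι T hA n hB (φ ≫ h) := by
  simp only [balancedι, balancedιAux]
  rw [Category.assoc, pairingι_naturality_left, transposeRight_comp, T.map_comp, NatTrans.comp_app,
    Category.assoc]

lemma balancedι_naturality_right {c m : C} {n n' : D} {B : A} (hB : IsFinitelyPresentable.{w} B)
    (φ : c ⊙ᵣ B ⟶ m) (g : n ⟶ n') :
    balancedι T hA n hB φ ≫ ((balancedCompletion A T).obj m).map g =
      (T.obj c).map (B ⊴ₗ g) ≫ balancedι T hA n' hB φ := by
  simp only [balancedι, balancedιAux]
  rw [Category.assoc, pairingι_naturality_right, NatTrans.naturality_assoc]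

variable {E : Type (w + 1)} [Category.{w} E] (F : P ⥤ E) [PreservesColimitsOfSize.{w, w} F]

instance : PreservesColimitsOfShape (Pairing A) F :=
  preservesColimitsOfShape_of_equiv (equivSmallModel.{w} (Pairing A)).symm F

variable {T}

-- The universal property is stated after applying a cocontinuous `F`: the case `F = 𝟭 P` yields the
-- balancing of `N`, the case `F = μ` the counit.
omit [Preadditive A] [Linear k A] in
lemma pairingι_hom_ext {m : C} {n : D} {p : E}
    {f g : F.obj (((balancedCompletion A T).obj m).obj n) ⟶ p}
    (h : ∀ (X' X : A) (hX' : IsFinitelyPresentable.{w} X') (hX : IsFinitelyPresentable.{w} X)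
      (e : X' ⊗ X ⟶ 𝟙_ A),
      F.map (pairingι T m n hX' hX e) ≫ f = F.map (pairingι T m n hX' hX e) ≫ g) : f = g :=
  (isColimitOfPreserves F (colimit.isColimit (((pairingDiagram A T).obj m).obj n))).hom_ext
    fun e => h _ _ e.left.1.property e.left.2.property e.hom

omit [Preadditive A] [Linear k A] in
lemma pairingι_exists_desc {m : C} {n : D} {p : E}
    (θ : ∀ (X' X : A) (_ : IsFinitelyPresentable.{w} X') (_ : IsFinitelyPresentable.{w} X)
      (_ : X' ⊗ X ⟶ 𝟙_ A), F.obj ((T.obj (m ⊙ᵣ X')).obj (X ⊙ₗ n)) ⟶ p)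
    (hθ : ∀ (X' X Y' Y : A) (hX' : IsFinitelyPresentable.{w} X')
      (hX : IsFinitelyPresentable.{w} X) (hY' : IsFinitelyPresentable.{w} Y')
      (hY : IsFinitelyPresentable.{w} Y) (f : X' ⟶ Y') (g : X ⟶ Y) (e : Y' ⊗ Y ⟶ 𝟙_ A),
      F.map (bimap T (m ⊴ᵣ f) (g ⊵ₗ n)) ≫ θ Y' Y hY' hY e = θ X' X hX' hX ((f ⊗ₘ g) ≫ e)) :
    ∃ f : F.obj (((balancedCompletion A T).obj m).obj n) ⟶ p,
      ∀ (X' X : A) (hX' : IsFinitelyPresentable.{w} X') (hX : IsFinitelyPresentable.{w} X)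
        (e : X' ⊗ X ⟶ 𝟙_ A), F.map (pairingι T m n hX' hX e) ≫ f = θ X' X hX' hX e :=
  let s : Cocone ((((pairingDiagram A T).obj m).obj n) ⋙ F) :=
    { pt := p
      ι :=
        { app e := θ _ _ e.left.1.property e.left.2.property e.hom
          naturality e e' f :=
            (hθ _ _ _ _ e.left.1.property e.left.2.property e'.left.1.property
              e'.left.2.property f.left.1.hom f.left.2.hom e'.hom).trans
              ((congrArg (θ _ _ e.left.1.property e.left.2.property) (CostructuredArrow.w f)).trans
                (Category.comp_id _).symm) } }
  let hc := isColimitOfPreserves F (colimit.isColimit (((pairingDiagram A T).obj m).obj n))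
  ⟨hc.desc s, fun _ _ hX' hX e => hc.fac s (Pairing.mk hX' hX e)⟩

lemma balancedCompletion_hom_ext {m : C} {n : D} {p : E}
    {f g : F.obj (((balancedCompletion A T).obj m).obj n) ⟶ p}
    (h : ∀ (c : C) (B : A) (hB : IsFinitelyPresentable.{w} B) (φ : c ⊙ᵣ B ⟶ m),
      F.map (balancedι T hA n hB φ) ≫ f = F.map (balancedι T hA n hB φ) ≫ g) : f = g :=
  pairingι_hom_ext F fun X' X hX' hX e => by
    rw [pairingι_eq_balancedι T hA m n hX']
    exact h _ _ _ _

-- Reindexes the colimit by the morphisms `φ : c ⊙ B ⟶ m`. A family `Θ` is determined by its values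
-- on contractions, because every `φ` is a contraction precomposed with its own transpose.
include hA in
lemma balancedCompletion_exists_desc {m : C} {n : D} {p : E}
    (Θ : ∀ (c : C) (B : A) (_ : IsFinitelyPresentable.{w} B) (_ : c ⊙ᵣ B ⟶ m),
      F.obj ((T.obj c).obj (B ⊙ₗ n)) ⟶ p)
    (h₁ : ∀ (c c' : C) (B : A) (hB : IsFinitelyPresentable.{w} B) (f : c' ⟶ c) (φ : c ⊙ᵣ B ⟶ m),
      F.map ((T.map f).app (B ⊙ₗ n)) ≫ Θ c B hB φ = Θ c' B hB (f ⊵ᵣ B ≫ φ))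
    (h₂ : ∀ (c : C) (B B₁ : A) (hB : IsFinitelyPresentable.{w} B)
      (hB₁ : IsFinitelyPresentable.{w} B₁) (g : B ⟶ B₁) (φ : c ⊙ᵣ B₁ ⟶ m),
      F.map ((T.obj c).map (g ⊵ₗ n)) ≫ Θ c B₁ hB₁ φ = Θ c B hB (c ⊴ᵣ g ≫ φ)) :
    ∃ f : F.obj (((balancedCompletion A T).obj m).obj n) ⟶ p,
      ∀ (c : C) (B : A) (hB : IsFinitelyPresentable.{w} B) (φ : c ⊙ᵣ B ⟶ m),
        F.map (balancedι T hA n hB φ) ≫ f = Θ c B hB φ := by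
  obtain ⟨f, hf⟩ := pairingι_exists_desc (T := T) F (m := m) (n := n)
    -- The cocone condition is dinaturality of contractions together with `h₁` and `h₂`.
    (fun X' X _ hX e => Θ _ X hX (contractRight m e)) (by
      intro X' X Y' Y hX' hX hY' hY f g e
      rw [contractRight_dinaturality, bimap, F.map_comp, Category.assoc, h₂ _ _ _ hX, h₁])
  refine ⟨f, fun c B hB φ => ?_⟩
  let _ : HasRightDual B := Classical.choice (hA.right_dual B hB)
  have hB' : IsFinitelyPresentable.{w} (HasRightDual.rightDual B) :=
    hA.isFinitelyPresentable_of_exactPairing B (HasRightDual.rightDual B)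
  change F.map (balancedιAux T n hB hB' φ) ≫ _ = _
  rw [balancedιAux, F.map_comp, Category.assoc, hf, h₁, transposeRight_contractRight]

end BalancedInclusions

/-! ### Lax balancings by compact objects are invertible -/

section CompactBalancing

/-- A lax balancing, defined only on the compact objects of `A`. -/
structure CompactBalancing (A : Type (w + 1)) {C D E : Type (w + 1)}
    [Category.{w} A] [Category.{w} C] [Category.{w} D] [Category.{w} E]
    [MonoidalCategory A] [MonoidalRightAction A C] [MonoidalLeftAction A D]
    (F : C ⥤ D ⥤ E) where
  hom (m : C) {Y : A} (hY : IsFinitelyPresentable.{w} Y) (n : D) :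
    (F.obj m).obj (Y ⊙ₗ n) ⟶ (F.obj (m ⊙ᵣ Y)).obj n
  naturality_left {m m' : C} (f : m ⟶ m') {Y : A} (hY : IsFinitelyPresentable.{w} Y) (n : D) :
    (F.map f).app (Y ⊙ₗ n) ≫ hom m' hY n = hom m hY n ≫ (F.map (f ⊵ᵣ Y)).app n
  naturality_middle (m : C) {Y Y' : A} (hY : IsFinitelyPresentable.{w} Y)
    (hY' : IsFinitelyPresentable.{w} Y') (f : Y ⟶ Y') (n : D) :
    (F.obj m).map (f ⊵ₗ n) ≫ hom m hY' n = hom m hY n ≫ (F.map (m ⊴ᵣ f)).app n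
  naturality_right (m : C) {Y : A} (hY : IsFinitelyPresentable.{w} Y) {n n' : D} (f : n ⟶ n') :
    (F.obj m).map (Y ⊴ₗ f) ≫ hom m hY n' = hom m hY n ≫ (F.obj (m ⊙ᵣ Y)).map f
  pentagon (m : C) {X Y : A} (hX : IsFinitelyPresentable.{w} X) (hY : IsFinitelyPresentable.{w} Y)
    (hXY : IsFinitelyPresentable.{w} (X ⊗ Y)) (n : D) :
    hom m hX (Y ⊙ₗ n) ≫ hom (m ⊙ᵣ X) hY n =
      (F.obj m).map (αₗ X Y n).inv ≫ hom m hXY n ≫ (F.map (αᵣ m X Y).hom).app n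
  unit (m : C) (h : IsFinitelyPresentable.{w} (𝟙_ A)) (n : D) :
    hom m h n ≫ (F.map (ρᵣ m).hom).app n = (F.obj m).map (λₗ n).hom

variable {k : Type w} [Field k] {A C D E : Type (w + 1)} [Category.{w} A] [Category.{w} C]
  [Category.{w} D] [Category.{w} E] [Preadditive A] [Linear k A]
  [MonoidalCategory A] [MonoidalRightAction A C] [MonoidalLeftAction A D]

-- Mirror image of the previous compactness argument: tensoring with `B` on the right is left
-- adjoint to tensoring with `B'`.
attribute [local instance] Cardinal.fact_isRegular_aleph0 in
lemma IsTensorCategory.isFinitelyPresentable_of_exactPairing_left (hA : IsTensorCategory k A)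
    [IsLocallyFinitelyPresentable.{w} A] (B B' : A) [ExactPairing B B'] :
    IsFinitelyPresentable.{w} B := by
  have := hA.unit_compact
  have := (hA.tensor.left B').preservesColimits
  have : (tensorRight B').IsCardinalAccessible Cardinal.aleph0.{w} :=
    ⟨fun J _ _ => inferInstanceAs (PreservesColimitsOfShape J ((curriedTensor A).flip.obj B'))⟩
  have : IsCardinalPresentable (𝟙_ A ⊗ B) Cardinal.aleph0.{w} :=
    (tensorRightAdjunction B B').isCardinalPresentable_leftAdjoint_obj Cardinal.aleph0 (𝟙_ A)
  exact isCardinalPresentable_of_iso (λ_ B) _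

variable {F : C ⥤ D ⥤ E} (b : CompactBalancing A F)

/-- Lax structure maps are automatically invertible at objects with a left dual. The inverse is `F
(m ⊙ Y, n) ⟶ F (m ⊙ Y, X ⊙ Y ⊙ n) ⟶ F ((m ⊙ Y) ⊙ X, Y ⊙ n) ⟶ F (m, Y ⊙ n)`: coevaluation, the
structure map for `X`, evaluation. -/
lemma CompactBalancing.isIso_hom_of_exactPairing (hA : IsTensorCategory k A) (m : C) {Y : A}
    (X : A) [ExactPairing X Y] (hY : IsFinitelyPresentable.{w} Y)
    (hX : IsFinitelyPresentable.{w} X) (n : D) : IsIso (b.hom m hY n) := by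
  have hu := hA.unit_compact
  have hXY : IsFinitelyPresentable.{w} (X ⊗ Y) := hA.tensor_compact X Y hX hY
  have hYX : IsFinitelyPresentable.{w} (Y ⊗ X) := hA.tensor_compact Y X hY hX
  let coev : n ⟶ X ⊙ₗ Y ⊙ₗ n := (λₗ[A] n).inv ≫ (η_ X Y) ⊵ₗ n ≫ (αₗ X Y n).hom
  let ev : (m ⊙ᵣ Y) ⊙ᵣ X ⟶ m := contractRight m (ε_ X Y)
  refine ⟨(F.obj (m ⊙ᵣ Y)).map coev ≫ b.hom (m ⊙ᵣ Y) hX (Y ⊙ₗ n) ≫ (F.map ev).app (Y ⊙ₗ n),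
    ?_, ?_⟩
  -- The two structure maps merge into the one for `Y ⊗ X`; naturality moves the evaluation to the
  -- side of `D`, where the zigzag applies.
  · rw [← reassoc_of% b.naturality_right, reassoc_of% b.pentagon m hY hX hYX,
      ← NatTrans.comp_app, ← F.map_comp]
    have : (αᵣ m Y X).hom ≫ ev = m ⊴ᵣ (ε_ X Y) ≫ (ρᵣ[A] m).hom := by simp [ev, contractRight]
    rw [this, F.map_comp, NatTrans.comp_app, ← reassoc_of% b.naturality_middle m hYX hu, b.unit]
    simp only [← CategoryTheory.Functor.map_comp]
    rw [leftAction_zigzag n X, CategoryTheory.Functor.map_id]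
  -- Symmetrically, the coevaluation is moved to the side of `C`.
  · rw [Category.assoc, Category.assoc, b.naturality_left, reassoc_of% b.pentagon _ hX hY hXY,
      ← NatTrans.comp_app, ← F.map_comp, ← CategoryTheory.Functor.map_comp_assoc]
    have : coev ≫ (αₗ X Y n).inv = (λₗ[A] n).inv ≫ (η_ X Y) ⊵ₗ n := by simp [coev]
    rw [this, CategoryTheory.Functor.map_comp, Category.assoc,
      reassoc_of% b.naturality_middle _ hu hXY, ← NatTrans.comp_app, ← F.map_comp]
    have h := b.unit (m ⊙ᵣ Y) hu n
    rw [← cancel_mono ((F.map (ρᵣ[A] (m ⊙ᵣ Y)).inv).app n), Category.assoc, ← NatTrans.comp_app,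
      ← F.map_comp, Iso.hom_inv_id, F.map_id, NatTrans.id_app, Category.comp_id] at h
    rw [h, Category.assoc, ← NatTrans.comp_app, ← F.map_comp, contractRight_transposeRight,
      F.map_id, NatTrans.id_app, Category.comp_id, ← CategoryTheory.Functor.map_comp,
      Iso.inv_hom_id, CategoryTheory.Functor.map_id]

variable [IsLocallyFinitelyPresentable.{w} A] in
lemma CompactBalancing.isIso_hom (hA : IsTensorCategory k A) (m : C) {Y : A}
    (hY : IsFinitelyPresentable.{w} Y) (n : D) : IsIso (b.hom m hY n) := by
  let _ : HasLeftDual Y := Classical.choice (hA.left_dual Y hY)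
  exact b.isIso_hom_of_exactPairing hA m (HasLeftDual.leftDual Y) hY
    (hA.isFinitelyPresentable_of_exactPairing_left _ Y) n

end CompactBalancing

/-! ### The balancing of `N` -/

section Completion

variable {k : Type w} [Field k] {A C D P : Type (w + 1)} [Category.{w} A] [Category.{w} C]
  [Category.{w} D] [Category.{w} P] [Preadditive A] [Linear k A]
  [MonoidalCategory A] [MonoidalRightAction A C] [MonoidalLeftAction A D]
  [IsLocallyFinitelyPresentable.{w} A] [HasColimitsOfSize.{w, w} P]
  (hA : IsTensorCategory k A) (T : C ⥤ D ⥤ P)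

/-- The component of `φ : c ⊙ B ⟶ m` goes to that of `φ ⊵ᵣ Y`, seen as a morphism out of `c ⊙ (B ⊗
Y)`. Indexing by `φ` instead of by pairings makes this formula free of duals. -/
lemma exists_balancedCompletion_hom (m : C) {Y : A} (hY : IsFinitelyPresentable.{w} Y) (n : D) :
    ∃ f : ((balancedCompletion A T).obj m).obj (Y ⊙ₗ n) ⟶
        ((balancedCompletion A T).obj (m ⊙ᵣ Y)).obj n,
      ∀ (c : C) (B : A) (hB : IsFinitelyPresentable.{w} B) (φ : c ⊙ᵣ B ⟶ m),
        balancedι T hA (Y ⊙ₗ n) hB φ ≫ f = (T.obj c).map (αₗ B Y n).inv ≫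
          balancedι T hA n (hA.tensor_compact B Y hB hY) ((αᵣ c B Y).hom ≫ φ ⊵ᵣ Y) := by
  refine balancedCompletion_exists_desc hA (𝟭 P) (fun c B hB φ => (T.obj c).map (αₗ B Y n).inv ≫
          balancedι T hA n (hA.tensor_compact B Y hB hY) ((αᵣ c B Y).hom ≫ φ ⊵ᵣ Y)) ?_ ?_
  · intro c c' B hB f φ
    dsimp
    rw [← NatTrans.naturality_assoc, app_balancedι]
    simp
  · intro c B B₁ hB hB₁ g φ
    dsimp
    have h : g ⊵ₗ (Y ⊙ₗ n) ≫ (αₗ B₁ Y n).inv = (αₗ B Y n).inv ≫ (g ▷ Y) ⊵ₗ n := by simp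
    rw [← CategoryTheory.Functor.map_comp_assoc, h, CategoryTheory.Functor.map_comp_assoc,
      map_balancedι T hA n (hA.tensor_compact B Y hB hY) (hA.tensor_compact B₁ Y hB₁ hY)]
    simp

/-- The morphism `N (m, Y ⊙ n) ⟶ N (m ⊙ Y, n)`. -/
noncomputable def balancedCompletionHom (m : C) {Y : A} (hY : IsFinitelyPresentable.{w} Y)
    (n : D) : ((balancedCompletion A T).obj m).obj (Y ⊙ₗ n) ⟶
      ((balancedCompletion A T).obj (m ⊙ᵣ Y)).obj n :=
  (exists_balancedCompletion_hom hA T m hY n).choose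

lemma balancedι_balancedCompletionHom {m : C} {Y : A} (hY : IsFinitelyPresentable.{w} Y) (n : D)
    {c : C} {B : A} (hB : IsFinitelyPresentable.{w} B) (φ : c ⊙ᵣ B ⟶ m) :
    balancedι T hA (Y ⊙ₗ n) hB φ ≫ balancedCompletionHom hA T m hY n =
      (T.obj c).map (αₗ B Y n).inv ≫
        balancedι T hA n (hA.tensor_compact B Y hB hY) ((αᵣ c B Y).hom ≫ φ ⊵ᵣ Y) :=
  (exists_balancedCompletion_hom hA T m hY n).choose_spec c B hB φ

/-- The bifunctor `N` has a balancing by compact objects. -/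
noncomputable def balancedCompletionBalancing : CompactBalancing A (balancedCompletion A T) where
  hom m _ hY n := balancedCompletionHom hA T m hY n
  naturality_left f Y hY n := by
    refine balancedCompletion_hom_ext hA (𝟭 P) fun c B hB φ => ?_
    dsimp
    rw [reassoc_of% balancedι_naturality_left, balancedι_balancedCompletionHom,
      reassoc_of% balancedι_balancedCompletionHom, balancedι_naturality_left]
    simp
  naturality_middle m Y Y' hY hY' f n := by
    refine balancedCompletion_hom_ext hA (𝟭 P) fun c B hB φ => ?_
    dsimp
    rw [reassoc_of% balancedι_naturality_right, balancedι_balancedCompletionHom,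
      reassoc_of% balancedι_balancedCompletionHom, balancedι_naturality_left]
    have h : B ⊴ₗ f ⊵ₗ n ≫ (αₗ B Y' n).inv = (αₗ B Y n).inv ≫ (B ◁ f) ⊵ₗ n := by simp
    rw [← CategoryTheory.Functor.map_comp_assoc, h, CategoryTheory.Functor.map_comp_assoc,
      map_balancedι T hA n (hA.tensor_compact B Y hB hY) (hA.tensor_compact B Y' hB hY')]
    simp only [Category.assoc, MonoidalRightAction.whiskerRight_actionHomLeft, Iso.inv_hom_id_assoc]
    rw [MonoidalRightAction.action_exchange]
  naturality_right m Y hY n n' f := by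
    refine balancedCompletion_hom_ext hA (𝟭 P) fun c B hB φ => ?_
    dsimp
    rw [reassoc_of% balancedι_naturality_right, balancedι_balancedCompletionHom,
      reassoc_of% balancedι_balancedCompletionHom, balancedι_naturality_right,
      ← CategoryTheory.Functor.map_comp_assoc, ← CategoryTheory.Functor.map_comp_assoc]
    simp
  pentagon m X Y hX hY hXY n := by
    refine balancedCompletion_hom_ext hA (𝟭 P) fun c B hB φ => ?_
    dsimp
    have hBX := hA.tensor_compact B X hB hX
    have hBXY := hA.tensor_compact (B ⊗ X) Y hBX hY
    have hBXY' := hA.tensor_compact B (X ⊗ Y) hB hXY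
    rw [reassoc_of% balancedι_balancedCompletionHom, balancedι_balancedCompletionHom,
      reassoc_of% balancedι_naturality_right, reassoc_of% balancedι_balancedCompletionHom,
      balancedι_naturality_left]
    -- One side lands in the component of `(B ⊗ X) ⊗ Y`, the other in that of `B ⊗ (X ⊗ Y)`. The
    -- associator of `A` identifies them, by the pentagons of the left action (`h`) and of the right
    -- action (`h'`).
    have h : (αₗ B X (Y ⊙ₗ n)).inv ≫ (αₗ (B ⊗ X) Y n).inv =
        (B ⊴ₗ (αₗ X Y n).inv ≫ (αₗ B (X ⊗ Y) n).inv) ≫ (α_ B X Y).inv ⊵ₗ n := by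
      rw [← cancel_mono ((α_ B X Y).hom ⊵ₗ n), ← cancel_mono (αₗ B (X ⊗ Y) n).hom,
        ← cancel_mono (B ⊴ₗ (αₗ X Y n).hom)]
      simp
    rw [← CategoryTheory.Functor.map_comp_assoc, ← CategoryTheory.Functor.map_comp_assoc, h,
      CategoryTheory.Functor.map_comp_assoc, map_balancedι T hA n hBXY' hBXY]
    congr 2
    have h' : c ⊴ᵣ (α_ B X Y).inv ≫ (αᵣ c (B ⊗ X) Y).hom ≫ (αᵣ c B X).hom ⊵ᵣ Y =
        (αᵣ c B (X ⊗ Y)).hom ≫ (αᵣ (c ⊙ᵣ B) X Y).hom := by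
      rw [← MonoidalRightAction.actionHom_associator, MonoidalRightAction.actionHomRight_inv_hom_assoc]
    rw [MonoidalRightAction.comp_actionHomLeft, reassoc_of% h']
    simp
  unit m h n := by
    refine balancedCompletion_hom_ext hA (𝟭 P) fun c B hB φ => ?_
    dsimp
    rw [reassoc_of% balancedι_balancedCompletionHom, balancedι_naturality_left,
      balancedι_naturality_right]
    have h' : (αₗ B (𝟙_ A) n).inv ≫ (ρ_ B).hom ⊵ₗ n = B ⊴ₗ (λₗ n).hom := by simp
    rw [← h', CategoryTheory.Functor.map_comp_assoc,
      map_balancedι T hA n (hA.tensor_compact B _ hB h) hB]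
    simp

end Completion

/-! ### Extending natural transformations from dense subcategories -/

section Dense

variable {a A E : Type*} [Category* a] [Category* A] [Category* E] (ι : a ⥤ A) [ι.IsDense]
  (F G : A ⥤ E) [∀ X, PreservesColimit (CostructuredArrow.proj ι X ⋙ ι) F]

lemma dense_hom_ext {X : A} {e : E} {f g : F.obj X ⟶ e}
    (h : ∀ (Y : a) (φ : ι.obj Y ⟶ X), F.map φ ≫ f = F.map φ ≫ g) : f = g :=
  (isColimitOfPreserves F (ι.denseAt X)).hom_ext fun φ => by
    have := h _ φ.hom
    rw [← Category.id_comp φ.hom] at this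
    exact this

lemma dense_exists_desc {X : A} {e : E} (θ : ∀ (Y : a) (_ : ι.obj Y ⟶ X), F.obj (ι.obj Y) ⟶ e)
    (hθ : ∀ (Y Y' : a) (f : Y ⟶ Y') (φ : ι.obj Y' ⟶ X),
      F.map (ι.map f) ≫ θ Y' φ = θ Y (ι.map f ≫ φ)) :
    ∃ f : F.obj X ⟶ e, ∀ (Y : a) (φ : ι.obj Y ⟶ X), F.map φ ≫ f = θ Y φ := by
  let s : Cocone ((CostructuredArrow.proj ι X ⋙ ι) ⋙ F) :=
    { pt := e
      ι :=
        { app φ := θ φ.left φ.hom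
          naturality φ ψ f :=
            (hθ _ _ f.left ψ.hom).trans
              ((congrArg (θ φ.left) (CostructuredArrow.w f)).trans (Category.comp_id _).symm) } }
  refine ⟨(isColimitOfPreserves F (ι.denseAt X)).desc s, fun Y φ => ?_⟩
  have h := (isColimitOfPreserves F (ι.denseAt X)).fac s (CostructuredArrow.mk φ)
  conv_lhs => rw [← Category.id_comp φ]
  exact h

variable {F G}

/-- `F X` is the colimit of the `F (ι Y)` over `ι Y ⟶ X`, so only `F` has to preserve the canonical
colimits, not `G`. -/
lemma dense_exists_natTrans (τ : ι ⋙ F ⟶ ι ⋙ G) :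
    ∃ t : F ⟶ G, ∀ Y, t.app (ι.obj Y) = τ.app Y := by
  have h (X : A) := dense_exists_desc ι F (X := X) (fun Y φ => τ.app Y ≫ G.map φ)
    (fun Y Y' f φ => by simpa using τ.naturality_assoc f (G.map φ))
  choose t ht using h
  refine ⟨{ app := t
            naturality X X' f := dense_hom_ext ι F fun Y φ => ?_ }, fun Y => ?_⟩
  · rw [reassoc_of% ht X, ← F.map_comp_assoc, ht, G.map_comp]
  · simpa using ht (ι.obj Y) Y (𝟙 _)

lemma dense_isIso [∀ X, PreservesColimit (CostructuredArrow.proj ι X ⋙ ι) G] (t : F ⟶ G)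
    (h : ∀ Y, IsIso (t.app (ι.obj Y))) : IsIso t := by
  let τ : ι ⋙ G ⟶ ι ⋙ F :=
    { app Y := inv (t.app (ι.obj Y)) }
  obtain ⟨s, hs⟩ := dense_exists_natTrans ι τ
  refine ⟨s, ?_, ?_⟩
  · ext X
    exact dense_hom_ext ι F fun Y φ => by simp [hs, τ]
  · ext X
    exact dense_hom_ext ι G fun Y φ => by simp [hs, τ]

end Dense

section CompactsDense

variable {A E : Type (w + 1)} [Category.{w} A] [Category.{w} E] [IsLocallyFinitelyPresentable.{w} A]

/-- The inclusion of compact objects. -/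
abbrev compactsι (A : Type (w + 1)) [Category.{w} A] : Compacts A ⥤ A := ObjectProperty.ι _

instance (X : A) : EssentiallySmall.{w} (CostructuredArrow (compactsι A) X) := inferInstance

instance (F : A ⥤ E) [PreservesColimitsOfSize.{w, w} F] (X : A) :
    PreservesColimit (CostructuredArrow.proj (compactsι A) X ⋙ compactsι A) F :=
  have : PreservesColimitsOfShape (CostructuredArrow (compactsι A) X) F :=
    preservesColimitsOfShape_of_equiv
      (equivSmallModel.{w} (CostructuredArrow (compactsι A) X)).symm F
  inferInstance

lemma compacts_hom_ext (F : A ⥤ E) [PreservesColimitsOfSize.{w, w} F] {X : A} {e : E}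
    {f g : F.obj X ⟶ e}
    (h : ∀ (Y : A) (_ : IsFinitelyPresentable.{w} Y) (φ : Y ⟶ X), F.map φ ≫ f = F.map φ ≫ g) :
    f = g :=
  dense_hom_ext (compactsι A) F fun Y φ => h _ Y.property φ

end CompactsDense

/-! ### From compact objects of `A` to all objects -/

section Extension

variable {k : Type w} [Field k] {A C D E : Type (w + 1)} [Category.{w} A] [Category.{w} C]
  [Category.{w} D] [Category.{w} E] [Preadditive A] [Linear k A]
  [Preadditive C] [Preadditive D] [Preadditive E] [Linear k C] [Linear k D] [Linear k E]
  [MonoidalCategory A] [MonoidalRightAction A C] [MonoidalLeftAction A D]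

/-- The functor `X ↦ F (m ⊙ X, n)`. -/
abbrev actLeft (A : Type (w + 1)) [Category.{w} A] [MonoidalCategory A] [MonoidalRightAction A C]
    (F : C ⥤ D ⥤ E) (m : C) (n : D) : A ⥤ E :=
  (MonoidalRightAction.curriedAction A C).flip.obj m ⋙ F.flip.obj n

/-- The functor `X ↦ F (m, X ⊙ n)`. -/
abbrev actRight (A : Type (w + 1)) [Category.{w} A] [MonoidalCategory A] [MonoidalLeftAction A D]
    (F : C ⥤ D ⥤ E) (m : C) (n : D) : A ⥤ E :=
  (MonoidalLeftAction.curriedAction A D).flip.obj n ⋙ F.obj m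

omit [MonoidalLeftAction A D] in
lemma preservesColimits_actLeft (hC : IsRightModuleCategory k A C) {F : C ⥤ D ⥤ E}
    (hF : IsBicocontinuousBilinear k F) (m : C) (n : D) :
    PreservesColimitsOfSize.{w, w} (actLeft A F m n) :=
  ((hC.action.left m).comp (hF.left n)).preservesColimits

omit [MonoidalRightAction A C] in
lemma preservesColimits_actRight (hD : IsLeftModuleCategory k A D) {F : C ⥤ D ⥤ E}
    (hF : IsBicocontinuousBilinear k F) (m : C) (n : D) :
    PreservesColimitsOfSize.{w, w} (actRight A F m n) :=
  ((hD.action.left n).comp (hF.right m)).preservesColimits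

variable [IsLocallyFinitelyPresentable.{w} A] (hA : IsTensorCategory k A)
  (hC : IsRightModuleCategory k A C) (hD : IsLeftModuleCategory k A D)
  {F : C ⥤ D ⥤ E} (hF : IsBicocontinuousBilinear k F) (b : CompactBalancing A F)

-- Compact `Y ⟶ X` are jointly epimorphic after applying `F (m ⊙ -, n)`; precomposing with the
-- invertible `b.hom` brings the test into the form to which `hom_iso` applies.
include hA hC hF in
lemma CompactBalancing.hom_ext {m : C} {X : A} {n : D} {e : E}
    {f g : (F.obj (m ⊙ᵣ X)).obj n ⟶ e}
    (h : ∀ (Y : A) (hY : IsFinitelyPresentable.{w} Y) (φ : Y ⟶ X),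
      b.hom m hY n ≫ (F.map (m ⊴ᵣ φ)).app n ≫ f = b.hom m hY n ≫ (F.map (m ⊴ᵣ φ)).app n ≫ g) :
    f = g := by
  have := preservesColimits_actLeft hC hF m n
  refine compacts_hom_ext (actLeft A F m n) fun Y hY φ => ?_
  have := b.isIso_hom hA m hY n
  exact (cancel_epi (b.hom m hY n)).1 (h Y hY φ)

-- Both sides are cocontinuous in `X`, and `b.hom` is a natural isomorphism between them on compact
-- objects, so density extends it.
include hA hC hD hF in
lemma CompactBalancing.exists_iso (m : C) (n : D) :
    ∃ t : actLeft A F m n ≅ actRight A F m n,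
      ∀ (Y X : A) (hY : IsFinitelyPresentable.{w} Y) (φ : Y ⟶ X),
        b.hom m hY n ≫ (F.map (m ⊴ᵣ φ)).app n ≫ t.hom.app X = (F.obj m).map (φ ⊵ₗ n) := by
  have := preservesColimits_actLeft hC hF m n
  have := preservesColimits_actRight hD hF m n
  have := fun (Y : Compacts A) => b.isIso_hom hA m Y.property n
  obtain ⟨t, ht⟩ := dense_exists_natTrans (compactsι A) (F := actRight A F m n)
    (G := actLeft A F m n)
    { app Y := b.hom m Y.property n
      naturality Y Y' f := b.naturality_middle m Y.property Y'.property f.hom n }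
  have : IsIso t := dense_isIso (compactsι A) t fun Y => by
    rw [ht]
    exact this Y
  refine ⟨(asIso t).symm, fun Y X hY φ => ?_⟩
  have h : b.hom m hY n = t.app Y := (ht ⟨Y, hY⟩).symm
  have h' : (actRight A F m n).map φ = t.app Y ≫ (actLeft A F m n).map φ ≫ (inv t).app X := by
    rw [← t.naturality_assoc]
    simp
  rw [h]
  exact h'.symm

/-- The isomorphism extending the inverse of a balancing on compact objects. -/
noncomputable def CompactBalancing.iso (m : C) (X : A) (n : D) :
    (F.obj (m ⊙ᵣ X)).obj n ≅ (F.obj m).obj (X ⊙ₗ n) :=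
  (b.exists_iso hA hC hD hF m n).choose.app X

lemma CompactBalancing.hom_iso (m : C) {Y X : A} (hY : IsFinitelyPresentable.{w} Y) (φ : Y ⟶ X)
    (n : D) : b.hom m hY n ≫ (F.map (m ⊴ᵣ φ)).app n ≫ (b.iso hA hC hD hF m X n).hom =
      (F.obj m).map (φ ⊵ₗ n) :=
  (b.exists_iso hA hC hD hF m n).choose_spec Y X hY φ

lemma CompactBalancing.iso_hom_naturality (m : C) {X X' : A} (f : X ⟶ X') (n : D) :
    (F.map (m ⊴ᵣ f)).app n ≫ (b.iso hA hC hD hF m X' n).hom =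
      (b.iso hA hC hD hF m X n).hom ≫ (F.obj m).map (f ⊵ₗ n) :=
  (b.exists_iso hA hC hD hF m n).choose.hom.naturality f

lemma CompactBalancing.hom_iso' (m : C) {Y : A} (hY : IsFinitelyPresentable.{w} Y)
    (n : D) : b.hom m hY n ≫ (b.iso hA hC hD hF m Y n).hom = 𝟙 _ := by
  have := b.hom_iso hA hC hD hF m hY (𝟙 Y) n
  simpa using this

/-- On compact objects `iso` inverts `b.hom`, so this is the pentagon of `b` read backwards. -/
lemma CompactBalancing.iso_pentagon_of_compact (m : C) {X Y : A}
    (hX : IsFinitelyPresentable.{w} X) (hY : IsFinitelyPresentable.{w} Y) (n : D) :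
    (b.iso hA hC hD hF m (X ⊗ Y) n).hom ≫ (F.obj m).map (αₗ X Y n).hom =
      (F.map (αᵣ m X Y).hom).app n ≫ (b.iso hA hC hD hF (m ⊙ᵣ X) Y n).hom ≫
        (b.iso hA hC hD hF m X (Y ⊙ₗ n)).hom := by
  have hXY := hA.tensor_compact X Y hX hY
  have := b.isIso_hom hA m hXY n
  have h : b.hom m hXY n ≫ (F.map (αᵣ m X Y).hom).app n =
      (F.obj m).map (αₗ X Y n).hom ≫ b.hom m hX (Y ⊙ₗ n) ≫ b.hom (m ⊙ᵣ X) hY n := by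
    rw [b.pentagon m hX hY hXY, ← CategoryTheory.Functor.map_comp_assoc, Iso.hom_inv_id,
      CategoryTheory.Functor.map_id, Category.id_comp]
  refine (cancel_epi (b.hom m hXY n)).1 ?_
  rw [reassoc_of% h, reassoc_of% b.hom_iso' hA hC hD hF, b.hom_iso', Category.comp_id]
  exact ((reassoc_of% b.hom_iso' hA hC hD hF) m hXY n _)

lemma CompactBalancing.iso_naturality_left {m m' : C} (f : m ⟶ m') (X : A) (n : D) :
    (F.map (f ⊵ᵣ X)).app n ≫ (b.iso hA hC hD hF m' X n).hom =
      (b.iso hA hC hD hF m X n).hom ≫ (F.map f).app (X ⊙ₗ n) :=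
  b.hom_ext hA hC hF fun Y hY φ => by
    rw [reassoc_of% b.hom_iso hA hC hD hF, ← NatTrans.comp_app_assoc, ← F.map_comp,
      MonoidalRightAction.action_exchange, F.map_comp, NatTrans.comp_app_assoc,
      ← reassoc_of% b.naturality_left, b.hom_iso, NatTrans.naturality]

lemma CompactBalancing.iso_naturality_right (m : C) (X : A) {n n' : D} (f : n ⟶ n') :
    (F.obj (m ⊙ᵣ X)).map f ≫ (b.iso hA hC hD hF m X n').hom =
      (b.iso hA hC hD hF m X n).hom ≫ (F.obj m).map (X ⊴ₗ f) :=
  b.hom_ext hA hC hF fun Y hY φ => by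
    rw [reassoc_of% b.hom_iso hA hC hD hF, ← NatTrans.naturality_assoc,
      ← reassoc_of% b.naturality_right, b.hom_iso,
      ← CategoryTheory.Functor.map_comp, ← CategoryTheory.Functor.map_comp,
      MonoidalLeftAction.action_exchange]

/-- A balancing by compact objects extends to a balancing. -/
noncomputable def CompactBalancing.balancing : Balancing A F where
  iso := b.iso hA hC hD hF
  naturality_left f X n := b.iso_naturality_left hA hC hD hF f X n
  naturality_middle m X X' f n := b.iso_hom_naturality hA hC hD hF m f n
  naturality_right m X n n' f := b.iso_naturality_right hA hC hD hF m X f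
  unit m n := b.hom_ext hA hC hF fun Y hY φ => by
    have hu := hA.unit_compact
    have h := (reassoc_of% b.naturality_middle m hY hu) φ n ((F.map (ρᵣ[A] m).hom).app n)
    rw [reassoc_of% b.hom_iso hA hC hD hF, ← h, b.unit]
  pentagon m X Y n := by
    -- The source of the pentagon is cocontinuous in `X` and in `Y` separately, so first `X` and
    -- then `Y` may be replaced by compact objects mapping to them.
    have : PreservesColimitsOfSize.{w, w}
        ((curriedTensor A).flip.obj Y ⋙ actLeft A F m n) :=
      have := preservesColimits_actLeft hC hF m n
      have := (hA.tensor.left Y).preservesColimits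
      inferInstance
    refine compacts_hom_ext ((curriedTensor A).flip.obj Y ⋙ actLeft A F m n)
      (fun X' hX' φ => ?_)
    have : PreservesColimitsOfSize.{w, w}
        ((curriedTensor A).obj X' ⋙ actLeft A F m n) :=
      have := preservesColimits_actLeft hC hF m n
      have := (hA.tensor.right X').preservesColimits
      inferInstance
    refine compacts_hom_ext ((curriedTensor A).obj X' ⋙ actLeft A F m n)
      (fun Y' hY' ψ => ?_)
    have h : (X' ◁ ψ) ⊵ₗ n ≫ (φ ▷ Y) ⊵ₗ n ≫ (αₗ X Y n).hom =
        (αₗ X' Y' n).hom ≫ X' ⊴ₗ (ψ ⊵ₗ n) ≫ φ ⊵ₗ (Y ⊙ₗ n) := by simp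
    have h' : m ⊴ᵣ (X' ◁ ψ) ≫ m ⊴ᵣ (φ ▷ Y) ≫ (αᵣ m X Y).hom =
        (αᵣ m X' Y').hom ≫ (m ⊙ᵣ X') ⊴ᵣ ψ ≫ (m ⊴ᵣ φ) ⊵ᵣ Y := by simp
    change (F.map (m ⊴ᵣ (X' ◁ ψ))).app n ≫ (F.map (m ⊴ᵣ (φ ▷ Y))).app n ≫ _ =
      (F.map (m ⊴ᵣ (X' ◁ ψ))).app n ≫ (F.map (m ⊴ᵣ (φ ▷ Y))).app n ≫ _
    rw [reassoc_of% b.iso_hom_naturality hA hC hD hF,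
      reassoc_of% b.iso_hom_naturality hA hC hD hF, ← CategoryTheory.Functor.map_comp,
      ← CategoryTheory.Functor.map_comp, h, CategoryTheory.Functor.map_comp,
      CategoryTheory.Functor.map_comp, reassoc_of% b.iso_pentagon_of_compact hA hC hD hF m hX' hY' n,
      ← NatTrans.comp_app_assoc, ← NatTrans.comp_app_assoc, ← F.map_comp, ← F.map_comp,
      Category.assoc, h', F.map_comp, F.map_comp, NatTrans.comp_app_assoc, NatTrans.comp_app_assoc,
      reassoc_of% b.iso_naturality_left hA hC hD hF, reassoc_of% b.iso_hom_naturality hA hC hD hF,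
      b.iso_hom_naturality,
      reassoc_of% b.iso_naturality_right hA hC hD hF]

end Extension

section HomExtension

variable {k : Type w} [Field k] {A C D E : Type (w + 1)} [Category.{w} A] [Category.{w} C]
  [Category.{w} D] [Category.{w} E] [Preadditive A] [Linear k A]
  [Preadditive C] [Preadditive D] [Preadditive E] [Linear k C] [Linear k D] [Linear k E]
  [MonoidalCategory A] [MonoidalRightAction A C] [MonoidalLeftAction A D]
  [IsLocallyFinitelyPresentable.{w} A]
  (hC : IsRightModuleCategory k A C)

-- The source is cocontinuous in `X`. This is needed because compatibility of the counit with the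
-- balancings is only computed for compact `X`.
include hC in
lemma BalancedFunctor.comm_of_compacts {F G : BalancedFunctor k A C D E}
    (t : F.functor ⟶ G.functor)
    (h : ∀ (m : C) (X : A) (_ : IsFinitelyPresentable.{w} X) (n : D),
      (t.app (m ⊙ᵣ X)).app n ≫ (G.balancing.iso m X n).hom =
        (F.balancing.iso m X n).hom ≫ (t.app m).app (X ⊙ₗ n)) (m : C) (X : A) (n : D) :
    (t.app (m ⊙ᵣ X)).app n ≫ (G.balancing.iso m X n).hom =
      (F.balancing.iso m X n).hom ≫ (t.app m).app (X ⊙ₗ n) := by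
  have := preservesColimits_actLeft hC F.bilinear m n
  refine compacts_hom_ext (actLeft A F.functor m n) fun Y hY φ => ?_
  change (F.functor.map (m ⊴ᵣ φ)).app n ≫ _ = (F.functor.map (m ⊴ᵣ φ)).app n ≫ _
  rw [reassoc_of% F.balancing.naturality_middle, ← NatTrans.comp_app_assoc, t.naturality,
    NatTrans.comp_app_assoc, G.balancing.naturality_middle, reassoc_of% h m Y hY n,
    NatTrans.naturality]

end HomExtension

/-! ### Universal properties in terms of natural transformations -/

section Restriction

variable {k : Type w} [Field k] {A C D E P Q : Type (w + 1)} [Category.{w} A] [Category.{w} C]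
  [Category.{w} D] [Category.{w} E] [Category.{w} P] [Category.{w} Q]
  [Preadditive C] [Preadditive D] [Preadditive E] [Preadditive P] [Preadditive Q]
  [Linear k C] [Linear k D] [Linear k E] [Linear k P] [Linear k Q]
  [MonoidalCategory A] [MonoidalRightAction A C] [MonoidalLeftAction A D]

lemma restrictBilinear_hom_ext (T : BilinearFunctor k C D P) [(restrictBilinear T E).Faithful]
    {G H : P ⥤ E} (hG : IsCocontinuousLinear k G) (hH : IsCocontinuousLinear k H) {f g : G ⟶ H}
    (h : ∀ m n, f.app ((T.obj.obj m).obj n) = g.app ((T.obj.obj m).obj n)) : f = g := by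
  let f' : (⟨G, hG⟩ : CocontinuousFunctor k P E) ⟶ ⟨H, hH⟩ := ObjectProperty.homMk f
  let g' : (⟨G, hG⟩ : CocontinuousFunctor k P E) ⟶ ⟨H, hH⟩ := ObjectProperty.homMk g
  have h' : f' = g' := (restrictBilinear T E).map_injective (by
    ext m n
    exact h m n)
  exact congrArg (fun t => t.hom) h'

lemma restrictBilinear_exists (T : BilinearFunctor k C D P) [(restrictBilinear T E).Full]
    {G H : P ⥤ E} (hG : IsCocontinuousLinear k G) (hH : IsCocontinuousLinear k H)
    (t : (Functor.postcompose₂.obj G).obj T.obj ⟶ (Functor.postcompose₂.obj H).obj T.obj) :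
    ∃ f : G ⟶ H, ∀ m n, f.app ((T.obj.obj m).obj n) = (t.app m).app n := by
  let t' : (restrictBilinear T E).obj ⟨G, hG⟩ ⟶ (restrictBilinear T E).obj ⟨H, hH⟩ :=
    ObjectProperty.homMk t
  obtain ⟨f, hf⟩ := (restrictBilinear T E).map_surjective t'
  refine ⟨f.hom, fun m n => ?_⟩
  exact congrArg (fun u => (u.hom.app m).app n) hf

lemma BalancedFunctor.restrict_hom_ext (S : BalancedFunctor k A C D Q) [(S.restrict E).Faithful]
    {G H : Q ⥤ E} (hG : IsCocontinuousLinear k G) (hH : IsCocontinuousLinear k H) {f g : G ⟶ H}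
    (h : ∀ m n, f.app ((S.functor.obj m).obj n) = g.app ((S.functor.obj m).obj n)) : f = g := by
  let f' : (⟨G, hG⟩ : CocontinuousFunctor k Q E) ⟶ ⟨H, hH⟩ := ObjectProperty.homMk f
  let g' : (⟨G, hG⟩ : CocontinuousFunctor k Q E) ⟶ ⟨H, hH⟩ := ObjectProperty.homMk g
  have h' : f' = g' := (S.restrict E).map_injective (by
    apply BalancedFunctor.Hom.ext
    ext m n
    exact h m n)
  exact congrArg (fun t => t.hom) h'

lemma BalancedFunctor.restrict_exists (S : BalancedFunctor k A C D Q) [(S.restrict E).Full]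
    {G H : Q ⥤ E} (hG : IsCocontinuousLinear k G) (hH : IsCocontinuousLinear k H)
    (t : (Functor.postcompose₂.obj G).obj S.functor ⟶ (Functor.postcompose₂.obj H).obj S.functor)
    (ht : ∀ m X n, (t.app (m ⊙ᵣ X)).app n ≫ H.map (S.balancing.iso m X n).hom =
      G.map (S.balancing.iso m X n).hom ≫ (t.app m).app (X ⊙ₗ n)) :
    ∃ f : G ⟶ H, ∀ m n, f.app ((S.functor.obj m).obj n) = (t.app m).app n := by
  let t' : (S.restrict E).obj ⟨G, hG⟩ ⟶ (S.restrict E).obj ⟨H, hH⟩ := ⟨t, ht⟩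
  obtain ⟨f, hf⟩ := (S.restrict E).map_surjective t'
  refine ⟨f.hom, fun m n => ?_⟩
  exact congrArg (fun u => (BalancedFunctor.Hom.natTrans u |>.app m).app n) hf

/-- The inverses on the objects `S (m, n)` are compatible with the balancings by naturality of `f`,
so fullness extends them to all of `Q`. -/
lemma BalancedFunctor.isIso_of_restrict (S : BalancedFunctor k A C D Q)
    [(S.restrict E).Full] [(S.restrict E).Faithful]
    {G H : Q ⥤ E} (hG : IsCocontinuousLinear k G) (hH : IsCocontinuousLinear k H) (f : G ⟶ H)
    (h : ∀ m n, IsIso (f.app ((S.functor.obj m).obj n))) : IsIso f := by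
  let t : (Functor.postcompose₂.obj H).obj S.functor ⟶
      (Functor.postcompose₂.obj G).obj S.functor :=
    { app m := { app n := inv (f.app ((S.functor.obj m).obj n))
                 naturality n n' g := by simp }
      naturality m m' g := by
        ext n
        simp }
  obtain ⟨g, hg⟩ := S.restrict_exists hH hG t (fun m X n => by simp [t])
  refine ⟨g, S.restrict_hom_ext hG hG fun m n => ?_, S.restrict_hom_ext hH hH fun m n => ?_⟩ <;>
  simp [hg, t]

lemma IsCocontinuousLinear.id : IsCocontinuousLinear k (𝟭 P) :=
  ⟨inferInstance, inferInstance, inferInstance⟩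

end Restriction

/-! ### The right adjoint of `μ` -/

section Adjunction

variable {k : Type w} [Field k] {A C D P Q : Type (w + 1)} [Category.{w} A] [Category.{w} C]
  [Category.{w} D] [Category.{w} P] [Category.{w} Q]
  [Preadditive A] [Preadditive C] [Preadditive D] [Preadditive P] [Preadditive Q]
  [Linear k A] [Linear k C] [Linear k D] [Linear k P] [Linear k Q]
  [MonoidalCategory A] [MonoidalRightAction A C] [MonoidalLeftAction A D]
  [IsLocallyFinitelyPresentable.{w} A] [HasColimitsOfSize.{w, w} P]
  (hA : IsTensorCategory k A) (hC : IsRightModuleCategory k A C) (hD : IsLeftModuleCategory k A D)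
  (T : BilinearFunctor k C D P) (S : BalancedFunctor k A C D Q)

/-- The balanced functor `N`. -/
noncomputable def balancedCompletionFunctor : BalancedFunctor k A C D P where
  functor := balancedCompletion A T.obj
  bilinear := balancedCompletion_bilinear hC hD T.property
  balancing := (balancedCompletionBalancing hA T.obj).balancing hA hC hD
    (balancedCompletion_bilinear hC hD T.property)

/-- The natural transformation `T (m, n) ⟶ N (m, n)` -/
noncomputable def balancedUnit : T.obj ⟶ balancedCompletion A T.obj where
  app m :=
    { app n := (T.obj.obj m).map (λₗ[A] n).inv ≫ balancedι T.obj hA n hA.unit_compact (ρᵣ[A] m).hom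
      naturality n n' g := by
        rw [Category.assoc, balancedι_naturality_right,
          ← CategoryTheory.Functor.map_comp_assoc, ← CategoryTheory.Functor.map_comp_assoc]
        simp }
  naturality m m' f := by
    ext n
    dsimp
    rw [← NatTrans.naturality_assoc, app_balancedι, Category.assoc, balancedι_naturality_left]
    simp

variable {T} {S} {μ : P ⥤ Q} (hμ : IsCocontinuousLinear k μ)
  (θ : (Functor.postcompose₂.obj μ).obj T.obj ≅ S.functor)

-- Transporting along `θ` and the inverse balancing of `S` moves `B` across, after which `φ`
-- applies. The cocone conditions are naturality of the balancing in its first two arguments.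
include hμ in
lemma exists_balancedCounit (m : C) (n : D) :
    ∃ f : μ.obj (((balancedCompletion A T.obj).obj m).obj n) ⟶ (S.functor.obj m).obj n,
      ∀ (c : C) (B : A) (hB : IsFinitelyPresentable.{w} B) (φ : c ⊙ᵣ B ⟶ m),
        μ.map (balancedι T.obj hA n hB φ) ≫ f = (θ.hom.app c).app (B ⊙ₗ n) ≫
          (S.balancing.iso c B n).inv ≫ (S.functor.map φ).app n := by
  have := hμ.preservesColimits
  refine balancedCompletion_exists_desc hA μ (fun c B hB φ => (θ.hom.app c).app (B ⊙ₗ n) ≫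
          (S.balancing.iso c B n).inv ≫ (S.functor.map φ).app n) ?_ ?_
  · intro c c' B hB f φ
    have h := NatTrans.congr_app (θ.hom.naturality f) (B ⊙ₗ n)
    dsimp at h
    rw [reassoc_of% h, S.functor.map_comp, NatTrans.comp_app]
    congr 1
    rw [← Category.assoc, ← Category.assoc]
    congr 1
    rw [Iso.comp_inv_eq, Category.assoc, S.balancing.naturality_left, Iso.inv_hom_id_assoc]
  · intro c B B₁ hB hB₁ g φ
    have h := (θ.hom.app c).naturality (g ⊵ₗ n)
    dsimp at h
    rw [reassoc_of% h, S.functor.map_comp, NatTrans.comp_app]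
    congr 1
    rw [← Category.assoc, ← Category.assoc]
    congr 1
    rw [Iso.comp_inv_eq, Category.assoc, S.balancing.naturality_middle, Iso.inv_hom_id_assoc]

/-- The component of the natural transformation `μ N ⟶ S`. -/
noncomputable def balancedCounitApp (m : C) (n : D) :
    μ.obj (((balancedCompletion A T.obj).obj m).obj n) ⟶ (S.functor.obj m).obj n :=
  (exists_balancedCounit hA hμ θ m n).choose

lemma map_balancedι_balancedCounitApp {m : C} (n : D) {c : C} {B : A}
    (hB : IsFinitelyPresentable.{w} B) (φ : c ⊙ᵣ B ⟶ m) :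
    μ.map (balancedι T.obj hA n hB φ) ≫ balancedCounitApp hA hμ θ m n =
      (θ.hom.app c).app (B ⊙ₗ n) ≫ (S.balancing.iso c B n).inv ≫ (S.functor.map φ).app n :=
  (exists_balancedCounit hA hμ θ m n).choose_spec c B hB φ

/-- The natural transformation `μ N ⟶ S`. -/
noncomputable def balancedCounit :
    (Functor.postcompose₂.obj μ).obj (balancedCompletion A T.obj) ⟶ S.functor where
  app m :=
    { app n := balancedCounitApp hA hμ θ m n
      naturality n n' g := by
        have := hμ.preservesColimits
        refine balancedCompletion_hom_ext hA μ fun c B hB φ => ?_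
        dsimp
        have h := (θ.hom.app c).naturality (B ⊴ₗ g)
        dsimp at h
        rw [← μ.map_comp_assoc, balancedι_naturality_right, μ.map_comp_assoc,
          map_balancedι_balancedCounitApp, reassoc_of% map_balancedι_balancedCounitApp,
          reassoc_of% h]
        congr 1
        rw [← cancel_epi (S.balancing.iso c B n).hom]
        simp only [Iso.hom_inv_id_assoc]
        rw [← reassoc_of% S.balancing.naturality_right, Iso.hom_inv_id_assoc, NatTrans.naturality] }
  naturality m m' f := by
    ext n
    have := hμ.preservesColimits
    refine balancedCompletion_hom_ext hA μ fun c B hB φ => ?_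
    dsimp
    rw [← μ.map_comp_assoc, balancedι_naturality_left, map_balancedι_balancedCounitApp,
      reassoc_of% map_balancedι_balancedCounitApp, S.functor.map_comp, NatTrans.comp_app]

/-- Precomposing with the invertible compact balancing of `N` reduces the claim to the components of
`N`, where it is the pentagon of `S` at `c`, `B`, `X`. -/
lemma balancedCounit_comm (m : C) {X : A} (hX : IsFinitelyPresentable.{w} X) (n : D) :
    balancedCounitApp hA hμ θ (m ⊙ᵣ X) n ≫ (S.balancing.iso m X n).hom =
      μ.map ((balancedCompletionBalancing hA T.obj).iso hA hC hD
        (balancedCompletion_bilinear hC hD T.property) m X n).hom ≫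
        balancedCounitApp hA hμ θ m (X ⊙ₗ n) := by
  have := hμ.preservesColimits
  let b := balancedCompletionBalancing hA T.obj
  have := b.isIso_hom hA m hX n
  rw [← cancel_epi (μ.map (b.hom m hX n)), ← μ.map_comp_assoc, b.hom_iso', μ.map_id,
    Category.id_comp]
  refine balancedCompletion_hom_ext hA μ fun c B hB φ => ?_
  have hBX := hA.tensor_compact B X hB hX
  have h := (θ.hom.app c).naturality (αₗ B X n).inv
  dsimp at h
  rw [← μ.map_comp_assoc]
  change μ.map (_ ≫ balancedCompletionHom hA T.obj m hX n) ≫ _ = _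
  rw [balancedι_balancedCompletionHom, μ.map_comp_assoc, reassoc_of% map_balancedι_balancedCounitApp,
    reassoc_of% h, map_balancedι_balancedCounitApp]
  congr 1
  have hp := S.balancing.pentagon c B X n
  rw [← cancel_epi (S.balancing.iso c B (X ⊙ₗ n)).hom,
    ← cancel_epi (S.balancing.iso (c ⊙ᵣ B) X n).hom,
    ← cancel_epi ((S.functor.map (αᵣ c B X).hom).app n)]
  rw [← reassoc_of% hp]
  simp only [Iso.hom_inv_id_assoc]
  rw [← CategoryTheory.Functor.map_comp_assoc, Iso.hom_inv_id, CategoryTheory.Functor.map_id,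
    Category.id_comp, Iso.hom_inv_id_assoc, S.functor.map_comp, NatTrans.comp_app_assoc,
    S.balancing.naturality_left]

include hA hC hD hμ θ in
/-- The functor `μ` has a right adjoint, which preserves colimits. -/
theorem exists_adjunction [(restrictBilinear T P).IsEquivalence]
    [(restrictBilinear T Q).IsEquivalence] [(S.restrict P).IsEquivalence]
    [(S.restrict Q).IsEquivalence] :
    ∃ (R : Q ⥤ P), IsCocontinuousLinear k R ∧ Nonempty (μ ⊣ R) := by
  let NB := balancedCompletionFunctor hA hC hD T
  -- The universal property of `S` turns the balanced functor `N` into `R`, with `ρ : R S ≅ N`.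
  let R' := (S.restrict P).objPreimage NB
  let R : Q ⥤ P := R'.obj
  have hR : IsCocontinuousLinear k R := R'.property
  let N := balancedCompletion A T.obj
  let ρ' : (S.restrict P).obj R' ≅ NB := (S.restrict P).objObjPreimageIso NB
  let ρ : (Functor.postcompose₂.obj R).obj S.functor ≅ N :=
    { hom := ρ'.hom.natTrans
      inv := ρ'.inv.natTrans
      hom_inv_id := congrArg BalancedFunctor.Hom.natTrans ρ'.hom_inv_id
      inv_hom_id := congrArg BalancedFunctor.Hom.natTrans ρ'.inv_hom_id }
  let b := balancedCompletionBalancing hA T.obj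
  let hN := balancedCompletion_bilinear hC hD T.property
  have hρ (m : C) (X : A) (n : D) : (ρ.hom.app (m ⊙ᵣ X)).app n ≫ (b.iso hA hC hD hN m X n).hom =
      R.map (S.balancing.iso m X n).hom ≫ (ρ.hom.app m).app (X ⊙ₗ n) :=
    ρ'.hom.comm m X n
  obtain ⟨η, hη⟩ := restrictBilinear_exists T (G := 𝟭 P) (H := μ ⋙ R) .id (hμ.comp hR)
    (balancedUnit hA T ≫ ρ.inv ≫ (Functor.postcompose₂.obj R).map θ.inv)
  obtain ⟨ε, hε⟩ := S.restrict_exists (G := R ⋙ μ) (H := 𝟭 Q) (hR.comp hμ) .id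
    ((Functor.postcompose₂.obj μ).map ρ.hom ≫ balancedCounit hA hμ θ) (by
      intro m X n
      have h₁ := balancedCounit_comm hA hC hD hμ θ
      have h₂ (m : C) {X : A} (hX : IsFinitelyPresentable.{w} X) (n : D) :
          (μ.map ((ρ.hom.app (m ⊙ᵣ X)).app n) ≫ balancedCounitApp hA hμ θ (m ⊙ᵣ X) n) ≫
            (S.balancing.iso m X n).hom = μ.map (R.map (S.balancing.iso m X n).hom) ≫
              μ.map ((ρ.hom.app m).app (X ⊙ₗ n)) ≫ balancedCounitApp hA hμ θ m (X ⊙ₗ n) := by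
        rw [Category.assoc, h₁ m hX, ← μ.map_comp_assoc, ← μ.map_comp_assoc, hρ]
      -- Both sides are seen as balanced functors, so that it is enough to have `h₂` for compact
      -- `X`.
      exact BalancedFunctor.comm_of_compacts hC
        (F := S.postcompose ⟨R ⋙ μ, hR.comp hμ⟩) (G := S)
        ((Functor.postcompose₂.obj μ).map ρ.hom ≫ balancedCounit hA hμ θ)
        (fun m X hX n => h₂ m hX n) m X n)
  replace hη (m : C) (n : D) : η.app ((T.obj.obj m).obj n) = (T.obj.obj m).map (λₗ[A] n).inv ≫
      balancedι T.obj hA n hA.unit_compact (ρᵣ[A] m).hom ≫ (ρ.inv.app m).app n ≫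
        R.map ((θ.inv.app m).app n) := (hη m n).trans (Category.assoc _ _ _)
  replace hε (m : C) (n : D) : ε.app ((S.functor.obj m).obj n) =
      μ.map ((ρ.hom.app m).app n) ≫ balancedCounitApp hA hμ θ m n := hε m n
  have hρ₁ (m : C) (n : D) : (ρ.inv.app m).app n ≫ (ρ.hom.app m).app n = 𝟙 _ := by
    rw [← NatTrans.comp_app, ← NatTrans.comp_app, Iso.inv_hom_id]; rfl
  have hρ₂ (m : C) (n : D) : (ρ.hom.app m).app n ≫ (ρ.inv.app m).app n =
      𝟙 (R.obj ((S.functor.obj m).obj n)) := by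
    rw [← NatTrans.comp_app, ← NatTrans.comp_app, Iso.hom_inv_id]; rfl
  have hθ₁ (m : C) (n : D) : (θ.inv.app m).app n ≫ (θ.hom.app m).app n = 𝟙 _ := by
    rw [← NatTrans.comp_app, ← NatTrans.comp_app, Iso.inv_hom_id]; rfl
  have hθ₂ (m : C) (n : D) : (θ.hom.app m).app n ≫ (θ.inv.app m).app n =
      𝟙 (μ.obj ((T.obj.obj m).obj n)) := by
    rw [← NatTrans.comp_app, ← NatTrans.comp_app, Iso.hom_inv_id]; rfl
  -- The triangle composite is an endomorphism of a cocontinuous functor, so it suffices to evaluate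
  -- it at `T (m, n)`; there the claim becomes the unit axiom of the balancing of `S`.
  have htriangle₁ (p : P) : μ.map (η.app p) ≫ ε.app (μ.obj p) = 𝟙 (μ.obj p) := by
    let f : μ ⟶ μ := { app p := μ.map (η.app p) ≫ ε.app (μ.obj p)
                       naturality p p' g := by
                        have h₁ := η.naturality g
                        have h₂ := ε.naturality (μ.map g)
                        dsimp at h₁ h₂
                        rw [← μ.map_comp_assoc, h₁, μ.map_comp_assoc, h₂, Category.assoc] }
    have hf : f = 𝟙 μ := by
      refine restrictBilinear_hom_ext T hμ hμ fun m n => ?_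
      have h₁ := ε.naturality ((θ.inv.app m).app n)
      dsimp at h₁
      dsimp [f]
      rw [hη, μ.map_comp, μ.map_comp, μ.map_comp]
      simp only [Category.assoc]
      rw [h₁, hε, Category.assoc]
      have h₂ : μ.map ((ρ.inv.app m).app n) ≫ μ.map ((ρ.hom.app m).app n) = 𝟙 _ := by
        rw [← μ.map_comp, hρ₁, μ.map_id]
      have h₃ := (θ.hom.app m).naturality (λₗ[A] n).inv
      dsimp at h₃
      have h₄ := S.balancing.unit m n
      rw [reassoc_of% h₂, reassoc_of% map_balancedι_balancedCounitApp, reassoc_of% h₃, ← h₄,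
        Category.assoc, Iso.inv_hom_id_assoc, ← CategoryTheory.Functor.map_comp_assoc, Iso.inv_hom_id,
        CategoryTheory.Functor.map_id, Category.id_comp, hθ₂]
    exact NatTrans.congr_app hf p
  -- Likewise evaluated at `S (m, n)`, then transported along `ρ` and tested on the components of
  -- `N`.
  have htriangle₂ (q : Q) : η.app (R.obj q) ≫ R.map (ε.app q) = 𝟙 (R.obj q) := by
    let f : R ⟶ R := { app q := η.app (R.obj q) ≫ R.map (ε.app q)
                       naturality q q' g := by
                        have h₁ := η.naturality (R.map g)
                        have h₂ := ε.naturality g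
                        dsimp at h₁ h₂
                        rw [reassoc_of% h₁, ← R.map_comp, h₂, Category.assoc, ← R.map_comp] }
    have hf : f = 𝟙 R := by
      refine S.restrict_hom_ext hR hR fun m n => ?_
      have h₁ := η.naturality ((ρ.hom.app m).app n)
      dsimp at h₁
      dsimp [f]
      rw [hε, R.map_comp, ← reassoc_of% h₁, ← hρ₂]
      congr 1
      have : IsIso ((ρ.hom.app m).app n) := ⟨_, hρ₂ m n, hρ₁ m n⟩
      rw [← cancel_mono ((ρ.hom.app m).app n), Category.assoc, hρ₁]
      refine balancedCompletion_hom_ext hA (𝟭 P) fun c B hB φ => ?_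
      have h₂ := η.naturality (balancedι T.obj hA n hB φ)
      have h₃ := NatTrans.congr_app (ρ.hom.naturality φ) n
      dsimp at h₂ h₃ ⊢
      rw [reassoc_of% h₂, hη, ← R.map_comp_assoc, map_balancedι_balancedCounitApp, R.map_comp,
        R.map_comp]
      simp only [Category.assoc]
      have h₄ : R.map ((θ.inv.app c).app (B ⊙ₗ n)) ≫ R.map ((θ.hom.app c).app (B ⊙ₗ n)) =
          𝟙 _ := by
        rw [← R.map_comp, hθ₁, R.map_id]
      rw [reassoc_of% h₄, h₃]
      -- Under `ρ` the inverse balancing of `S` becomes the explicit compact balancing of `N`.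
      have h₅ : R.map (S.balancing.iso c B n).inv ≫ (ρ.hom.app (c ⊙ᵣ B)).app n =
          (ρ.hom.app c).app (B ⊙ₗ n) ≫ b.hom c hB n := by
        rw [← cancel_mono (b.iso hA hC hD hN c B n).hom, Category.assoc, Category.assoc,
          b.hom_iso', Category.comp_id, hρ, ← R.map_comp_assoc, Iso.inv_hom_id, R.map_id,
          Category.id_comp]
      rw [reassoc_of% h₅, reassoc_of% (hρ₁ c (B ⊙ₗ n))]
      change _ ≫ _ ≫ balancedCompletionHom hA T.obj c hB n ≫ _ = _
      rw [reassoc_of% balancedι_balancedCompletionHom, balancedι_naturality_left]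
      -- The composite lands in the component of `𝟙 ⊗ B`; the left unitor of `A` brings it back to
      -- that of `B`.
      have h₆ : ((αᵣ c (𝟙_ A) B).hom ≫ (ρᵣ[A] c).hom ⊵ᵣ B) ≫ φ = c ⊴ᵣ (λ_ B).hom ≫ φ := by
        simp
      have h₇ : (λₗ[A] (B ⊙ₗ n)).inv ≫ (αₗ (𝟙_ A) B n).inv = (λ_ B).inv ⊵ₗ n := by
        rw [← cancel_mono ((λ_ B).hom ⊵ₗ n), ← MonoidalLeftAction.comp_actionHomLeft,
          Iso.inv_hom_id, MonoidalLeftAction.id_actionHomLeft]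
        simp
      rw [← CategoryTheory.Functor.map_comp_assoc, h₇, h₆,
        map_balancedι T.obj hA n hB (hA.tensor_compact _ B hA.unit_compact hB),
        ← MonoidalRightAction.actionHomRight_comp_assoc]
      simp
      exact (Category.comp_id _).symm
    exact NatTrans.congr_app hf q
  exact ⟨R, hR, ⟨Adjunction.mkOfUnitCounit
    ⟨η, ε, by ext p; simpa using htriangle₁ p, by ext q; simpa using htriangle₂ q⟩⟩⟩

end Adjunction

/-! ### The canonical presentation and monadicity -/

section CanonicalPresentation

lemma isIso_coequalizer_desc_app {C D : Type*} [Category* C] [Category* D] [HasCoequalizers D]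
    {F G H : C ⥤ D} (f g : F ⟶ G) (h : G ⟶ H) (w : f ≫ h = g ≫ h) (X : C)
    (w' : f.app X ≫ h.app X = g.app X ≫ h.app X)
    (hc : IsColimit (Cofork.ofπ (h.app X) w')) :
    IsIso ((coequalizer.desc h w).app X) := by
  let e := isColimitOfHasCoequalizerOfPreservesColimit ((evaluation C D).obj X) f g
  have h₁ : (coequalizer.π f g).app X ≫ (coequalizer.desc h w).app X = h.app X := by
    rw [← NatTrans.comp_app, coequalizer.π_desc]
  let i := IsColimit.coconePointUniqueUpToIso e hc
  have h₂ : (coequalizer.π f g).app X ≫ i.hom = h.app X :=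
    IsColimit.comp_coconePointUniqueUpToIso_hom e hc .one
  have h₃ : (coequalizer.desc h w).app X = i.hom :=
    Cofork.IsColimit.hom_ext e (h₁.trans h₂.symm)
  rw [h₃]
  infer_instance

variable {P Q : Type*} [Category* P] [Category* Q] {μ : P ⥤ Q} {R : Q ⥤ P} (adj : μ ⊣ R)

/-- The morphism `μ R ε`. -/
def counitLeft : (R ⋙ μ) ⋙ R ⋙ μ ⟶ R ⋙ μ where
  app q := (R ⋙ μ).map (adj.counit.app q)
  naturality q q' f := by
    have := adj.counit.naturality f
    dsimp at this ⊢
    rw [← μ.map_comp, ← μ.map_comp, ← R.map_comp, ← R.map_comp, this]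

/-- The morphism `ε μ R`. -/
def counitRight : (R ⋙ μ) ⋙ R ⋙ μ ⟶ R ⋙ μ where
  app q := adj.counit.app ((R ⋙ μ).obj q)
  naturality _ _ f := adj.counit.naturality ((R ⋙ μ).map f)

lemma counitRight_counit : counitRight adj ≫ adj.counit = counitLeft adj ≫ adj.counit := by
  ext q
  exact (adj.counit.naturality (adj.counit.app q)).symm

/-- A section of the counit at `q` makes the canonical fork at `q` a split coequalizer, and
coequalizers of functors are computed pointwise. -/
lemma isIso_desc_counit_app [HasCoequalizers Q] {q : Q} (s : q ⟶ μ.obj (R.obj q))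
    (hs : s ≫ adj.counit.app q = 𝟙 q) :
    IsIso ((coequalizer.desc _ (counitRight_counit adj)).app q) := by
  refine isIso_coequalizer_desc_app _ _ _ _ _ (NatTrans.congr_app (counitRight_counit adj) q) ?_
  let sp : IsSplitCoequalizer ((counitRight adj).app q) ((counitLeft adj).app q)
      (adj.counit.app q) :=
    { rightSection := s
      leftSection := (R ⋙ μ).map s
      condition := NatTrans.congr_app (counitRight_counit adj) q
      rightSection_π := hs
      leftSection_bottom := by
        dsimp [counitLeft]
        rw [← μ.map_comp, ← R.map_comp, hs, R.map_id, μ.map_id]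
      leftSection_top := adj.counit.naturality s }
  exact sp.isCoequalizer

end CanonicalPresentation

section Monadicity

variable {k : Type w} [Field k] {A C D P Q : Type (w + 1)} [Category.{w} A] [Category.{w} C]
  [Category.{w} D] [Category.{w} P] [Category.{w} Q]
  [Preadditive C] [Preadditive D] [Preadditive P] [Preadditive Q]
  [Linear k C] [Linear k D] [Linear k P] [Linear k Q]
  [MonoidalCategory A] [MonoidalRightAction A C] [MonoidalLeftAction A D]
  [HasColimitsOfSize.{w, w} Q]
  {T : BilinearFunctor k C D P} {S : BalancedFunctor k A C D Q}
  {μ : P ⥤ Q} (hμ : IsCocontinuousLinear k μ)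
  (θ : (Functor.postcompose₂.obj μ).obj T.obj ≅ S.functor)
  {R : Q ⥤ P} (hR : IsCocontinuousLinear k R) (adj : μ ⊣ R)

lemma IsCocontinuousLinear.coequalizer {F G : P ⥤ Q} (f g : F ⟶ G)
    (hF : IsCocontinuousLinear k F) (hG : IsCocontinuousLinear k G) :
    IsCocontinuousLinear k (coequalizer f g) := by
  refine IsCocontinuousLinear.of_iso (IsCocontinuousLinear.comp_colim (parallelPair f g).flip ?_)
    (colimitIsoFlipCompColim (parallelPair f g)).symm
  rintro (_ | _)
  · exact hF
  · exact hG

-- At `S (m, n) ≅ μ T (m, n)` the unit provides a section of the counit. As the coequalizer functor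
-- and the identity are both cocontinuous, invertibility on these objects is enough.
include hμ θ hR in
lemma isIso_desc_counit [(S.restrict Q).IsEquivalence] :
    IsIso (coequalizer.desc _ (counitRight_counit adj)) := by
  have hRμ := hR.comp hμ
  refine S.isIso_of_restrict (IsCocontinuousLinear.coequalizer _ _ (hRμ.comp hRμ) hRμ) .id _
    fun m n => isIso_desc_counit_app adj ((θ.inv.app m).app n ≫
      μ.map (adj.unit.app _) ≫ μ.map (R.map ((θ.hom.app m).app n))) ?_
  have hθ₁ (m : C) (n : D) : (θ.inv.app m).app n ≫ (θ.hom.app m).app n =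
      𝟙 ((S.functor.obj m).obj n) := by
    rw [← NatTrans.comp_app, ← NatTrans.comp_app, Iso.inv_hom_id]; rfl
  have h := adj.counit.naturality ((θ.hom.app m).app n)
  dsimp at h
  simp [h, hθ₁]

-- The identity of `Q` is the coequalizer of `μRμR ⇉ μR`, and both functors invert every morphism
-- inverted by `R`.
include hμ θ hR adj in
lemma reflectsIsomorphisms [(S.restrict Q).IsEquivalence] : R.ReflectsIsomorphisms where
  reflects {q q'} f hf := by
    have := isIso_desc_counit hμ θ hR adj
    let d := asIso (coequalizer.desc _ (counitRight_counit adj))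
    have : IsIso ((coequalizer (counitRight adj) (counitLeft adj)).map f) := by
      have h (j : WalkingParallelPair) : IsIso
          (((parallelPair (counitRight adj) (counitLeft adj)).flip.map f).app j) := by
        rcases j with _ | _
        · exact inferInstanceAs (IsIso (μ.map (R.map (μ.map (R.map f)))))
        · exact inferInstanceAs (IsIso (μ.map (R.map f)))
      have := NatIso.isIso_of_isIso_app
        ((parallelPair (counitRight adj) (counitLeft adj)).flip.map f)
      have e := colimitIsoFlipCompColim (parallelPair (counitRight adj) (counitLeft adj))
      exact (NatIso.isIso_map_iff e f).2
        (inferInstanceAs (IsIso (colim.map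
          ((parallelPair (counitRight adj) (counitLeft adj)).flip.map f))))
    have h : f = d.inv.app q ≫ (coequalizer (counitRight adj) (counitLeft adj)).map f ≫
      d.hom.app q' := by simp
    rw [h]
    infer_instance

-- Crude monadicity: `R` reflects isomorphisms and preserves the reflexive coequalizers, which exist
-- in `Q`.
include hμ θ hR in
theorem comparison_isEquivalence [(S.restrict Q).IsEquivalence] :
    (Monad.comparison adj).IsEquivalence := by
  have := reflectsIsomorphisms hμ θ hR adj
  have := hR.preservesColimits
  have : Monad.PreservesColimitOfIsReflexivePair R := ⟨fun _ _ _ => inferInstance⟩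
  exact (Monad.monadicOfHasPreservesReflexiveCoequalizersOfReflectsIsomorphisms adj).eqv

end Monadicity

section CanonicalFunctor

variable {k : Type w} [Field k] {A C D P Q : Type (w + 1)} [Category.{w} A] [Category.{w} C]
  [Category.{w} D] [Category.{w} P] [Category.{w} Q]
  [Preadditive A] [Preadditive C] [Preadditive D] [Preadditive P] [Preadditive Q]
  [Linear k A] [Linear k C] [Linear k D] [Linear k P] [Linear k Q]
  [MonoidalCategory A] [MonoidalRightAction A C] [MonoidalLeftAction A D]
  [IsLocallyFinitelyPresentable.{w} A] [IsLocallyFinitelyPresentable.{w} P]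
  [IsLocallyFinitelyPresentable.{w} Q]
  (hA : IsTensorCategory k A) (hC : IsRightModuleCategory k A C) (hD : IsLeftModuleCategory k A D)
  {T : BilinearFunctor k C D P} (hT : IsDeligneKellyTensor T)
  {S : BalancedFunctor k A C D Q} (hS : S.IsRelativeTensor)
  {μ : CocontinuousFunctor k P Q} (hμ : IsCanonicalFunctor T S μ)

include hA hC hD hT hS hμ

theorem exists_cocontinuous_monadic_rightAdjoint :
    ∃ (R : Q ⥤ P), IsCocontinuousLinear k R ∧ R.ReflectsIsomorphisms ∧ Nonempty (μ.obj ⊣ R) := by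
  obtain ⟨e⟩ := hμ
  have := hT P
  have := hT Q
  have := hS P
  have := hS Q
  let θ := (ObjectProperty.ι _).mapIso e
  obtain ⟨R, hR, ⟨adj⟩⟩ := exists_adjunction hA hC hD μ.property θ
  exact ⟨R, hR, reflectsIsomorphisms μ.property θ hR adj, ⟨adj⟩⟩

/-- Right adjoints are unique up to isomorphism, so an arbitrary `R` inherits cocontinuity from the
one constructed. -/
theorem monadic_of_isCanonicalFunctor {R : Q ⥤ P} (adj : μ.obj ⊣ R) :
    (Monad.comparison adj).IsEquivalence := by
  obtain ⟨R', hR', -, ⟨adj'⟩⟩ := exists_cocontinuous_monadic_rightAdjoint hA hC hD hT hS hμ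
  obtain ⟨e⟩ := hμ
  have := hS Q
  exact comparison_isEquivalence μ.property ((ObjectProperty.ι _).mapIso e)
    (hR'.of_iso (adj'.rightAdjointUniq adj)) adj

end CanonicalFunctor

/-! ### Small models of the compact objects -/

section CompactModel

/-- `ι : a ⥤ C` is equivalent to the inclusion of the compact objects of `C`. -/
structure IsCompactModel (k : Type w) [Field k] {a : Type w} [SmallCategory a] [Preadditive a]
    [Linear k a] {C : Type (w + 1)} [Category.{w} C] [Preadditive C] [Linear k C]
    (ι : a ⥤ C) : Prop where
  full : ι.Full
  faithful : ι.Faithful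
  additive : ι.Additive
  linear : ι.Linear k
  dense : ι.IsDense
  compact (x : a) : IsFinitelyPresentable.{w} (ι.obj x)
  exists_iso (c : C) (hc : IsFinitelyPresentable.{w} c) : ∃ x, Nonempty (ι.obj x ≅ c)

/-- The small model is taken as an induced category of `C`: its morphisms are those of `C`, so the
linear structure is inherited and the inclusion is linear. -/
theorem exists_isCompactModel (k : Type w) [Field k] (C : Type (w + 1)) [Category.{w} C]
    [Preadditive C] [Linear k C] [IsLocallyFinitelyPresentable.{w} C] :
    ∃ (a : Type w) (_ : SmallCategory a) (_ : Preadditive a) (_ : Linear k a) (ι : a ⥤ C),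
      IsCompactModel k ι := by
  let e := equivSmallModel.{w} (Compacts C)
  let F : SmallModel.{w} (Compacts C) → C := fun x => (e.inverse.obj x).obj
  let ι' : InducedCategory C F ⥤ Compacts C :=
    ObjectProperty.lift _ (inducedFunctor F) (fun x => (e.inverse.obj x).property)
  have hι (Y : Compacts C) : ∃ x : InducedCategory C F, Nonempty (ι'.obj x ≅ Y) :=
    ⟨e.functor.obj Y, ⟨(ObjectProperty.ι _).preimageIso
      ((ObjectProperty.ι _).mapIso (e.unitIso.app Y).symm)⟩⟩
  have : ι'.Faithful := inferInstance
  have : ι'.Full := inferInstance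
  have : ι'.EssSurj := ⟨fun Y => hι Y⟩
  have : ι'.IsEquivalence := {}
  refine ⟨InducedCategory C F, inferInstance, inferInstance, inferInstance, inducedFunctor F,
    inferInstance, inferInstance, inferInstance, inferInstance,
    inferInstanceAs (ι' ⋙ compactsι C).IsDense, fun x => (e.inverse.obj x).property,
    fun c hc => ?_⟩
  obtain ⟨x, ⟨i⟩⟩ := hι ⟨c, hc⟩
  exact ⟨x, ⟨(compactsι C).mapIso i⟩⟩

end CompactModel

section FiniteColimits

attribute [local instance] Cardinal.fact_isRegular_aleph0

lemma isFinitelyPresentable_of_isColimit {C : Type (w + 1)} [Category.{w} C]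
    {K : Type} [SmallCategory K] [FinCategory K] {Y : K ⥤ C} {c : Cocone Y} (hc : IsColimit c)
    (h : ∀ j, IsFinitelyPresentable.{w} (Y.obj j)) : IsFinitelyPresentable.{w} c.pt :=
  isCardinalPresentable_of_isColimit c hc Cardinal.aleph0.{w} (by
    rw [hasCardinalLT_aleph0_iff]
    infer_instance)

variable {k : Type w} [Field k] {a : Type w} [SmallCategory a] [Preadditive a]
    [Linear k a] {C : Type (w + 1)} [Category.{w} C] [Preadditive C] [Linear k C]
    (ι : a ⥤ C)

/-- The image under `ι` of `x'' ⟶ x' ⟶ x` exhibits `ι x` as a cokernel. -/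
def IsCokernelSequence {x'' x' x : a} (g : x'' ⟶ x') (h : x' ⟶ x) : Prop :=
  ∃ w : ι.map g ≫ ι.map h = 0, Nonempty (IsColimit (CokernelCofork.ofπ (ι.map h) w))

variable {ι} (hι : IsCompactModel k ι) [HasColimitsOfSize.{w, w} C]
include hι

/-- Compact objects are closed under finite colimits, here under cokernels. -/
lemma IsCompactModel.exists_isCokernelSequence {x'' x' : a} (g : x'' ⟶ x') :
    ∃ (x : a) (h : x' ⟶ x), IsCokernelSequence ι g h := by
  have := hι.full
  have : HasCoequalizers C := inferInstance
  have hc : IsFinitelyPresentable.{w} (cokernel (ι.map g)) :=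
    isFinitelyPresentable_of_isColimit (colimit.isColimit (parallelPair (ι.map g) 0)) (by
      rintro (_ | _)
      · exact hι.compact x''
      · exact hι.compact x')
  obtain ⟨x, ⟨i⟩⟩ := hι.exists_iso _ hc
  refine ⟨x, ι.preimage (cokernel.π _ ≫ i.inv), ?_, ⟨?_⟩⟩
  · simp
  · exact (cokernelIsCokernel (ι.map g)).ofIsoColimit (Cofork.ext i.symm (by simp))

lemma IsCompactModel.hasBinaryBiproducts : HasBinaryBiproducts a := by
  have := hι.full
  have := hι.faithful
  have := hι.additive
  have := HasBinaryBiproducts.of_hasBinaryCoproducts (C := C)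
  refine ⟨fun x y => ?_⟩
  have hc : IsFinitelyPresentable.{w} (ι.obj x ⊞ ι.obj y) :=
    isFinitelyPresentable_of_isColimit (BinaryBiproduct.isColimit (ι.obj x) (ι.obj y)) (by
      rintro ⟨_ | _⟩
      · exact hι.compact x
      · exact hι.compact y)
  obtain ⟨z, ⟨i⟩⟩ := hι.exists_iso _ hc
  have h₁ {x y : a} {f g : x ⟶ y} (h : ι.map f = ι.map g) : f = g := ι.map_injective h
  exact hasBinaryBiproduct_of_total
    { pt := z
      fst := ι.preimage (i.hom ≫ biprod.fst)
      snd := ι.preimage (i.hom ≫ biprod.snd)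
      inl := ι.preimage (biprod.inl ≫ i.inv)
      inr := ι.preimage (biprod.inr ≫ i.inv)
      inl_fst := h₁ (by simp)
      inl_snd := h₁ (by simp)
      inr_fst := h₁ (by simp)
      inr_snd := h₁ (by simp) }
    (h₁ (by
      rw [ι.map_add]
      simp
      rw [← Preadditive.comp_add, ← Category.assoc, ← Category.assoc, ← Preadditive.add_comp]
      simp))

lemma IsCompactModel.nonempty : Nonempty a := by
  have hc : IsFinitelyPresentable.{w} (⊥_ C) :=
    isFinitelyPresentable_of_isColimit (colimit.isColimit (Functor.empty.{0} C))
      (fun j => j.as.elim)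
  obtain ⟨z, -⟩ := hι.exists_iso _ hc
  exact ⟨z⟩

end FiniteColimits

/-! ### Representability and Kan extensions that are left adjoints -/

section Representation

variable {a : Type w} [SmallCategory a] {C : Type (w + 1)} [Category.{w} C]
  [HasColimitsOfSize.{w, w} C] (ι : a ⥤ C) [ι.Full] [ι.Faithful]
  (hι : ∀ x, IsFinitelyPresentable.{w} (ι.obj x)) (H : aᵒᵖ ⥤ Type w)

/-- A presheaf on `a` whose category of elements is filtered. -/
structure HasFilteredElements : Prop where
  nonempty : ∃ x, Nonempty (H.obj (.op x))
  pair (x x' : a) (s : H.obj (.op x)) (s' : H.obj (.op x')) :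
    ∃ (z : a) (f : x ⟶ z) (f' : x' ⟶ z) (t : H.obj (.op z)),
      H.map f.op t = s ∧ H.map f'.op t = s'
  parallel (x x' : a) (f g : x ⟶ x') (s : H.obj (.op x')) (hs : H.map f.op s = H.map g.op s) :
    ∃ (z : a) (h : x' ⟶ z) (t : H.obj (.op z)), f ≫ h = g ≫ h ∧ H.map h.op t = s

variable {H} in
lemma HasFilteredElements.isFiltered (hH : HasFilteredElements H) : IsFiltered H.Elementsᵒᵖ := by
  have : Nonempty H.Elementsᵒᵖ := by
    obtain ⟨x, ⟨s⟩⟩ := hH.nonempty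
    exact ⟨.op ⟨.op x, s⟩⟩
  have : IsFilteredOrEmpty H.Elementsᵒᵖ :=
    { cocone_objs := by
        rintro ⟨⟨x⟩, s⟩ ⟨⟨x'⟩, s'⟩
        obtain ⟨z, f, f', t, h, h'⟩ := hH.pair x x' s s'
        exact ⟨.op ⟨.op z, t⟩, Quiver.Hom.op ⟨f.op, h⟩, Quiver.Hom.op ⟨f'.op, h'⟩, trivial⟩
      cocone_maps := by
        rintro ⟨⟨x⟩, s⟩ ⟨⟨x'⟩, s'⟩ ⟨⟨f, hf⟩⟩ ⟨⟨g, hg⟩⟩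
        obtain ⟨z, h, t, hfg, ht⟩ := hH.parallel x x' f.unop g.unop s' (hf.trans hg.symm)
        refine ⟨.op ⟨.op z, t⟩, Quiver.Hom.op ⟨h.op, ht⟩, Quiver.Hom.unop_inj ?_⟩
        exact Subtype.ext (Quiver.Hom.unop_inj hfg) }
  exact {}

include hι in
/-- Presheaves with a filtered category of elements are represented by objects of `C`. -/
theorem HasFilteredElements.exists_iso (hH : HasFilteredElements H) :
    ∃ z : C, Nonempty (H ≅ ι.op ⋙ yoneda.obj z) := by
  have := hH.isFiltered
  -- The representing object is the filtered colimit of `ι` over the elements of `H`.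
  let D : H.Elementsᵒᵖ ⥤ C := (CategoryOfElements.π H).leftOp ⋙ ι
  let hc := colimit.isColimit D
  have hw {x x' : a} (f : x ⟶ x') (s : H.obj (.op x')) :
      ι.map f ≫ colimit.ι D (.op ⟨.op x', s⟩) = colimit.ι D (.op ⟨.op x, H.map f.op s⟩) :=
    let X : H.Elements := ⟨.op x', s⟩
    let Y : H.Elements := ⟨.op x, H.map f.op s⟩
    let φ : X ⟶ Y := ⟨f.op, rfl⟩
    colimit.w D φ.op
  let t : H ⟶ ι.op ⋙ yoneda.obj (colimit D) :=
    { app x := ↾(fun s => colimit.ι D (.op ⟨x, s⟩))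
      naturality := by
        rintro ⟨x⟩ ⟨x'⟩ ⟨f⟩
        ext s
        exact (hw f s).symm }
  -- As `ι x` is compact, morphisms into the filtered colimit, and equalities between them, come
  -- from a finite stage, where full faithfulness of `ι` turns them into data in `a`.
  have ht (x : aᵒᵖ) : IsIso (t.app x) := by
    rw [isIso_iff_bijective]
    obtain ⟨x⟩ := x
    have := hι x
    constructor
    · intro s s' hs
      obtain ⟨⟨⟨z⟩, u⟩, ⟨⟨p, hp⟩⟩, ⟨⟨q, hq⟩⟩, h⟩ := IsFinitelyPresentable.exists_eq_of_isColimit hc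
        (X := ι.obj x) (i := .op ⟨.op x, s⟩) (j := .op ⟨.op x, s'⟩)
        (𝟙 _) (𝟙 _)
        ((Category.id_comp _).trans (Eq.trans hs (Category.id_comp _).symm))
      have h' : p.unop = q.unop :=
        ι.map_injective ((Category.id_comp _).symm.trans (h.trans (Category.id_comp _)))
      rw [← show H.map p u = s from hp, ← show H.map q u = s' from hq, Quiver.Hom.unop_inj h']
    · intro f
      obtain ⟨⟨⟨z⟩, u⟩, p, hp⟩ := IsFinitelyPresentable.exists_hom_of_isColimit
        (X := ι.obj x) hc f
      obtain ⟨p, rfl⟩ := ι.map_surjective (X := x) (Y := z) p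
      exact ⟨H.map p.op u, (hw p u).symm.trans hp⟩
  have := NatIso.isIso_of_isIso_app t
  exact ⟨colimit D, ⟨asIso t⟩⟩

end Representation

section KanExtension

variable {a C E : Type*} [Category* a] [Category.{w} C] [Category.{w} E] {ι : a ⥤ C}
  {G : a ⥤ E} {F : C ⥤ E} {α : G ⟶ ι ⋙ F}
  (hF : (Functor.LeftExtension.mk F α).IsPointwiseLeftKanExtension)

include hF

lemma pointwise_hom_ext {c : C} {e : E} {f g : F.obj c ⟶ e}
    (h : ∀ (x : a) (φ : ι.obj x ⟶ c), α.app x ≫ F.map φ ≫ f = α.app x ≫ F.map φ ≫ g) : f = g :=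
  (hF c).hom_ext fun φ =>
    (Category.assoc _ _ _).trans ((h φ.left φ.hom).trans (Category.assoc _ _ _).symm)

lemma pointwise_exists_desc {c : C} {e : E} (θ : ∀ (x : a) (_ : ι.obj x ⟶ c), G.obj x ⟶ e)
    (hθ : ∀ (x x' : a) (f : x ⟶ x') (φ : ι.obj x' ⟶ c),
      G.map f ≫ θ x' φ = θ x (ι.map f ≫ φ)) :
    ∃ f : F.obj c ⟶ e, ∀ (x : a) (φ : ι.obj x ⟶ c), α.app x ≫ F.map φ ≫ f = θ x φ := by
  let s : Cocone (CostructuredArrow.proj ι c ⋙ G) :=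
    { pt := e
      ι :=
        { app φ := θ φ.left φ.hom
          naturality φ ψ f :=
            (hθ _ _ f.left ψ.hom).trans
              ((congrArg (θ φ.left) (CostructuredArrow.w f)).trans (Category.comp_id _).symm) } }
  refine ⟨(hF c).desc s, fun x φ => ?_⟩
  exact (Category.assoc _ _ _).symm.trans ((hF c).fac s (CostructuredArrow.mk φ))

variable [ι.IsDense]

/-- If `E (G -, e)` is represented along `ι` by an object of `C`, for all `e`, then the left Kan
extension of `G` along `ι` is a left adjoint. -/
theorem pointwise_isLeftAdjoint
    (hG : ∀ e : E, ∃ z : C, Nonempty (G.op ⋙ yoneda.obj e ≅ ι.op ⋙ yoneda.obj z)) :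
    F.IsLeftAdjoint ∧ IsIso α := by
  -- A morphism `F c ⟶ e` is a natural family `G x ⟶ e` over `ι x ⟶ c`, that is, a family `ι x ⟶ z`,
  -- that is, by density, a morphism `c ⟶ z`. So `u : F z ⟶ e` is a universal arrow.
  have key (e : E) : ∃ (z : C) (u : F.obj z ⟶ e),
      (∀ x, Function.Bijective fun φ : ι.obj x ⟶ z => α.app x ≫ F.map φ ≫ u) ∧
      (∀ (c : C) (f : F.obj c ⟶ e), ∃! g : c ⟶ z, F.map g ≫ u = f) := by
    obtain ⟨z, ⟨σ⟩⟩ := hG e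
    have hσ {x x' : a} (f : x ⟶ x') (g : G.obj x' ⟶ e) :
        σ.hom.app (.op x) (G.map f ≫ g) = ι.map f ≫ σ.hom.app (.op x') g :=
      NatTrans.naturality_apply σ.hom f.op g
    have hσ' {x x' : a} (f : x ⟶ x') (g : ι.obj x' ⟶ z) :
        σ.inv.app (.op x) (ι.map f ≫ g) = G.map f ≫ σ.inv.app (.op x') g :=
      NatTrans.naturality_apply σ.inv f.op g
    have h₁ (x : a) (g : G.obj x ⟶ e) : σ.inv.app (.op x) (σ.hom.app (.op x) g) = g := by simp
    have h₂ (x : a) (g : ι.obj x ⟶ z) : σ.hom.app (.op x) (σ.inv.app (.op x) g) = g := by simp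
    obtain ⟨u, hu⟩ := pointwise_exists_desc hF (fun x φ => (σ.inv.app (.op x) φ : G.obj x ⟶ e))
      (fun x x' f φ => (hσ' f φ).symm)
    refine ⟨z, u, fun x => ⟨fun φ ψ h => ?_, fun f => ?_⟩, fun c f => ?_⟩
    · dsimp only at h
      rw [hu, hu] at h
      rw [← h₂ x φ, h, h₂]
    · exact ⟨σ.hom.app (.op x) f, (hu x _).trans (h₁ x f)⟩
    · obtain ⟨g, hg⟩ := dense_exists_desc ι (𝟭 C) (X := c) (e := z)
        (fun x φ => (σ.hom.app (.op x) (α.app x ≫ F.map φ ≫ f) : ι.obj x ⟶ z))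
        (fun x x' p φ => by
          have := hσ p (α.app x' ≫ F.map φ ≫ f)
          rw [α.naturality_assoc] at this
          dsimp at this ⊢
          rw [← this, F.map_comp_assoc])
      refine ⟨g, pointwise_hom_ext hF fun x φ => ?_, fun g' hg' => ?_⟩
      · rw [← F.map_comp_assoc, hu, show φ ≫ g = _ from hg x φ, h₁]
      · refine dense_hom_ext ι (𝟭 C) fun x φ => ?_
        rw [hg]
        change φ ≫ g' = _
        rw [← hg', ← F.map_comp_assoc, hu, h₂]
  refine ⟨?_, ?_⟩
  · have (e : E) : HasTerminal (CostructuredArrow F e) := by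
      obtain ⟨z, u, -, hu⟩ := key e
      refine (IsTerminal.ofUniqueHom (Y := CostructuredArrow.mk u) (fun f =>
        CostructuredArrow.homMk (hu _ f.hom).choose (hu _ f.hom).choose_spec.1)
        (fun f m => ?_)).hasTerminal
      ext
      exact (hu _ f.hom).choose_spec.2 _ (CostructuredArrow.w m)
    exact isLeftAdjoint_of_costructuredArrowTerminals F
  -- Morphisms to `e` from `F (ι x)` and from `G x` both correspond to morphisms `ι x ⟶ z`,
  -- compatibly with `α`.
  · have (x : a) : IsIso (α.app x) := by
      refine isIso_of_coyoneda_map_bijective _ fun e => ?_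
      obtain ⟨z, u, h₁, hu⟩ := key e
      refine ⟨fun f f' h => ?_, fun f => ?_⟩
      · obtain ⟨g, rfl, -⟩ := hu _ f
        obtain ⟨g', rfl, -⟩ := hu _ f'
        rw [(h₁ x).1 h]
      · obtain ⟨φ, hφ⟩ := (h₁ x).2 f
        exact ⟨F.map φ ≫ u, hφ⟩
    exact NatIso.isIso_of_isIso_app α

end KanExtension

/-! ### Presheaves of modules -/

section ModulePresheaves

attribute [local instance] Cardinal.fact_isRegular_aleph0

variable (k : Type w) [Field k]

/-- Morphisms out of the free module of rank one. -/
def homFromUnitEquiv (M : ModuleCat.{w} k) : (ModuleCat.of k k ⟶ M) ≃ M :=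
  ModuleCat.homEquiv.trans (LinearMap.ringLmapEquivSelf k k M).toEquiv

@[simp]
lemma homFromUnitEquiv_apply {M : ModuleCat.{w} k} (f : ModuleCat.of k k ⟶ M) :
    homFromUnitEquiv k M f = f.hom (1 : k) := rfl

lemma homFromUnitEquiv_comp {M N : ModuleCat.{w} k} (f : ModuleCat.of k k ⟶ M) (g : M ⟶ N) :
    homFromUnitEquiv k N (f ≫ g) = g (homFromUnitEquiv k M f) := rfl

/-- The functor corepresented by `k` is the forgetful functor, which preserves filtered colimits. -/
instance : IsFinitelyPresentable.{w} (ModuleCat.of k k) := by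
  let e : coyoneda.obj (.op (ModuleCat.of k k)) ≅ forget (ModuleCat.{w} k) :=
    NatIso.ofComponents (fun M => (homFromUnitEquiv k M).toIso)
  constructor
  intro J _ _
  have := isFiltered_of_isCardinalFiltered J Cardinal.aleph0.{w}
  exact preservesColimitsOfShape_of_natIso e.symm

instance : IsLocallyFinitelyPresentable.{w} (ModuleCat.{w} k) := by
  change IsCardinalLocallyPresentable _ Cardinal.aleph0.{w}
  rw [IsCardinalLocallyPresentable.iff_exists_isStrongGenerator]
  refine ⟨.ofObj (fun (_ : PUnit.{w + 1}) => ModuleCat.of k k), inferInstance, ?_, ?_⟩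
  · rw [ObjectProperty.isStrongGenerator_iff]
    have hP : ObjectProperty.ofObj (fun (_ : PUnit.{w + 1}) => ModuleCat.of k k)
        (ModuleCat.of k k) := ObjectProperty.ofObj_apply (fun (_ : PUnit.{w + 1}) => _) ⟨⟩
    refine ⟨fun M N f g h => ?_, fun M N i _ h => ?_⟩
    · ext m
      have h := congrArg (homFromUnitEquiv k N) (h _ hP ((homFromUnitEquiv k M).symm m))
      rw [homFromUnitEquiv_comp, homFromUnitEquiv_comp, Equiv.apply_symm_apply] at h
      exact h
    · have hi : Mono i := inferInstance
      refine (ConcreteCategory.isIso_iff_bijective i).2 ⟨(ModuleCat.mono_iff_injective i).1 hi,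
        fun n => ?_⟩
      obtain ⟨g, hg⟩ := h _ hP ((homFromUnitEquiv k N).symm n)
      refine ⟨homFromUnitEquiv k M g, ?_⟩
      rw [← homFromUnitEquiv_comp]
      exact (congrArg (homFromUnitEquiv k N) hg).trans (Equiv.apply_symm_apply _ _)
  · rintro _ ⟨_⟩
    exact inferInstanceAs (IsFinitelyPresentable.{w} (ModuleCat.of k k))

variable {k} {X : Type w} [SmallCategory X]

/-- The presheaf of modules freely generated by a section over `x`. -/
noncomputable abbrev freePresheaf (k : Type w) [Field k] (x : X) : Xᵒᵖ ⥤ ModuleCat.{w} k :=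
  Presheaf.freeYoneda x (ModuleCat.of k k)

/-- Sections of `p` over `x` are morphisms from the free presheaf. -/
noncomputable def freePresheafEquiv {x : X} {p : Xᵒᵖ ⥤ ModuleCat.{w} k} :
    (freePresheaf k x ⟶ p) ≃ p.obj (.op x) :=
  Presheaf.freeYonedaHomEquiv.trans (homFromUnitEquiv k _)

lemma freePresheafEquiv_comp {x : X} {p q : Xᵒᵖ ⥤ ModuleCat.{w} k} (f : freePresheaf k x ⟶ p)
    (g : p ⟶ q) : freePresheafEquiv (f ≫ g) = g.app (.op x) (freePresheafEquiv f) := by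
  simp [freePresheafEquiv, Presheaf.freeYonedaHomEquiv_comp]

/-- The universal section. -/
noncomputable def freeGen (k : Type w) [Field k] (x : X) : (freePresheaf k x).obj (.op x) :=
  freePresheafEquiv (𝟙 _)

lemma app_freeGen {x : X} {p : Xᵒᵖ ⥤ ModuleCat.{w} k} (f : freePresheaf k x ⟶ p) :
    f.app (.op x) (freeGen k x) = freePresheafEquiv f := by
  rw [freeGen, ← freePresheafEquiv_comp, Category.id_comp]

lemma freePresheafEquiv_symm_comp {x : X} {p q : Xᵒᵖ ⥤ ModuleCat.{w} k} (s : p.obj (.op x))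
    (g : p ⟶ q) : freePresheafEquiv.symm s ≫ g = freePresheafEquiv.symm (g.app _ s) := by
  apply freePresheafEquiv.injective
  rw [freePresheafEquiv_comp, Equiv.apply_symm_apply, Equiv.apply_symm_apply]

lemma freePresheafEquiv_zero {x : X} {p : Xᵒᵖ ⥤ ModuleCat.{w} k} :
    freePresheafEquiv (0 : freePresheaf k x ⟶ p) = 0 := by
  rw [← app_freeGen]
  rfl

instance (x : X) : IsFinitelyPresentable.{w} (freePresheaf k x) :=
  inferInstanceAs (IsCardinalPresentable _ Cardinal.aleph0.{w})

lemma isFinitelyPresentable_cokernel {x : X} {p : Xᵒᵖ ⥤ ModuleCat.{w} k}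
    (f : freePresheaf k x ⟶ p) (hp : IsFinitelyPresentable.{w} p) :
    IsFinitelyPresentable.{w} (cokernel f) :=
  isFinitelyPresentable_of_isColimit (colimit.isColimit (parallelPair f 0)) (by
      rintro (_ | _)
      · exact inferInstanceAs (IsFinitelyPresentable.{w} (freePresheaf k x))
      · exact hp)

end ModulePresheaves

/-! ### Bilex presheaves as local objects -/

section Orthogonality

variable {P : Type*} [Category* P] [HasZeroMorphisms P] {A B Z : P} (f : A ⟶ B) [HasCokernel f]

/-- Locality with respect to a cokernel projection imposes an equation; this encodes bilinearity. -/
lemma bijective_cokernel_π_iff (p : P) : Function.Bijective (fun g : cokernel f ⟶ p =>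
    cokernel.π f ≫ g) ↔ ∀ g : B ⟶ p, f ≫ g = 0 := by
  refine ⟨fun h g => ?_, fun h => ⟨fun g g' hg => coequalizer.hom_ext hg, fun g =>
    ⟨cokernel.desc f g (h g), by simp⟩⟩⟩
  obtain ⟨g, rfl⟩ := h.2 g
  simp

/-- Locality with respect to a map out of a cokernel imposes unique extension of whatever satisfies
an equation; this encodes left exactness. -/
lemma bijective_cokernel_desc_iff (v : B ⟶ Z) (w : f ≫ v = 0) (p : P) :
    Function.Bijective (fun g : Z ⟶ p => cokernel.desc f v w ≫ g) ↔
      ∀ s : B ⟶ p, f ≫ s = 0 → ∃! t : Z ⟶ p, v ≫ t = s := by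
  have h (t : Z ⟶ p) (s : cokernel f ⟶ p) :
      cokernel.desc f v w ≫ t = s ↔ v ≫ t = cokernel.π f ≫ s := by
    rw [← cancel_epi (cokernel.π f)]
    simp
  rw [Function.bijective_iff_existsUnique]
  simp only [h]
  exact ⟨fun h s hs => by simpa using h (cokernel.desc f s hs), fun h s => h _ (by simp)⟩

end Orthogonality

section Bilex

variable {k : Type w} [Field k] {a b : Type w} [SmallCategory a] [SmallCategory b]

/-- Restriction of sections of a presheaf of modules of two variables. -/
def res (p : (a × b)ᵒᵖ ⥤ ModuleCat.{w} k) {x x' : a} {y y' : b} (f : x ⟶ x') (g : y ⟶ y') :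
    p.obj (.op (x', y')) →ₗ[k] p.obj (.op (x, y)) :=
  (p.map (Quiver.Hom.op (Prod.mkHom f g))).hom

variable (p q : (a × b)ᵒᵖ ⥤ ModuleCat.{w} k)

@[simp]
lemma res_id (x : a) (y : b) (s : p.obj (.op (x, y))) : res p (𝟙 x) (𝟙 y) s = s :=
  congrArg (fun t => t.hom s) (p.map_id (.op (x, y)))

lemma res_res {x x' x'' : a} {y y' y'' : b} (f : x ⟶ x') (f' : x' ⟶ x'') (g : y ⟶ y')
    (g' : y' ⟶ y'') (s : p.obj (.op (x'', y''))) :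
    res p f g (res p f' g' s) = res p (f ≫ f') (g ≫ g') s :=
  congrArg (fun t => t.hom s) (p.map_comp (Quiver.Hom.op (Prod.mkHom f' g'))
    (Quiver.Hom.op (Prod.mkHom f g))).symm

variable {p q} in
lemma app_res (t : p ⟶ q) {x x' : a} {y y' : b} (f : x ⟶ x') (g : y ⟶ y')
    (s : p.obj (.op (x', y'))) :
    (t.app (.op (x, y))).hom (res p f g s) = res q f g ((t.app (.op (x', y'))).hom s) :=
  congrArg (fun t => t.hom s) (t.naturality (Quiver.Hom.op (Prod.mkHom f g)))

variable [Preadditive a] [Preadditive b] [Linear k a] [Linear k b]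

/-- Presheaves of modules on `a × b` which are bilinear. -/
structure IsBilinearPresheaf : Prop where
  add_left {x x' : a} (f f' : x ⟶ x') (y : b) (s : p.obj (.op (x', y))) :
    res p (f + f') (𝟙 y) s = res p f (𝟙 y) s + res p f' (𝟙 y) s
  smul_left {x x' : a} (r : k) (f : x ⟶ x') (y : b) (s : p.obj (.op (x', y))) :
    res p (r • f) (𝟙 y) s = r • res p f (𝟙 y) s
  add_right (x : a) {y y' : b} (g g' : y ⟶ y') (s : p.obj (.op (x, y'))) :
    res p (𝟙 x) (g + g') s = res p (𝟙 x) g s + res p (𝟙 x) g' s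
  smul_right (x : a) {y y' : b} (r : k) (g : y ⟶ y') (s : p.obj (.op (x, y'))) :
    res p (𝟙 x) (r • g) s = r • res p (𝟙 x) g s

variable {C D : Type (w + 1)} [Category.{w} C] [Category.{w} D] [Preadditive C] [Preadditive D]
  (ι : a ⥤ C) (κ : b ⥤ D)

/-- Presheaves of modules on `a × b` which are bilinear and left exact in each variable. -/
structure IsBilex : Prop extends IsBilinearPresheaf p where
  lex_left {x'' x' x : a} (g : x'' ⟶ x') (h : x' ⟶ x) (hgh : IsCokernelSequence ι g h) (y : b)
    (s : p.obj (.op (x', y))) (hs : res p g (𝟙 y) s = 0) : ∃! t, res p h (𝟙 y) t = s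
  lex_right (x : a) {y'' y' y : b} (g : y'' ⟶ y') (h : y' ⟶ y) (hgh : IsCokernelSequence κ g h)
    (s : p.obj (.op (x, y'))) (hs : res p (𝟙 x) g s = 0) : ∃! t, res p (𝟙 x) h t = s

variable (k a b) in
/-- The equations that define bilinear presheaves. -/
inductive BilinearIndex : Type w
  | add_left {x x' : a} (f f' : x ⟶ x') (y : b)
  | smul_left {x x' : a} (r : k) (f : x ⟶ x') (y : b)
  | add_right (x : a) {y y' : b} (g g' : y ⟶ y')
  | smul_right (x : a) {y y' : b} (r : k) (g : y ⟶ y')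

/-- The element of a free presheaf which has to act as zero. -/
noncomputable def BilinearIndex.equation :
    BilinearIndex k a b → Σ x y : a × b, (freePresheaf k y).obj (.op x)
  | add_left (x := x) (x' := x') f f' y => ⟨(x, y), (x', y),
      res _ (f + f') (𝟙 y) (freeGen k (x', y)) - (res _ f (𝟙 y) (freeGen k (x', y)) +
        res _ f' (𝟙 y) (freeGen k (x', y)))⟩
  | smul_left (x := x) (x' := x') r f y => ⟨(x, y), (x', y),
      res _ (r • f) (𝟙 y) (freeGen k (x', y)) - r • res _ f (𝟙 y) (freeGen k (x', y))⟩
  | add_right x (y := y) (y' := y') g g' => ⟨(x, y), (x, y'),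
      res _ (𝟙 x) (g + g') (freeGen k (x, y')) - (res _ (𝟙 x) g (freeGen k (x, y')) +
        res _ (𝟙 x) g' (freeGen k (x, y')))⟩
  | smul_right x (y := y) (y' := y') r g => ⟨(x, y), (x, y'),
      res _ (𝟙 x) (r • g) (freeGen k (x, y')) - r • res _ (𝟙 x) g (freeGen k (x, y'))⟩

/-- The quotient of a free presheaf by an equation. -/
noncomputable def BilinearIndex.morphism (i : BilinearIndex k a b) :
    Arrow ((a × b)ᵒᵖ ⥤ ModuleCat.{w} k) :=
  Arrow.mk (cokernel.π (freePresheafEquiv.symm i.equation.2.2))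

/-- The left exactness conditions. -/
inductive LexIndex : Type w
  | left {x'' x' x : a} (g : x'' ⟶ x') (h : x' ⟶ x) (hgh : g ≫ h = 0)
      (hc : IsCokernelSequence ι g h) (y : b)
  | right (x : a) {y'' y' y : b} (g : y'' ⟶ y') (h : y' ⟶ y) (hgh : g ≫ h = 0)
      (hc : IsCokernelSequence κ g h)

variable {p}

omit [Preadditive a] [Preadditive b] [Linear k a] [Linear k b] in
lemma app_symm_freeGen {x : a} {y : b} (s : p.obj (.op (x, y))) :
    ((freePresheafEquiv.symm s).app (.op (x, y))).hom (freeGen k (x, y)) = s :=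
  (app_freeGen _).trans (Equiv.apply_symm_apply _ _)

omit [Preadditive a] [Preadditive b] [Linear k a] [Linear k b] in
lemma app_symm_res_freeGen {x x' : a} {y y' : b} (s : p.obj (.op (x', y'))) (f : x ⟶ x')
    (g : y ⟶ y') : ((freePresheafEquiv.symm s).app (.op (x, y))).hom
      (res _ f g (freeGen k (x', y'))) = res p f g s := by
  rw [app_res, app_symm_freeGen]

/-- A morphism between free presheaves. -/
noncomputable def freeMap {x x' : a} {y y' : b}
    (s : (freePresheaf k (x', y')).obj (.op (x, y))) :
    freePresheaf k (x, y) ⟶ freePresheaf k (x', y') := freePresheafEquiv.symm s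

omit [Preadditive a] [Preadditive b] [Linear k a] [Linear k b] in
lemma freeMap_comp_symm {x x' : a} {y y' : b}
    (s : (freePresheaf k (x', y')).obj (.op (x, y))) (t : p.obj (.op (x', y'))) :
    freeMap s ≫ freePresheafEquiv.symm t =
      freePresheafEquiv.symm (((freePresheafEquiv.symm t).app (.op (x, y))).hom s) :=
  freePresheafEquiv_symm_comp _ _

omit [Preadditive a] [Preadditive b] [Linear k a] [Linear k b] in
lemma freeMap_sub_comp_symm {x x' : a} {y y' : b} (f f' : x ⟶ x') (g g' : y ⟶ y')
    (t : p.obj (.op (x', y'))) :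
    freeMap (res _ f g (freeGen k (x', y')) - res _ f' g' (freeGen k (x', y'))) ≫
      freePresheafEquiv.symm t = freePresheafEquiv.symm (res p f g t - res p f' g' t) := by
  rw [freeMap_comp_symm, map_sub, app_symm_res_freeGen, app_symm_res_freeGen]

omit [Preadditive a] [Preadditive b] [Linear k a] [Linear k b] in
lemma freeMap_sub_comp_freeMap {x'' x' x : a} {y'' y' y : b} (f f' : x'' ⟶ x') (g g' : y'' ⟶ y')
    (h : x' ⟶ x) (h' : y' ⟶ y) (w : f ≫ h = f' ≫ h) (w' : g ≫ h' = g' ≫ h') :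
    freeMap (res _ f g (freeGen k (x', y')) - res _ f' g' (freeGen k (x', y'))) ≫
      freeMap (res _ h h' (freeGen k (x, y))) = 0 := by
  refine (freeMap_sub_comp_symm _ _ _ _ _).trans ?_
  rw [res_res, res_res, w, w', sub_self, Equiv.symm_apply_eq, freePresheafEquiv_zero]

variable {ι κ}

/-- The morphism inverted by presheaves satisfying a left exactness condition. -/
noncomputable def LexIndex.morphism : LexIndex ι κ → Arrow ((a × b)ᵒᵖ ⥤ ModuleCat.{w} k)
  | left (x'' := x'') (x' := x') (x := x) g h hgh _ y =>
      -- The restriction along `0` is subtracted because free presheaves are not bilinear: there the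
      -- restriction along `g ≫ h = 0` need not vanish, so `g` alone would not give a zero
      -- composite.
      Arrow.mk (cokernel.desc
        (freeMap (x := x'') (y := y)
          (res _ g (𝟙 y) (freeGen k (x', y)) - res _ 0 (𝟙 y) (freeGen k (x', y))))
        (freeMap (res _ h (𝟙 y) (freeGen k (x, y))))
        (freeMap_sub_comp_freeMap _ _ _ _ _ _ (by simpa) rfl))
  | right x (y'' := y'') (y' := y') (y := y) g h hgh _ =>
      Arrow.mk (cokernel.desc
        (freeMap (x := x) (y := y'')
          (res _ (𝟙 x) g (freeGen k (x, y')) - res _ (𝟙 x) 0 (freeGen k (x, y'))))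
        (freeMap (res _ (𝟙 x) h (freeGen k (x, y))))
        (freeMap_sub_comp_freeMap _ _ _ _ _ _ rfl (by simpa)))

variable (k ι κ) in
/-- The morphisms with respect to which the bilex presheaves are the local objects. -/
noncomputable def bilexMorphisms : MorphismProperty ((a × b)ᵒᵖ ⥤ ModuleCat.{w} k) :=
  .ofHoms (fun i : BilinearIndex k a b ⊕ LexIndex ι κ =>
    (i.elim BilinearIndex.morphism LexIndex.morphism).hom)

instance : MorphismProperty.IsSmall.{w} (bilexMorphisms k ι κ) := MorphismProperty.isSmall_ofHoms _

/-- By Yoneda, morphisms from a free presheaf are sections, so locality for the bilinear part says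
that each listed element acts as zero on every section. -/
lemma isLocal_bilexMorphisms_iff' : (bilexMorphisms k ι κ).isLocal p ↔
    (∀ (i : BilinearIndex k a b) (s : p.obj (.op i.equation.2.1)),
      ((freePresheafEquiv.symm s).app (.op i.equation.1)).hom i.equation.2.2 = 0) ∧
    ∀ (i : LexIndex ι κ), Function.Bijective (fun (g : _ ⟶ p) =>
      (i.morphism (k := k)).hom ≫ g) := by
  have h : (bilexMorphisms k ι κ).isLocal p ↔
    (∀ (i : BilinearIndex k a b), Function.Bijective (fun (g : _ ⟶ p) => i.morphism.hom ≫ g)) ∧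
    ∀ (i : LexIndex ι κ), Function.Bijective (fun (g : _ ⟶ p) =>
      (i.morphism (k := k)).hom ≫ g) := by
    have h' (i) := MorphismProperty.ofHoms.mk (f := fun i : BilinearIndex k a b ⊕ LexIndex ι κ =>
      (i.elim BilinearIndex.morphism LexIndex.morphism).hom) i
    refine ⟨fun h => ⟨fun i => h _ (h' (.inl i)), fun i => h _ (h' (.inr i))⟩, fun h => ?_⟩
    rintro _ _ _ ⟨i | i⟩
    · exact h.1 i
    · exact h.2 i
  rw [h]
  refine and_congr_left fun _ => forall_congr' fun i => ?_
  refine (bijective_cokernel_π_iff _ p).trans ?_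
  refine (freePresheafEquiv (p := p)).forall_congr fun s => ?_
  rw [← freePresheafEquiv.apply_eq_iff_eq, freePresheafEquiv_zero, freePresheafEquiv_comp,
    Equiv.apply_symm_apply]
  obtain ⟨s, rfl⟩ := freePresheafEquiv.symm.surjective s
  rw [Equiv.apply_symm_apply]

omit [Preadditive a] [Preadditive b] [Linear k a] [Linear k b] in
lemma app_symm_sub_add_eq_zero_iff {x x' : a} {y y' : b} (f f' f'' : x ⟶ x') (g g' g'' : y ⟶ y')
    (s : p.obj (.op (x', y'))) :
    ((freePresheafEquiv.symm s).app (.op (x, y))).hom (res _ f g (freeGen k (x', y')) -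
      (res _ f' g' (freeGen k (x', y')) + res _ f'' g'' (freeGen k (x', y')))) = 0 ↔
      res p f g s = res p f' g' s + res p f'' g'' s := by
  rw [map_sub, map_add, app_symm_res_freeGen, app_symm_res_freeGen, app_symm_res_freeGen,
    sub_eq_zero]

omit [Preadditive a] [Preadditive b] [Linear k a] [Linear k b] in
lemma app_symm_sub_smul_eq_zero_iff {x x' : a} {y y' : b} (f f' : x ⟶ x') (g g' : y ⟶ y')
    (r : k) (s : p.obj (.op (x', y'))) :
    ((freePresheafEquiv.symm s).app (.op (x, y))).hom (res _ f g (freeGen k (x', y')) -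
      r • res _ f' g' (freeGen k (x', y'))) = 0 ↔ res p f g s = r • res p f' g' s := by
  rw [map_sub, map_smul, app_symm_res_freeGen, app_symm_res_freeGen, sub_eq_zero]

omit [Preadditive a] [Preadditive b] [Linear k a] [Linear k b] in
lemma bijective_lex_iff {x'' x' x : a} {y'' y' y : b} (f f' : x'' ⟶ x') (g g' : y'' ⟶ y')
    (h : x' ⟶ x) (h' : y' ⟶ y) (w : f ≫ h = f' ≫ h) (w' : g ≫ h' = g' ≫ h') :
    Function.Bijective (fun (t : _ ⟶ p) => cokernel.desc
      (freeMap (res _ f g (freeGen k (x', y')) - res _ f' g' (freeGen k (x', y'))))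
      (freeMap (res _ h h' (freeGen k (x, y)))) (freeMap_sub_comp_freeMap f f' g g' h h' w w') ≫ t) ↔
      ∀ s, res p f g s - res p f' g' s = 0 → ∃! t, res p h h' t = s := by
  refine (bijective_cokernel_desc_iff _ _ _ _).trans ?_
  refine (freePresheafEquiv (p := p)).forall_congr fun s => ?_
  obtain ⟨s, rfl⟩ := freePresheafEquiv.symm.surjective s
  rw [Equiv.apply_symm_apply, freeMap_sub_comp_symm, Equiv.symm_apply_eq, freePresheafEquiv_zero]
  refine imp_congr Iff.rfl ?_
  refine (freePresheafEquiv (p := p)).existsUnique_congr fun {t} => ?_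
  obtain ⟨t, rfl⟩ := freePresheafEquiv.symm.surjective t
  rw [Equiv.apply_symm_apply, freeMap_comp_symm, app_symm_res_freeGen, Equiv.apply_eq_iff_eq]

lemma IsBilinearPresheaf.zero_left (hp : IsBilinearPresheaf p) {x x' : a} (y : b)
    (s : p.obj (.op (x', y))) : res p (0 : x ⟶ x') (𝟙 y) s = 0 := by
  simpa using hp.add_left (0 : x ⟶ x') 0 y s

lemma IsBilinearPresheaf.zero_right (hp : IsBilinearPresheaf p) (x : a) {y y' : b}
    (s : p.obj (.op (x, y'))) : res p (𝟙 x) (0 : y ⟶ y') s = 0 := by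
  simpa using hp.add_right x (0 : y ⟶ y') 0 s

/-- Bilinearity has to be extracted first: it makes the restriction along `0` vanish, after which
the lex morphisms express left exactness. -/
theorem isLocal_bilexMorphisms_iff [ι.Faithful] [κ.Faithful] [ι.Additive] [κ.Additive] :
    (bilexMorphisms k ι κ).isLocal p ↔ IsBilex p ι κ := by
  rw [isLocal_bilexMorphisms_iff']
  constructor
  · rintro ⟨h₁, h₂⟩
    have H : IsBilinearPresheaf p :=
      { add_left f f' y s := (app_symm_sub_add_eq_zero_iff ..).1 (h₁ (.add_left f f' y) s)
        smul_left r f y s := (app_symm_sub_smul_eq_zero_iff ..).1 (h₁ (.smul_left r f y) s)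
        add_right x _ _ g g' s := (app_symm_sub_add_eq_zero_iff ..).1 (h₁ (.add_right x g g') s)
        smul_right x _ _ r g s :=
          (app_symm_sub_smul_eq_zero_iff ..).1 (h₁ (.smul_right x r g) s) }
    refine ⟨H, fun g h hgh y s hs => ?_, fun x _ _ _ g h hgh s hs => ?_⟩
    · have w : g ≫ h = 0 := ι.map_injective (by simpa using hgh.choose)
      exact (bijective_lex_iff g 0 (𝟙 y) (𝟙 y) h (𝟙 y) (by simpa) rfl).1
        (h₂ (.left g h w hgh y)) s (by rw [H.zero_left, sub_zero, hs])
    · have w : g ≫ h = 0 := κ.map_injective (by simpa using hgh.choose)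
      exact (bijective_lex_iff (𝟙 x) (𝟙 x) g 0 (𝟙 x) h rfl (by simpa)).1
        (h₂ (.right x g h w hgh)) s (by rw [H.zero_right, sub_zero, hs])
  · intro H
    refine ⟨?_, ?_⟩
    · rintro (⟨f, f', y⟩ | ⟨r, f, y⟩ | ⟨x, g, g'⟩ | ⟨x, r, g⟩) s
      · exact (app_symm_sub_add_eq_zero_iff ..).2 (H.add_left f f' y s)
      · exact (app_symm_sub_smul_eq_zero_iff ..).2 (H.smul_left r f y s)
      · exact (app_symm_sub_add_eq_zero_iff ..).2 (H.add_right x g g' s)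
      · exact (app_symm_sub_smul_eq_zero_iff ..).2 (H.smul_right x r g s)
    · rintro (⟨g, h, w, hgh, y⟩ | ⟨x, g, h, w, hgh⟩)
      · refine (bijective_lex_iff g 0 (𝟙 y) (𝟙 y) h (𝟙 y) (by simpa) rfl).2 fun s hs => ?_
        rw [H.zero_left, sub_zero] at hs
        exact H.lex_left g h hgh y s hs
      · refine (bijective_lex_iff (𝟙 x) (𝟙 x) g 0 (𝟙 x) h rfl (by simpa)).2 fun s hs => ?_
        rw [H.zero_right, sub_zero] at hs
        exact H.lex_right x g h hgh s hs

attribute [local instance] Cardinal.fact_isRegular_aleph0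

omit [Preadditive a] [Preadditive b] [Linear k a] [Linear k b] in
lemma isFinitelyPresentable_cokernel_desc {x'' x' x : a × b}
    (f : freePresheaf k x'' ⟶ freePresheaf k x')
    (v : freePresheaf k x' ⟶ freePresheaf k x) (w : f ≫ v = 0) :
    IsFinitelyPresentable.{w} (Arrow.mk (cokernel.desc f v w)).left ∧
      IsFinitelyPresentable.{w} (Arrow.mk (cokernel.desc f v w)).right :=
  ⟨isFinitelyPresentable_cokernel f inferInstance,
    inferInstanceAs (IsFinitelyPresentable.{w} (freePresheaf k x))⟩

/-- Compactness of all sources and targets is what makes the local objects reflective and locally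
finitely presentable. -/
lemma isFinitelyPresentable_bilexMorphisms ⦃p q : (a × b)ᵒᵖ ⥤ ModuleCat.{w} k⦄ (f : p ⟶ q)
    (hf : bilexMorphisms k ι κ f) :
    IsFinitelyPresentable.{w} p ∧ IsFinitelyPresentable.{w} q := by
  obtain ⟨i | i⟩ := hf
  · exact ⟨inferInstanceAs (IsFinitelyPresentable.{w} (freePresheaf k _)),
      isFinitelyPresentable_cokernel _ inferInstance⟩
  · obtain ⟨g, h, w, hgh, y⟩ | ⟨x, g, h, w, hgh⟩ := i
    · exact isFinitelyPresentable_cokernel_desc _ _ _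
    · exact isFinitelyPresentable_cokernel_desc _ _ _

lemma isRightAdjoint_ι_isLocal_bilexMorphisms :
    (bilexMorphisms k ι κ).isLocal.ι.IsRightAdjoint :=
  MorphismProperty.isRightAdjoint_ι_isLocal _ Cardinal.aleph0.{w}
    isFinitelyPresentable_bilexMorphisms

lemma isLocallyFinitelyPresentable_isLocal_bilexMorphisms :
    IsLocallyFinitelyPresentable.{w} (bilexMorphisms k ι κ).isLocal.FullSubcategory :=
  MorphismProperty.isLocallyPresentable_isLocal _ Cardinal.aleph0.{w}
    isFinitelyPresentable_bilexMorphisms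

end Bilex

lemma isDense_of_existsUnique {a A : Type*} [Category* a] [Category* A] (F : a ⥤ A)
    (h : ∀ (X e : A) (θ : ∀ (Y : a) (_ : F.obj Y ⟶ X), F.obj Y ⟶ e),
      (∀ (Y Y' : a) (f : Y ⟶ Y') (φ : F.obj Y' ⟶ X), F.map f ≫ θ Y' φ = θ Y (F.map f ≫ φ)) →
      ∃! t : X ⟶ e, ∀ (Y : a) (φ : F.obj Y ⟶ X), φ ≫ t = θ Y φ) : F.IsDense where
  isDenseAt X := by
    refine ⟨IsColimit.ofExistsUnique fun (s : Cocone (CostructuredArrow.proj F X ⋙ F)) => ?_⟩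
    obtain ⟨t, ht, ht'⟩ := h X s.pt (fun Y φ => s.ι.app (CostructuredArrow.mk φ))
      (fun Y Y' f φ => s.w (CostructuredArrow.homMk f :
        CostructuredArrow.mk (F.map f ≫ φ) ⟶ CostructuredArrow.mk φ))
    have hc {Y : a} {φ : F.obj Y ⟶ X} {e : A} (t : X ⟶ e) :
        ((Functor.LeftExtension.mk (𝟭 A) F.rightUnitor.inv).coconeAt X).ι.app
          (CostructuredArrow.mk φ) ≫ t = φ ≫ t := congrArg (· ≫ t) (Category.id_comp _)
    refine ⟨t, fun φ => (hc t).trans (ht φ.left φ.hom), fun t' h' => ht' t' fun Y φ => ?_⟩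
    exact (hc t').symm.trans (h' (CostructuredArrow.mk φ))

/-! ### The category of bilex presheaves and its generators -/

section BilexCategory

variable {k : Type w} [Field k] {a b : Type w} [SmallCategory a] [SmallCategory b]
  [Preadditive a] [Preadditive b] [Linear k a] [Linear k b]
  {C D : Type (w + 1)} [Category.{w} C] [Category.{w} D] [Preadditive C] [Preadditive D]
  (ι : a ⥤ C) (κ : b ⥤ D)

/-- A natural family of mere functions between bilinear presheaves is automatically linear: `s + s'`
is the restriction along the diagonal `x ⟶ x ⊞ x` of a section built from `s` and `s'`, and scaling
by `r` is restriction along `r • 𝟙`. -/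
lemma IsBilinearPresheaf.exists_natTrans {p q : (a × b)ᵒᵖ ⥤ ModuleCat.{w} k}
    [HasBinaryBiproducts a] (hp : IsBilinearPresheaf p) (hq : IsBilinearPresheaf q)
    (τ : ∀ (x : a) (y : b), p.obj (.op (x, y)) → q.obj (.op (x, y)))
    (hτ : ∀ {x x' : a} {y y' : b} (f : x ⟶ x') (g : y ⟶ y') (s : p.obj (.op (x', y'))),
      τ x y (res p f g s) = res q f g (τ x' y' s)) :
    ∃ t : p ⟶ q, ∀ (x : a) (y : b) (s : p.obj (.op (x, y))),
      (t.app (.op (x, y))).hom s = τ x y s := by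
  have h₁ (x : a) (y : b) (s s' : p.obj (.op (x, y))) :
      τ x y (s + s') = τ x y s + τ x y s' := by
    let v : p.obj (.op (x ⊞ x, y)) := res p biprod.fst (𝟙 y) s + res p biprod.snd (𝟙 y) s'
    have h₁ : res p biprod.inl (𝟙 y) v = s := by
      simp [v, res_res, hp.zero_left]
    have h₂ : res p biprod.inr (𝟙 y) v = s' := by
      simp [v, res_res, hp.zero_left]
    have h₃ : res p (biprod.inl + biprod.inr) (𝟙 y) v = s + s' := by
      rw [hp.add_left, h₁, h₂]
    rw [← h₃, hτ, hq.add_left, ← hτ, ← hτ, h₁, h₂]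
  have h₂ (x : a) (y : b) (r : k) (s : p.obj (.op (x, y))) :
      τ x y (r • s) = r • τ x y s := by
    have h {p : (a × b)ᵒᵖ ⥤ ModuleCat.{w} k} (hp : IsBilinearPresheaf p)
        (s : p.obj (.op (x, y))) : r • s = res p (r • 𝟙 x) (𝟙 y) s := by
      rw [hp.smul_left, res_id]
    rw [h hp, hτ, h hq]
  refine ⟨{ app z := ModuleCat.ofHom
              { toFun := τ z.unop.1 z.unop.2
                map_add' := h₁ _ _
                map_smul' := h₂ _ _ }
            naturality z z' f := ?_ }, fun x y s => rfl⟩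
  ext s
  exact hτ f.unop.1 f.unop.2 s

variable (k) in
/-- The category of bilinear presheaves that are left exact in each variable, as a category of
local objects. -/
abbrev BilexCat : Type (w + 1) := (bilexMorphisms k ι κ).isLocal.FullSubcategory

variable {ι κ}

lemma BilexCat.isBilex [ι.Faithful] [κ.Faithful] [ι.Additive] [κ.Additive] (p : BilexCat k ι κ) :
    IsBilex p.obj ι κ := isLocal_bilexMorphisms_iff.1 p.property

instance : IsLocallyFinitelyPresentable.{w} (BilexCat k ι κ) :=
  isLocallyFinitelyPresentable_isLocal_bilexMorphisms

instance : (bilexMorphisms k ι κ).isLocal.ι.IsRightAdjoint :=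
  isRightAdjoint_ι_isLocal_bilexMorphisms

variable (k ι κ) in
/-- The bilex presheaf generated by a section. -/
noncomputable def bilexFree (z : a × b) : BilexCat k ι κ :=
  (bilexMorphisms k ι κ).isLocal.ι.leftAdjoint.obj (freePresheaf k z)

/-- Sections of bilex presheaves. -/
noncomputable def bilexEquiv {z : a × b} {p : BilexCat k ι κ} :
    (bilexFree k ι κ z ⟶ p) ≃ p.obj.obj (.op z) :=
  ((Adjunction.ofIsRightAdjoint (bilexMorphisms k ι κ).isLocal.ι).homEquiv _ _).trans
    freePresheafEquiv

lemma bilexEquiv_comp {z : a × b} {p q : BilexCat k ι κ} (s : bilexFree k ι κ z ⟶ p) (t : p ⟶ q) :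
    bilexEquiv (s ≫ t) = (t.hom.app (.op z)).hom (bilexEquiv s) := by
  have h := (Adjunction.ofIsRightAdjoint
    (bilexMorphisms k ι κ).isLocal.ι).homEquiv_naturality_right (X := freePresheaf k z) s t
  exact (congrArg (fun f => freePresheafEquiv f) h).trans (freePresheafEquiv_comp _ _)

variable (k ι κ) in
/-- The generating section. -/
noncomputable def bilexGen (z : a × b) : (bilexFree k ι κ z).obj.obj (.op z) :=
  bilexEquiv (𝟙 _)

lemma bilexEquiv_apply {z : a × b} {p : BilexCat k ι κ} (s : bilexFree k ι κ z ⟶ p) :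
    bilexEquiv s = (s.hom.app (.op z)).hom (bilexGen k ι κ z) := by
  rw [bilexGen, ← bilexEquiv_comp, Category.id_comp]

lemma bilexEquiv_add {z : a × b} {p : BilexCat k ι κ} (s s' : bilexFree k ι κ z ⟶ p) :
    bilexEquiv (s + s') = bilexEquiv s + bilexEquiv s' := by
  rw [bilexEquiv_apply, bilexEquiv_apply, bilexEquiv_apply]
  rfl

lemma bilexEquiv_smul {z : a × b} {p : BilexCat k ι κ} (r : k) (s : bilexFree k ι κ z ⟶ p) :
    bilexEquiv (r • s) = r • bilexEquiv s := by
  rw [bilexEquiv_apply, bilexEquiv_apply]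
  rfl

/-- The morphism of free objects induced by `f`. -/
noncomputable def bilexMap {z z' : a × b} (f : z ⟶ z') : bilexFree k ι κ z ⟶ bilexFree k ι κ z' :=
  bilexEquiv.symm (((bilexFree k ι κ z').obj.map f.op).hom (bilexGen k ι κ z'))

lemma bilexEquiv_bilexMap_comp {z z' : a × b} (f : z ⟶ z') {p : BilexCat k ι κ}
    (s : bilexFree k ι κ z' ⟶ p) :
    bilexEquiv (bilexMap f ≫ s) = (p.obj.map f.op).hom (bilexEquiv s) := by
  rw [bilexEquiv_comp, bilexMap, Equiv.apply_symm_apply, bilexEquiv_apply]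
  exact congrArg (fun t => t.hom (bilexGen k ι κ z')) (s.hom.naturality f.op)

variable (k ι κ) in
/-- The functor sending a pair to the bilex presheaf generated by a section. -/
noncomputable def bilexRep : a × b ⥤ BilexCat k ι κ where
  obj z := bilexFree k ι κ z
  map f := bilexMap f
  map_id z := by
    apply bilexEquiv.injective
    rw [← Category.comp_id (bilexMap (𝟙 z)), bilexEquiv_bilexMap_comp, op_id,
      CategoryTheory.Functor.map_id]
    rfl
  map_comp {z z' z''} f g := by
    apply bilexEquiv.injective
    rw [bilexEquiv_bilexMap_comp, ← Category.comp_id (bilexMap g), bilexEquiv_bilexMap_comp,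
      ← Category.comp_id (bilexMap (f ≫ g)), bilexEquiv_bilexMap_comp, op_comp,
      CategoryTheory.Functor.map_comp]
    rfl

lemma bilexEquiv_res {x x' : a} {y y' : b} (f : x ⟶ x') (g : y ⟶ y') {p : BilexCat k ι κ}
    (s : bilexFree k ι κ (x', y') ⟶ p) :
    bilexEquiv ((bilexRep k ι κ).map (Prod.mkHom f g) ≫ s) = res p.obj f g (bilexEquiv s) :=
  bilexEquiv_bilexMap_comp _ _

variable [ι.Faithful] [κ.Faithful] [ι.Additive] [κ.Additive]

/-- A compatible family on morphisms from the generators is, through `bilexEquiv`, a natural family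
of functions on sections, and these are automatically linear. -/
instance [HasBinaryBiproducts a] : (bilexRep k ι κ).IsDense := by
  refine isDense_of_existsUnique _ fun p q θ hθ => ?_
  let σ (z : a × b) (u : p.obj.obj (.op z)) : bilexFree k ι κ z ⟶ q := θ z (bilexEquiv.symm u)
  have hσ {z z' : a × b} (f : z ⟶ z') (u : p.obj.obj (.op z')) :
      σ z ((p.obj.map f.op).hom u) = bilexMap f ≫ σ z' u := by
    refine Eq.trans (congrArg (θ z) ?_) (hθ _ _ f _).symm
    refine bilexEquiv.symm_apply_eq.2 (Eq.trans ?_ (bilexEquiv_bilexMap_comp _ _).symm)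
    rw [Equiv.apply_symm_apply]
  obtain ⟨t, ht⟩ := p.isBilex.toIsBilinearPresheaf.exists_natTrans
    (q := q.obj) q.isBilex.toIsBilinearPresheaf
    (fun x y u => bilexEquiv (σ (x, y) u)) (fun {x x' y y'} f g u => by
      rw [res, hσ, bilexEquiv_bilexMap_comp]
      rfl)
  refine ⟨ObjectProperty.homMk t, fun ⟨x, y⟩ φ => ?_, fun t' ht' => ?_⟩
  · apply bilexEquiv.injective
    refine (bilexEquiv_comp _ _).trans ((ht _ _ _).trans ?_)
    exact congrArg (fun φ => bilexEquiv (θ (x, y) φ)) (bilexEquiv.symm_apply_apply φ)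
  · ext ⟨x, y⟩ u
    refine Eq.trans ?_ (ht x y u).symm
    have h := (bilexEquiv_comp _ _).symm.trans
      (congrArg bilexEquiv (ht' (x, y) (bilexEquiv.symm u)))
    exact (congrArg _ (bilexEquiv.apply_symm_apply u).symm).trans h

end BilexCategory

/-! ### Right exact functors and their cocontinuous extension -/

section RightExact

variable {k : Type w} [Field k] {a : Type w} [SmallCategory a] [Preadditive a] [Linear k a]
  {C E : Type (w + 1)} [Category.{w} C] [Category.{w} E] [Preadditive C] [Preadditive E]
  [Linear k C] [Linear k E]

variable (k) in
/-- Linear functors on compact objects which send cokernels to cokernels. -/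
structure IsRightExactOn (ι : a ⥤ C) (G : a ⥤ E) : Prop where
  additive : G.Additive
  linear : G.Linear k
  existsUnique {x'' x' x : a} (g : x'' ⟶ x') (h : x' ⟶ x) (hgh : IsCokernelSequence ι g h)
    {e : E} (s : G.obj x' ⟶ e) (hs : G.map g ≫ s = 0) : ∃! t, G.map h ≫ t = s

variable {ι : a ⥤ C} {G : a ⥤ E}

/-- Biproducts give upper bounds of two elements; the cokernel of `f - g` coequalizes a parallel
pair, and right exactness extends the element to it. -/
lemma IsRightExactOn.hasFilteredElements (hG : IsRightExactOn k ι G) (hι : IsCompactModel k ι)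
    [HasColimitsOfSize.{w, w} C] (e : E) : HasFilteredElements (G.op ⋙ yoneda.obj e) where
  nonempty := ⟨hι.nonempty.some, ⟨(0 : G.obj hι.nonempty.some ⟶ e)⟩⟩
  pair x x' s s' := by
    have := hι.hasBinaryBiproducts
    have := hG.additive
    refine ⟨x ⊞ x', biprod.inl, biprod.inr,
      (G.map biprod.fst ≫ (s : G.obj x ⟶ e) + G.map biprod.snd ≫ (s' : G.obj x' ⟶ e)), ?_, ?_⟩
    · change G.map biprod.inl ≫ (_ + _) = _
      rw [Preadditive.comp_add, ← G.map_comp_assoc, ← G.map_comp_assoc]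
      simp
    · change G.map biprod.inr ≫ (_ + _) = _
      rw [Preadditive.comp_add, ← G.map_comp_assoc, ← G.map_comp_assoc]
      simp
  parallel x x' f g (s : G.obj x' ⟶ e) (hs : G.map f ≫ s = G.map g ≫ s) := by
    have := hG.additive
    have := hι.faithful
    have := hι.additive
    obtain ⟨z, h, hh⟩ := hι.exists_isCokernelSequence (f - g)
    obtain ⟨t, ht, -⟩ := hG.existsUnique _ _ hh s (by simp [hs])
    refine ⟨z, h, t, ι.map_injective ?_, ht⟩
    have := hh.choose
    simpa [sub_eq_zero] using this

omit [Preadditive C] [Preadditive E] in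
lemma preservesColimits_of_isLeftAdjoint (F : C ⥤ E) [F.IsLeftAdjoint] :
    PreservesColimitsOfSize.{w, w} F :=
  (Adjunction.ofIsLeftAdjoint F).leftAdjoint_preservesColimits

lemma additive_of_preservesColimits (F : C ⥤ E) [PreservesColimitsOfSize.{w, w} F]
    [HasColimitsOfSize.{w, w} C] [HasColimitsOfSize.{w, w} E] : F.Additive := by
  have := HasBinaryBiproducts.of_hasBinaryCoproducts (C := C)
  have : HasZeroObject C := hasZeroObject_of_hasInitial_object
  have : HasZeroObject E := hasZeroObject_of_hasInitial_object
  have := preservesBinaryBiproducts_of_preservesBinaryCoproducts F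
  exact Functor.additive_of_preservesBinaryBiproducts F

/-- A scalar can be moved onto the identity of a dense object, as `r • (φ ≫ f) = (r • 𝟙) ≫ φ ≫ f`.
-/
lemma linear_of_dense {X : Type*} [Category* X] (ι : X ⥤ C) [ι.IsDense] (F : C ⥤ E)
    [∀ c, PreservesColimit (CostructuredArrow.proj ι c ⋙ ι) F]
    (hF : ∀ (r : k) (x : X), F.map (r • 𝟙 (ι.obj x)) = r • 𝟙 _) : F.Linear k where
  map_smul {c c'} f r := by
    refine dense_hom_ext ι F fun x φ => ?_
    rw [← F.map_comp, Linear.comp_smul, Linear.comp_smul, ← F.map_comp]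
    have h : r • φ ≫ f = (r • 𝟙 (ι.obj x)) ≫ φ ≫ f := by simp
    rw [h, F.map_comp, hF, Linear.smul_comp, Category.id_comp]

/-- The left Kan extension of a right exact functor is cocontinuous. -/
theorem IsRightExactOn.kanExtension (hG : IsRightExactOn k ι G) (hι : IsCompactModel k ι)
    [HasColimitsOfSize.{w, w} C] [HasColimitsOfSize.{w, w} E] {F : C ⥤ E} {α : G ⟶ ι ⋙ F}
    (hF : (Functor.LeftExtension.mk F α).IsPointwiseLeftKanExtension) :
    IsCocontinuousLinear k F ∧ IsIso α := by
  have := hι.dense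
  have := hι.full
  have := hι.faithful
  -- The presheaves of morphisms `G x ⟶ e` are represented by objects of `C`, which makes the Kan
  -- extension a left adjoint.
  obtain ⟨h₁, h₂⟩ := pointwise_isLeftAdjoint hF fun e =>
    (hG.hasFilteredElements hι e).exists_iso ι hι.compact
  have := preservesColimits_of_isLeftAdjoint F
  refine ⟨⟨additive_of_preservesColimits F, linear_of_dense ι F fun r x => ?_, inferInstance⟩, h₂⟩
  have := hG.linear
  have := hι.linear
  rw [← cancel_epi (α.app x), ← CategoryTheory.Functor.map_id, ← ι.map_smul]
  refine (α.naturality _).symm.trans ?_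
  rw [G.map_smul, CategoryTheory.Functor.map_id, Linear.smul_comp, Linear.comp_smul,
    Category.id_comp]
  erw [Category.comp_id]

end RightExact

section UniversalFunctor

variable {k : Type w} [Field k] {a b : Type w} [SmallCategory a] [SmallCategory b]
  [Preadditive a] [Preadditive b] [Linear k a] [Linear k b]
  {C D : Type (w + 1)} [Category.{w} C] [Category.{w} D] [Preadditive C] [Preadditive D]
  {ι : a ⥤ C} {κ : b ⥤ D}

section

variable [ι.Faithful] [κ.Faithful] [ι.Additive] [κ.Additive]

omit [ι.Faithful] [κ.Faithful] [ι.Additive] [κ.Additive] in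
lemma bilexEquiv_map {x x' : a} {y y' : b} (f : x ⟶ x') (g : y ⟶ y') :
    bilexEquiv ((bilexRep k ι κ).map (Prod.mkHom f g)) =
      res _ f g (bilexGen k ι κ (x', y')) :=
  bilexEquiv.apply_symm_apply _

omit [ι.Faithful] [κ.Faithful] [ι.Additive] [κ.Additive] in
lemma bilexRep_map_comp_eq_zero_iff {x x' : a} {y y' : b} (f : x ⟶ x') (g : y ⟶ y')
    {p : BilexCat k ι κ} (s : bilexFree k ι κ (x', y') ⟶ p) :
    (bilexRep k ι κ).map (Prod.mkHom f g) ≫ s = 0 ↔ res p.obj f g (bilexEquiv s) = 0 := by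
  have h : bilexEquiv (0 : bilexFree k ι κ (x, y) ⟶ p) = 0 := by
    simpa using bilexEquiv_smul (0 : k) (0 : bilexFree k ι κ (x, y) ⟶ p)
  rw [← bilexEquiv_res, ← h]
  exact (Equiv.apply_eq_iff_eq _).symm

omit [ι.Faithful] [κ.Faithful] [ι.Additive] [κ.Additive] in
lemma existsUnique_bilexRep_map_comp {x x' : a} {y y' : b} (f : x ⟶ x') (g : y ⟶ y')
    {p : BilexCat k ι κ} (s : bilexFree k ι κ (x, y) ⟶ p)
    (hs : ∃! t, res p.obj f g t = bilexEquiv s) :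
    ∃! t, (bilexRep k ι κ).map (Prod.mkHom f g) ≫ t = s := by
  obtain ⟨t, ht, ht'⟩ := hs
  refine ⟨bilexEquiv.symm t, bilexEquiv.injective ?_, fun t' h => ?_⟩
  · exact (bilexEquiv_res _ _ _).trans (by rw [Equiv.apply_symm_apply, ht])
  · refine (Equiv.eq_symm_apply _).2 (ht' _ ?_)
    exact (bilexEquiv_res _ _ _).symm.trans (congrArg _ h)

/-- Morphisms out of a generator are sections, so the cokernel property is the left exactness of the
target, and linearity is the bilinearity of the generators. -/
lemma isRightExactOn_bilexRep_right (x : a) :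
    IsRightExactOn k κ ((Functor.curry.obj (bilexRep k ι κ)).obj x) where
  additive := ⟨fun {y y' f g} => bilexEquiv.injective (by
    refine Eq.trans ?_ (bilexEquiv_add _ _).symm
    refine (bilexEquiv_map _ _).trans (Eq.trans ?_
      (congrArg₂ _ (bilexEquiv_map _ _) (bilexEquiv_map _ _)).symm)
    exact (BilexCat.isBilex _).add_right _ _ _ _)⟩
  linear := ⟨fun {y y'} f r => bilexEquiv.injective (by
    refine Eq.trans ?_ (bilexEquiv_smul _ _).symm
    refine (bilexEquiv_map _ _).trans (Eq.trans ?_ (congrArg _ (bilexEquiv_map _ _)).symm)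
    exact (BilexCat.isBilex _).smul_right _ _ _ _)⟩
  existsUnique g h hgh e s hs := existsUnique_bilexRep_map_comp _ _ _
    (e.isBilex.lex_right _ _ _ hgh _ ((bilexRep_map_comp_eq_zero_iff _ _ _).1 hs))

lemma isRightExactOn_bilexRep_left (y : b) :
    IsRightExactOn k ι ((Functor.curry.obj (bilexRep k ι κ)).flip.obj y) where
  additive := ⟨fun {x x' f g} => bilexEquiv.injective (by
    refine Eq.trans ?_ (bilexEquiv_add _ _).symm
    refine (bilexEquiv_map _ _).trans (Eq.trans ?_
      (congrArg₂ _ (bilexEquiv_map _ _) (bilexEquiv_map _ _)).symm)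
    exact (BilexCat.isBilex _).add_left _ _ _ _)⟩
  linear := ⟨fun {x x'} f r => bilexEquiv.injective (by
    refine Eq.trans ?_ (bilexEquiv_smul _ _).symm
    refine (bilexEquiv_map _ _).trans (Eq.trans ?_ (congrArg _ (bilexEquiv_map _ _)).symm)
    exact (BilexCat.isBilex _).smul_left _ _ _ _)⟩
  existsUnique g h hgh e s hs := existsUnique_bilexRep_map_comp _ _ _
    (e.isBilex.lex_left _ _ hgh _ _ ((bilexRep_map_comp_eq_zero_iff _ _ _).1 hs))

end

end UniversalFunctor

/-! ### Extension in two variables -/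

section TwoVariables

variable {k : Type w} [Field k] {a b : Type w} [SmallCategory a] [SmallCategory b]
  {C D E : Type (w + 1)} [Category.{w} C] [Category.{w} D] [Category.{w} E]
  [HasColimitsOfSize.{w, w} E] {ι : a ⥤ C} (κ : b ⥤ D) (G : a ⥤ b ⥤ E)

/-- Extension in the second variable. -/
noncomputable def extendRight : a ⥤ D ⥤ E := G ⋙ κ.lan

/-- Extension in the second variable is pointwise. -/
noncomputable def extendRightIsPointwise (x : a) :
    (Functor.LeftExtension.mk ((extendRight κ G).obj x)
      (κ.lanUnit.app (G.obj x))).IsPointwiseLeftKanExtension :=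
  Functor.isPointwiseLeftKanExtensionLeftKanExtensionUnit κ (G.obj x)

variable {κ}

/-- The unit of the extension in the second variable. -/
noncomputable def extendUnit (x : a) (y : b) :
    (G.obj x).obj y ⟶ ((extendRight κ G).obj x).obj (κ.obj y) :=
  (κ.lanUnit.app (G.obj x)).app y

lemma extendUnit_app {x x' : a} (f : x ⟶ x') (y : b) :
    extendUnit (κ := κ) G x y ≫ ((extendRight κ G).map f).app (κ.obj y) =
      (G.map f).app y ≫ extendUnit G x' y :=
  (congrArg (fun t => t.app y) (κ.lanUnit.naturality (G.map f))).symm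

lemma map_extendUnit (x : a) {y y' : b} (g : y ⟶ y') :
    (G.obj x).map g ≫ extendUnit G x y' =
      extendUnit G x y ≫ ((extendRight κ G).obj x).map (κ.map g) :=
  (κ.lanUnit.app (G.obj x)).naturality g

/-- The inclusion in the colimit that computes the extension. -/
noncomputable def extendι (x : a) {y : b} {d : D} (φ : κ.obj y ⟶ d) :
    (G.obj x).obj y ⟶ ((extendRight κ G).obj x).obj d :=
  extendUnit G x y ≫ ((extendRight κ G).obj x).map φ

lemma extendι_app {x x' : a} (f : x ⟶ x') {y : b} {d : D} (φ : κ.obj y ⟶ d) :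
    extendι G x φ ≫ ((extendRight κ G).map f).app d = (G.map f).app y ≫ extendι G x' φ := by
  rw [extendι, extendι, Category.assoc, NatTrans.naturality, reassoc_of% extendUnit_app]

lemma map_extendι (x : a) {y y' : b} (g : y ⟶ y') {d : D} (φ : κ.obj y' ⟶ d) :
    (G.obj x).map g ≫ extendι G x φ = extendι G x (κ.map g ≫ φ) := by
  rw [extendι, extendι, reassoc_of% map_extendUnit, CategoryTheory.Functor.map_comp]

variable {G} in
lemma extendι_hom_ext {x : a} {d : D} {e : E} {f g : ((extendRight κ G).obj x).obj d ⟶ e}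
    (h : ∀ (y : b) (φ : κ.obj y ⟶ d), extendι G x φ ≫ f = extendι G x φ ≫ g) : f = g :=
  pointwise_hom_ext (extendRightIsPointwise κ G x) fun y φ =>
    (Category.assoc _ _ _).symm.trans ((h y φ).trans (Category.assoc _ _ _))

variable {G} in
lemma extendι_exists_desc {x : a} {d : D} {e : E}
    (θ : ∀ (y : b) (_ : κ.obj y ⟶ d), (G.obj x).obj y ⟶ e)
    (hθ : ∀ (y y' : b) (f : y ⟶ y') (φ : κ.obj y' ⟶ d),
      (G.obj x).map f ≫ θ y' φ = θ y (κ.map f ≫ φ)) :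
    ∃ f : ((extendRight κ G).obj x).obj d ⟶ e, ∀ (y : b) (φ : κ.obj y ⟶ d),
      extendι G x φ ≫ f = θ y φ := by
  obtain ⟨f, hf⟩ := pointwise_exists_desc (extendRightIsPointwise κ G x) θ hθ
  exact ⟨f, fun y φ => (Category.assoc _ _ _).trans (hf y φ)⟩

variable {G}
variable [Preadditive a] [Preadditive b] [Linear k a] [Linear k b]
  [Preadditive C] [Preadditive D] [Preadditive E] [Linear k C] [Linear k D] [Linear k E]

-- The value at `d` is a colimit of the right exact functors `G (-, y)` over `κ y ⟶ d`; the
-- factorizations exist uniquely on each component and glue by uniqueness.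
omit [Linear k C] [Preadditive b] [Linear k b] [Preadditive D] [Linear k D] in
lemma isRightExactOn_extendRight (hG : ∀ y, IsRightExactOn k ι (G.flip.obj y)) (d : D) :
    IsRightExactOn k ι ((extendRight κ G).flip.obj d) where
  additive := ⟨fun {x x' f g} => extendι_hom_ext fun y φ => by
    have h := (hG y).additive.map_add (f := f) (g := g)
    dsimp at h
    rw [Preadditive.comp_add, Functor.flip_obj_map, Functor.flip_obj_map, Functor.flip_obj_map,
      extendι_app, extendι_app, extendι_app, h, Preadditive.add_comp]⟩
  linear := ⟨fun {x x'} f r => extendι_hom_ext fun y φ => by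
    have h := (hG y).linear.map_smul f r
    dsimp at h
    rw [Linear.comp_smul, Functor.flip_obj_map, Functor.flip_obj_map,
      extendι_app, extendι_app, h, Linear.smul_comp]⟩
  existsUnique {x'' x' x} g h hgh e (s : ((extendRight κ G).obj x').obj d ⟶ e)
      (hs : ((extendRight κ G).map g).app d ≫ s = 0) := by
    have H (y : b) (φ : κ.obj y ⟶ d) :
        ∃! t : (G.obj x).obj y ⟶ e, (G.map h).app y ≫ t = extendι G x' φ ≫ s :=
      (hG y).existsUnique g h hgh (extendι G x' φ ≫ s) (by
        change (G.map g).app y ≫ _ = _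
        rw [← reassoc_of% extendι_app, hs, comp_zero])
    choose t ht ht' using H
    have hu (y y' : b) (f : y ⟶ y') (φ : κ.obj y' ⟶ d) :
        (G.obj x).map f ≫ t y' φ = t y (κ.map f ≫ φ) := by
      refine ht' _ _ _ ?_
      dsimp only
      rw [← NatTrans.naturality_assoc, ht, reassoc_of% map_extendι]
    obtain ⟨u, hu⟩ := extendι_exists_desc t hu
    refine ⟨u, extendι_hom_ext fun y φ => ?_, fun u' hu' => extendι_hom_ext fun y φ => ?_⟩
    · change extendι G x' φ ≫ ((extendRight κ G).map h).app d ≫ u = _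
      rw [reassoc_of% extendι_app, hu, ht]
    · rw [hu]
      refine ht' _ _ _ ?_
      dsimp only
      rw [← reassoc_of% extendι_app]
      exact congrArg _ hu'

variable [HasColimitsOfSize.{w, w} C] [HasColimitsOfSize.{w, w} D]

/-- A functor of two variables on compact objects which is right exact in each variable extends
to a bicocontinuous functor. -/
theorem exists_isBicocontinuousBilinear (hι : IsCompactModel k ι) (hκ : IsCompactModel k κ)
    (hG : ∀ x, IsRightExactOn k κ (G.obj x)) (hG' : ∀ y, IsRightExactOn k ι (G.flip.obj y)) :
    ∃ T : C ⥤ D ⥤ E, IsBicocontinuousBilinear k T ∧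
      Nonempty (G ≅ ι ⋙ T ⋙ (Functor.whiskeringLeft _ _ _).obj κ) := by
  -- The second variable is extended first, then the first one; pointwise Kan extensions are
  -- preserved by evaluation at `d`.
  have h₁ (x : a) := (hG x).kanExtension hκ (extendRightIsPointwise κ G x)
  have hp := Functor.isPointwiseLeftKanExtensionLeftKanExtensionUnit ι (extendRight κ G)
  have h₂ (d : D) := (isRightExactOn_extendRight hG' d).kanExtension hι
    (F := (ι.leftKanExtension (extendRight κ G)).flip.obj d)
    (α := Functor.whiskerRight (ι.leftKanExtensionUnit (extendRight κ G))
      ((evaluation D E).obj d)) (fun c =>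
        (isColimitOfPreserves ((evaluation D E).obj d) (hp c)).ofIsoColimit
          (Cocone.ext (Iso.refl _) fun _ => Category.comp_id _))
  refine ⟨ι.leftKanExtension (extendRight κ G), ⟨fun c => ?_, fun d => (h₂ d).1⟩, ⟨?_⟩⟩
  -- For fixed `c` the extension is a colimit of the functors of `h₁`, each cocontinuous on `D`.
  · let K := CostructuredArrow.proj ι c ⋙ extendRight κ G
    exact (IsCocontinuousLinear.comp_colim K.flip fun j => (h₁ j.left).1).of_iso
      ((colimitIsoFlipCompColim K).symm ≪≫
        (ι.leftKanExtensionObjIsoColimit (extendRight κ G) c).symm)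
  · let t : G ⟶ ι ⋙ ι.leftKanExtension (extendRight κ G) ⋙
        (Functor.whiskeringLeft _ _ _).obj κ :=
      Functor.whiskerLeft G κ.lanUnit ≫ Functor.whiskerRight
        (ι.leftKanExtensionUnit (extendRight κ G)) ((Functor.whiskeringLeft _ _ _).obj κ)
    have ht (x : a) (y : b) : IsIso ((t.app x).app y) := by
      let α : G.obj x ⟶ κ ⋙ (extendRight κ G).obj x := κ.lanUnit.app (G.obj x)
      have : IsIso α := (h₁ x).2
      have := (h₂ (κ.obj y)).2
      have h₃ : IsIso ((κ.lanUnit.app (G.obj x)).app y) :=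
        inferInstanceAs (IsIso (α.app y))
      have h₄ : IsIso (((ι.leftKanExtensionUnit (extendRight κ G)).app x).app (κ.obj y)) :=
        inferInstanceAs (IsIso ((Functor.whiskerRight (ι.leftKanExtensionUnit (extendRight κ G))
          ((evaluation D E).obj (κ.obj y))).app x))
      exact IsIso.comp_isIso' h₃ h₄
    have (x : a) : IsIso (t.app x) := NatIso.isIso_of_isIso_app _
    have := NatIso.isIso_of_isIso_app t
    exact asIso t

end TwoVariables

section TwoVariableExtension

variable {k : Type w} [Field k] {a b : Type w} [SmallCategory a] [SmallCategory b]
  {C D E : Type (w + 1)} [Category.{w} C] [Category.{w} D] [Category.{w} E]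
  [Preadditive C] [Preadditive D] [Preadditive E] [Linear k C] [Linear k D] [Linear k E]
  (ι : a ⥤ C) (κ : b ⥤ D) [ι.IsDense] [κ.IsDense]

lemma IsBicocontinuousBilinear.preservesColimits {F : C ⥤ D ⥤ E}
    (hF : IsBicocontinuousBilinear k F) : PreservesColimitsOfSize.{w, w} F :=
  ⟨fun {K} _ => preservesColimitsOfShape_of_evaluation F K
    fun d => (hF.left d).preservesColimits.preservesColimitsOfShape⟩

lemma IsBicocontinuousBilinear.hom_ext {F G : C ⥤ D ⥤ E} (hF : IsBicocontinuousBilinear k F)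
    {s t : F ⟶ G} (h : ∀ x y, (s.app (ι.obj x)).app (κ.obj y) = (t.app (ι.obj x)).app (κ.obj y)) :
    s = t := by
  ext c d
  have := (hF.left d).preservesColimits
  refine dense_hom_ext ι (F.flip.obj d) fun x φ => ?_
  have h₁ : (s.app (ι.obj x)).app d = (t.app (ι.obj x)).app d := by
    have := (hF.right (ι.obj x)).preservesColimits
    refine dense_hom_ext κ (F.obj (ι.obj x)) fun y ψ => ?_
    rw [NatTrans.naturality, NatTrans.naturality, h]
  have h₂ (u : F ⟶ G) : (F.map φ).app d ≫ (u.app c).app d =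
      (u.app (ι.obj x)).app d ≫ (G.map φ).app d := congrArg (fun v => v.app d) (u.naturality φ)
  exact (h₂ s).trans ((congrArg (· ≫ _) h₁).trans (h₂ t).symm)

lemma IsBicocontinuousBilinear.exists_natTrans {F G : C ⥤ D ⥤ E}
    (hF : IsBicocontinuousBilinear k F)
    (t : ι ⋙ F ⋙ (Functor.whiskeringLeft _ _ _).obj κ ⟶
      ι ⋙ G ⋙ (Functor.whiskeringLeft _ _ _).obj κ) :
    ∃ s : F ⟶ G, ∀ x y, (s.app (ι.obj x)).app (κ.obj y) = (t.app x).app y := by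
  have h (x : a) : ∃ u : F.obj (ι.obj x) ⟶ G.obj (ι.obj x),
      ∀ y, u.app (κ.obj y) = (t.app x).app y := by
    have := (hF.right (ι.obj x)).preservesColimits
    exact dense_exists_natTrans κ (F := F.obj (ι.obj x)) (G := G.obj (ι.obj x)) (t.app x)
  choose u hu using h
  have := hF.preservesColimits
  obtain ⟨s, hs⟩ := dense_exists_natTrans ι (F := F) (G := G)
    { app x := u x
      naturality x x' f := by
        ext d
        have := (hF.right (ι.obj x)).preservesColimits
        refine dense_hom_ext κ (F.obj (ι.obj x)) fun y ψ => ?_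
        have := congrArg (fun v => v.app y) (t.naturality f)
        dsimp at this ⊢
        rw [NatTrans.naturality_assoc, NatTrans.naturality, hu, reassoc_of% this,
          NatTrans.naturality_assoc, hu, NatTrans.naturality] }
  refine ⟨s, fun x y => ?_⟩
  rw [hs, hu]

lemma IsBicocontinuousBilinear.isIso {F G : C ⥤ D ⥤ E}
    (hF : IsBicocontinuousBilinear k F) (hG : IsBicocontinuousBilinear k G) (s : F ⟶ G)
    (hs : ∀ x y, IsIso ((s.app (ι.obj x)).app (κ.obj y))) : IsIso s := by
  have := hF.preservesColimits
  have := hG.preservesColimits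
  refine dense_isIso ι s fun x => ?_
  have := (hF.right (ι.obj x)).preservesColimits
  have := (hG.right (ι.obj x)).preservesColimits
  exact dense_isIso κ _ (hs x)

end TwoVariableExtension

/-! ### The bilex model is a Deligne-Kelly tensor product -/

section Universality

variable {k : Type w} [Field k] {a b : Type w} [SmallCategory a] [SmallCategory b]
  [Preadditive a] [Preadditive b] [Linear k a] [Linear k b]
  {C D : Type (w + 1)} [Category.{w} C] [Category.{w} D]
  [Preadditive C] [Preadditive D] [Linear k C] [Linear k D]
  [HasColimitsOfSize.{w, w} C]
  {ι : a ⥤ C} {κ : b ⥤ D} (hι : IsCompactModel k ι) (hκ : IsCompactModel k κ)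
  (T : BilinearFunctor k C D (BilexCat k ι κ))
  (e : Functor.curry.obj (bilexRep k ι κ) ≅ ι ⋙ T.obj ⋙ (Functor.whiskeringLeft _ _ _).obj κ)
  {E : Type (w + 1)} [Category.{w} E] [Preadditive E] [Linear k E]

/-- The components of `e`. -/
noncomputable def repIso (x : a) (y : b) :
    (bilexRep k ι κ).obj (x, y) ≅ (T.obj.obj (ι.obj x)).obj (κ.obj y) :=
  (e.app x).app y

omit [HasColimitsOfSize.{w, w} C] in
lemma repIso_naturality {x x' : a} {y y' : b} (f : x ⟶ x') (g : y ⟶ y') :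
    (bilexRep k ι κ).map (Prod.mkHom f g) ≫ (repIso T e x' y').hom =
      (repIso T e x y).hom ≫ (T.obj.map (ι.map f)).app (κ.obj y) ≫
        (T.obj.obj (ι.obj x')).map (κ.map g) := by
  have h₁ : (bilexRep k ι κ).map (Prod.mkHom f (𝟙 y)) ≫ (repIso T e x' y).hom =
      (repIso T e x y).hom ≫ (T.obj.map (ι.map f)).app (κ.obj y) :=
    congrArg (fun t => t.app y) (e.hom.naturality f)
  have h₂ : (bilexRep k ι κ).map (Prod.mkHom (𝟙 x') g) ≫ (repIso T e x' y').hom =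
      (repIso T e x' y).hom ≫ (T.obj.obj (ι.obj x')).map (κ.map g) :=
    (e.hom.app x').naturality g
  have h₃ : Prod.mkHom f g = Prod.mkHom f (𝟙 y) ≫ Prod.mkHom (𝟙 x') g := by simp
  rw [h₃, CategoryTheory.Functor.map_comp, Category.assoc, h₂, reassoc_of% h₁]

include hι hκ in
lemma isDense_bilexRep : (bilexRep k ι κ).IsDense := by
  have := hι.faithful
  have := hκ.faithful
  have := hι.additive
  have := hκ.additive
  have := hι.hasBinaryBiproducts
  infer_instance

include hι hκ e in
lemma restrictBilinear_faithful : (restrictBilinear T E).Faithful where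
  map_injective {G H s t} h := by
    have := isDense_bilexRep hι hκ
    have := G.property.preservesColimits
    have h' (x y) : s.hom.app ((T.obj.obj (ι.obj x)).obj (κ.obj y)) =
        t.hom.app ((T.obj.obj (ι.obj x)).obj (κ.obj y)) :=
      congrArg (fun u => (u.hom.app (ι.obj x)).app (κ.obj y)) h
    have h'' (x y) : s.hom.app ((bilexRep k ι κ).obj (x, y)) =
        t.hom.app ((bilexRep k ι κ).obj (x, y)) := by
      rw [← cancel_mono (H.obj.map (repIso T e x y).hom), ← NatTrans.naturality,
        ← NatTrans.naturality, h']
    ext p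
    refine dense_hom_ext (bilexRep k ι κ) G.obj fun ⟨x, y⟩ φ => ?_
    rw [NatTrans.naturality, NatTrans.naturality, h'']

-- The components on compact objects are transported to the generators `bilexRep (x, y)` and
-- extended by density; the result restricts to `t` because bicocontinuous functors are determined
-- on compact objects.
include hι hκ e in
lemma restrictBilinear_full : (restrictBilinear T E).Full where
  map_surjective {G H} t := by
    have := isDense_bilexRep hι hκ
    have := G.property.preservesColimits
    have := hι.dense
    have := hκ.dense
    let t' : (Functor.postcompose₂.obj G.obj).obj T.obj ⟶
        (Functor.postcompose₂.obj H.obj).obj T.obj := t.hom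
    let τ (z : a × b) : G.obj.obj ((bilexRep k ι κ).obj z) ⟶ H.obj.obj ((bilexRep k ι κ).obj z) :=
      G.obj.map (repIso T e z.1 z.2).hom ≫ (t'.app (ι.obj z.1)).app (κ.obj z.2) ≫
        H.obj.map (repIso T e z.1 z.2).inv
    have hτ {z z' : a × b} (f : z ⟶ z') : G.obj.map ((bilexRep k ι κ).map f) ≫ τ z' =
        τ z ≫ H.obj.map ((bilexRep k ι κ).map f) := by
      obtain ⟨x, y⟩ := z
      obtain ⟨x', y'⟩ := z'
      obtain ⟨f, g⟩ := f
      have h₁ : G.obj.map ((T.obj.map (ι.map f)).app (κ.obj y)) ≫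
          (t'.app (ι.obj x')).app (κ.obj y) = (t'.app (ι.obj x)).app (κ.obj y) ≫
            H.obj.map ((T.obj.map (ι.map f)).app (κ.obj y)) :=
        congrArg (fun u => u.app (κ.obj y)) (t'.naturality (ι.map f))
      have h₂ : G.obj.map ((T.obj.obj (ι.obj x')).map (κ.map g)) ≫
          (t'.app (ι.obj x')).app (κ.obj y') = (t'.app (ι.obj x')).app (κ.obj y) ≫
            H.obj.map ((T.obj.obj (ι.obj x')).map (κ.map g)) :=
        (t'.app (ι.obj x')).naturality (κ.map g)
      have h := repIso_naturality T e f g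
      have h' : (repIso T e x y).inv ≫ (bilexRep k ι κ).map (Prod.mkHom f g) =
          ((T.obj.map (ι.map f)).app (κ.obj y) ≫ (T.obj.obj (ι.obj x')).map (κ.map g)) ≫
            (repIso T e x' y').inv := by
        rw [Iso.inv_comp_eq, ← Category.assoc, Iso.eq_comp_inv, h]
      dsimp only [τ]
      rw [← G.obj.map_comp_assoc]
      refine (congrArg (fun u => G.obj.map u ≫ _) h).trans ?_
      rw [Category.assoc, Category.assoc, ← H.obj.map_comp]
      refine Eq.trans ?_ (congrArg (fun u => _ ≫ _ ≫ H.obj.map u) h').symm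
      simp only [CategoryTheory.Functor.map_comp, Category.assoc]
      rw [reassoc_of% h₂, reassoc_of% h₁]
    obtain ⟨s, hs⟩ := dense_exists_natTrans (bilexRep k ι κ) (F := G.obj) (G := H.obj)
      { app := τ
        naturality _ _ f := hτ f }
    refine ⟨ObjectProperty.homMk s, ?_⟩
    apply ObjectProperty.hom_ext
    refine IsBicocontinuousBilinear.hom_ext ι κ (T.property.comp G.property) fun x y => ?_
    change s.app _ = (t'.app _).app _
    rw [← cancel_epi (G.obj.map (repIso T e x y).hom), s.naturality]
    refine (congrArg (· ≫ _) (hs (x, y))).trans ?_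
    simp [τ, ← H.obj.map_comp]

omit [Preadditive a] [Linear k a] [HasColimitsOfSize.{w, w} C] in
lemma IsCokernelSequence.existsUnique {x'' x' x : a} {g : x'' ⟶ x'} {h : x' ⟶ x}
    (hgh : IsCokernelSequence ι g h) {F : C ⥤ E} (hF : IsCocontinuousLinear k F) {e : E}
    (s : F.obj (ι.obj x') ⟶ e) (hs : F.map (ι.map g) ≫ s = 0) :
    ∃! t, F.map (ι.map h) ≫ t = s := by
  obtain ⟨w, ⟨hc⟩⟩ := hgh
  have := hF.additive
  have := hF.preservesColimits
  have hc' := CokernelCofork.mapIsColimit _ hc F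
  refine ⟨hc'.desc (CokernelCofork.ofπ s hs), hc'.fac _ .one, fun t ht => ?_⟩
  refine Cofork.IsColimit.hom_ext hc' (ht.trans (hc'.fac (CokernelCofork.ofπ s hs) .one).symm)

section EssSurj

variable (ι κ) in
/-- The restriction of a functor of two variables to compact objects. -/
abbrev restrictCompacts (F : C ⥤ D ⥤ E) : a × b ⥤ E :=
  Functor.uncurry.obj (ι ⋙ F ⋙ (Functor.whiskeringLeft _ _ _).obj κ)

variable (k) in
/-- The presheaf of morphisms from values of `F` to `e`. -/
abbrev homPresheaf (H : a × b ⥤ E) (e : E) : (a × b)ᵒᵖ ⥤ ModuleCat.{w} k :=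
  H.op ⋙ (linearYoneda k E).obj e

omit [Preadditive a] [Preadditive b] [Linear k a] [Linear k b] in
lemma res_homPresheaf (H : a × b ⥤ E) (e : E) {x x' : a} {y y' : b} (f : x ⟶ x') (g : y ⟶ y')
    (s : H.obj (x', y') ⟶ e) :
    res (homPresheaf k H e) f g s = H.map (Prod.mkHom f g) ≫ s := rfl

-- `F` preserves cokernel sequences in each variable, and morphisms into `e` turn cokernels into
-- kernels.
omit [HasColimitsOfSize.{w, w} C] in
include hι hκ in
lemma isBilex_homPresheaf {F : C ⥤ D ⥤ E} (hF : IsBicocontinuousBilinear k F) (e : E) :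
    IsBilex (homPresheaf k (restrictCompacts ι κ F) e) ι κ := by
  have := hι.additive
  have := hι.linear
  have := hκ.additive
  have := hκ.linear
  have hl {x x' : a} (f : x ⟶ x') (y : b) (s : (F.obj (ι.obj x')).obj (κ.obj y) ⟶ e) :
      res (homPresheaf k (restrictCompacts ι κ F) e) f (𝟙 y) s =
        (F.flip.obj (κ.obj y)).map (ι.map f) ≫ s := by
    rw [res_homPresheaf]
    simp
    rfl
  have hr (x : a) {y y' : b} (g : y ⟶ y') (s : (F.obj (ι.obj x)).obj (κ.obj y') ⟶ e) :
      res (homPresheaf k (restrictCompacts ι κ F) e) (𝟙 x) g s =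
        (F.obj (ι.obj x)).map (κ.map g) ≫ s := by
    rw [res_homPresheaf]
    simp
    rfl
  refine ⟨⟨fun f f' y s => ?_, fun r f y s => ?_, fun x _ _ g g' s => ?_, fun x _ _ r g s => ?_⟩,
    fun g h hgh y s hs => ?_, fun x _ _ _ g h hgh s hs => ?_⟩
  · have := (hF.left (κ.obj y)).additive
    refine (hl _ _ _).trans (Eq.trans ?_ (congrArg₂ (· + ·) (hl f y s) (hl f' y s)).symm)
    rw [ι.map_add, CategoryTheory.Functor.map_add]
    exact Preadditive.add_comp ..
  · have := (hF.left (κ.obj y)).linear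
    refine (hl _ _ _).trans (Eq.trans ?_ (congrArg (r • ·) (hl f y s)).symm)
    rw [ι.map_smul, CategoryTheory.Functor.map_smul]
    exact Linear.smul_comp ..
  · have := (hF.right (ι.obj x)).additive
    refine (hr _ _ _).trans (Eq.trans ?_ (congrArg₂ (· + ·) (hr x g s) (hr x g' s)).symm)
    rw [κ.map_add, CategoryTheory.Functor.map_add]
    exact Preadditive.add_comp ..
  · have := (hF.right (ι.obj x)).linear
    refine (hr _ _ _).trans (Eq.trans ?_ (congrArg (r • ·) (hr x g s)).symm)
    rw [κ.map_smul, CategoryTheory.Functor.map_smul]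
    exact Linear.smul_comp ..
  · obtain ⟨t, ht, ht'⟩ := hgh.existsUnique (hF.left (κ.obj y)) s ((hl _ _ _).symm.trans hs)
    exact ⟨t, (hl _ _ _).trans ht, fun t' h => ht' t' ((hl _ _ _).symm.trans h)⟩
  · obtain ⟨t, ht, ht'⟩ := hgh.existsUnique (hF.right (ι.obj x)) s ((hr _ _ _).symm.trans hs)
    exact ⟨t, (hr _ _ _).trans ht, fun t' h => ht' t' ((hr _ _ _).symm.trans h)⟩

variable [HasColimitsOfSize.{w, w} E]

-- By `bilexEquiv`, the bilex presheaf of morphisms to `e` represents them along `bilexRep`; so the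
-- criterion for Kan extensions to be left adjoints applies to `bilexRep`.
include hι hκ in
lemma exists_kanExtension {F : C ⥤ D ⥤ E} (hF : IsBicocontinuousBilinear k F) :
    ∃ M : BilexCat k ι κ ⥤ E, IsCocontinuousLinear k M ∧
      Nonempty (restrictCompacts ι κ F ≅ bilexRep k ι κ ⋙ M) := by
  have := isDense_bilexRep hι hκ
  have := hι.faithful
  have := hκ.faithful
  have := hι.additive
  have := hκ.additive
  have := hι.linear
  let H := restrictCompacts ι κ F
  have hp := Functor.isPointwiseLeftKanExtensionLeftKanExtensionUnit (bilexRep k ι κ) H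
  obtain ⟨h₁, h₂⟩ := pointwise_isLeftAdjoint hp fun e => by
    let Z : BilexCat k ι κ :=
      ⟨homPresheaf k H e, isLocal_bilexMorphisms_iff.2 (isBilex_homPresheaf hι hκ hF e)⟩
    let σ (z : a × b) : (H.obj z ⟶ e) ≃ ((bilexRep k ι κ).obj z ⟶ Z) :=
      (bilexEquiv (z := z) (p := Z)).symm
    have hσ {z z' : a × b} (f : z ⟶ z') (s : H.obj z' ⟶ e) :
        σ z (H.map f ≫ s) = (bilexRep k ι κ).map f ≫ σ z' s := by
      refine bilexEquiv.symm_apply_eq.2 (Eq.trans ?_ (bilexEquiv_bilexMap_comp _ _).symm)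
      exact (congrArg (fun u => (Z.obj.map f.op).hom u)
        (bilexEquiv.apply_symm_apply (s : Z.obj.obj (.op z')))).symm
    refine ⟨Z, ⟨NatIso.ofComponents (fun z => (σ z.unop).toIso) fun {z z'} f => ?_⟩⟩
    ext s
    exact hσ f.unop s
  have := preservesColimits_of_isLeftAdjoint ((bilexRep k ι κ).leftKanExtension H)
  refine ⟨(bilexRep k ι κ).leftKanExtension H, ⟨additive_of_preservesColimits _,
    linear_of_dense (bilexRep k ι κ) _ fun r z => ?_, inferInstance⟩,
    ⟨asIso ((bilexRep k ι κ).leftKanExtensionUnit H)⟩⟩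
  obtain ⟨x, y⟩ := z
  -- Scalars on a generator come from scalars on `x`, which `H` respects; this is the input of
  -- `linear_of_dense`.
  have h (r : k) : r • 𝟙 ((bilexRep k ι κ).obj (x, y)) =
      (bilexRep k ι κ).map (Prod.mkHom (r • 𝟙 x) (𝟙 y)) := by
    have := (isRightExactOn_bilexRep_left (k := k) (ι := ι) (κ := κ) y).linear.map_smul (𝟙 x) r
    refine Eq.trans ?_ this.symm
    rw [CategoryTheory.Functor.map_id]
    rfl
  have h' : H.map (Prod.mkHom (r • 𝟙 x) (𝟙 y)) = r • 𝟙 _ := by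
    have := (hF.left (κ.obj y)).linear.map_smul (𝟙 (ι.obj x)) r
    dsimp at this
    simp [H, this]
  rw [h, ← cancel_epi (((bilexRep k ι κ).leftKanExtensionUnit H).app (x, y))]
  refine (((bilexRep k ι κ).leftKanExtensionUnit H).naturality
    (Prod.mkHom (r • 𝟙 x) (𝟙 y))).symm.trans ?_
  rw [h', Linear.smul_comp, Linear.comp_smul, Category.id_comp]
  erw [Category.comp_id]

-- The functors `M ∘ T` and `F` agree on compact objects and are both bicocontinuous, hence agree.
include hι hκ e in
lemma restrictBilinear_essSurj : (restrictBilinear T E).EssSurj where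
  mem_essImage F := by
    have := hι.dense
    have := hκ.dense
    obtain ⟨M, hM, ⟨i⟩⟩ := exists_kanExtension hι hκ F.property
    let t : ι ⋙ ((Functor.postcompose₂.obj M).obj T.obj) ⋙ (Functor.whiskeringLeft _ _ _).obj κ ≅
        ι ⋙ F.obj ⋙ (Functor.whiskeringLeft _ _ _).obj κ :=
      Functor.isoWhiskerRight e.symm ((Functor.whiskeringRight _ _ _).obj M) ≪≫
        Functor.curry.mapIso i.symm ≪≫ Functor.currying.unitIso.symm.app _
    obtain ⟨s, hs⟩ := (T.property.comp hM).exists_natTrans ι κ t.hom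
    have := IsBicocontinuousBilinear.isIso ι κ (T.property.comp hM) F.property s
      (fun x y => by rw [hs]; infer_instance)
    exact ⟨⟨M, hM⟩, ⟨ObjectProperty.isoMk _ (@asIso _ _ _ _ s this)⟩⟩

end EssSurj

end Universality

/-- The category of bilex presheaves is a Deligne-Kelly tensor product. -/
theorem exists_isDeligneKellyTensor {k : Type w} [Field k] {a b : Type w} [SmallCategory a]
    [SmallCategory b] [Preadditive a] [Preadditive b] [Linear k a] [Linear k b]
    {C D : Type (w + 1)} [Category.{w} C] [Category.{w} D]
    [Preadditive C] [Preadditive D] [Linear k C] [Linear k D]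
    [HasColimitsOfSize.{w, w} C] [HasColimitsOfSize.{w, w} D]
    {ι : a ⥤ C} {κ : b ⥤ D} (hι : IsCompactModel k ι) (hκ : IsCompactModel k κ) :
    ∃ T : BilinearFunctor k C D (BilexCat k ι κ), IsDeligneKellyTensor T := by
  have := hι.faithful
  have := hκ.faithful
  have := hι.additive
  have := hκ.additive
  obtain ⟨T, hT, ⟨e⟩⟩ := exists_isBicocontinuousBilinear hι hκ
    (isRightExactOn_bilexRep_right (k := k) (ι := ι) (κ := κ)) isRightExactOn_bilexRep_left
  refine ⟨⟨T, hT⟩, fun E _ _ _ _ => ?_⟩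
  have := restrictBilinear_faithful hι hκ ⟨T, hT⟩ e (E := E)
  have := restrictBilinear_full hι hκ ⟨T, hT⟩ e (E := E)
  have := restrictBilinear_essSurj hι hκ ⟨T, hT⟩ e (E := E)
  exact {}

/-! ### Covers by compact objects in the abelian case -/

section CompactCovers

variable {k : Type w} [Field k] {a : Type w} [SmallCategory a] [Preadditive a] [Linear k a]
  {C : Type (w + 1)} [Category.{w} C] [Abelian C] [Linear k C] [HasColimitsOfSize.{w, w} C]
  {ι : a ⥤ C} (hι : IsCompactModel k ι)
include hι

omit [HasColimitsOfSize.{w, w} C] in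
lemma IsCompactModel.isRightExactOn : IsRightExactOn k ι ι where
  additive := hι.additive
  linear := hι.linear
  existsUnique _ _ hgh _ s hs :=
    hgh.existsUnique (k := k) (F := 𝟭 C) ⟨inferInstance, inferInstance, inferInstance⟩ s hs

/-- Every epimorphism onto a compact object is refined by one from a compact object. -/
lemma IsCompactModel.exists_epi {Z : C} {y : a} (π : Z ⟶ ι.obj y) [Epi π] :
    ∃ (z : a) (φ : ι.obj z ⟶ Z), Epi (φ ≫ π) := by
  have := hι.dense
  have := hι.compact y
  let H := ι.op ⋙ yoneda.obj Z
  have hH : HasFilteredElements H := hι.isRightExactOn.hasFilteredElements hι Z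
  have := hH.isFiltered
  let d (i : H.Elementsᵒᵖ) : a := i.unop.1.unop
  let φ (i : H.Elementsᵒᵖ) : ι.obj (d i) ⟶ Z := i.unop.2
  let m {i j : H.Elementsᵒᵖ} (u : i ⟶ j) : d i ⟶ d j := u.unop.1.unop
  have hφ {i j : H.Elementsᵒᵖ} (u : i ⟶ j) : ι.map (m u) ≫ φ j = φ i := u.unop.2
  have hc (i : H.Elementsᵒᵖ) : φ i ≫ π ≫ cokernel.π (φ i ≫ π) = 0 :=
    (Category.assoc _ _ _).symm.trans (cokernel.condition _)
  -- The cokernels of all composites `ι z ⟶ Z ⟶ ι y` form a filtered diagram. The maps from `ι y` to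
  -- its colimit coincide (`hv`), and they vanish since compact objects mapping to `Z` detect this
  -- after precomposing with the epimorphism `π`.
  let Q : H.Elementsᵒᵖ ⥤ C :=
    { obj i := cokernel (φ i ≫ π)
      map {i j} u := cokernel.desc _ (cokernel.π (φ j ≫ π)) (by
        rw [← hφ u, Category.assoc, Category.assoc, hc, comp_zero])
      map_id i := coequalizer.hom_ext (by simp)
      map_comp u v := coequalizer.hom_ext (by simp) }
  have hQ {i j : H.Elementsᵒᵖ} (u : i ⟶ j) :
      cokernel.π (φ i ≫ π) ≫ Q.map u = cokernel.π (φ j ≫ π) := cokernel.π_desc _ _ _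
  let v (i : H.Elementsᵒᵖ) : ι.obj y ⟶ colimit Q := cokernel.π (φ i ≫ π) ≫ colimit.ι Q i
  have hv' {i j : H.Elementsᵒᵖ} (u : i ⟶ j) : v i = v j := by
    dsimp only [v]
    rw [← colimit.w Q u, ← Category.assoc, hQ]
  have hv (i j : H.Elementsᵒᵖ) : v i = v j :=
    (hv' (IsFiltered.leftToMax i j)).trans (hv' (IsFiltered.rightToMax i j)).symm
  have hv₀ (i : H.Elementsᵒᵖ) : v i = 0 := by
    rw [← cancel_epi π, comp_zero]
    refine dense_hom_ext ι (𝟭 C) (X := Z) (e := colimit Q) fun z ψ => ?_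
    let j : H.Elementsᵒᵖ := .op ⟨.op z, ψ⟩
    change ψ ≫ π ≫ v i = ψ ≫ 0
    rw [hv i j, comp_zero]
    have h : ψ ≫ π ≫ cokernel.π (φ j ≫ π) = 0 := hc j
    dsimp only [v]
    rw [reassoc_of% h, zero_comp]
  obtain ⟨i₀⟩ : Nonempty H.Elementsᵒᵖ := IsFiltered.nonempty
  -- Compactness of `ι y` makes the map vanish at a finite stage `i`, so the cokernel of `φ i ≫ π`
  -- is zero.
  obtain ⟨i, u, u', h⟩ := IsFinitelyPresentable.exists_eq_of_isColimit (colimit.isColimit Q)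
    (X := ι.obj y) (i := i₀) (j := i₀) (cokernel.π (φ i₀ ≫ π)) 0
    ((hv₀ i₀).trans zero_comp.symm)
  rw [zero_comp] at h
  have h₀ : cokernel.π (φ i ≫ π) = 0 := (hQ u).symm.trans h
  refine ⟨_, φ i, Preadditive.epi_of_cancel_zero _ fun g hg => ?_⟩
  rw [← cokernel.π_desc _ g hg, h₀, zero_comp]

/-- Epimorphisms of compact objects can be pulled back. -/
lemma IsCompactModel.exists_pullback {x' x u : a} (h : x' ⟶ x) [Epi (ι.map h)] (f : u ⟶ x) :
    ∃ (u' : a) (e : u' ⟶ u) (l : u' ⟶ x'), Epi (ι.map e) ∧ e ≫ f = l ≫ h := by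
  have := hι.full
  have := hι.faithful
  obtain ⟨z, φ, hφ⟩ := hι.exists_epi (pullback.snd (ι.map h) (ι.map f))
  refine ⟨z, ι.preimage (φ ≫ pullback.snd _ _), ι.preimage (φ ≫ pullback.fst _ _), ?_,
    ι.map_injective ?_⟩
  · rwa [ι.map_preimage]
  · simp [pullback.condition]

section Representable

variable {H : a → Type w} (r : ∀ {x x' : a} (_ : x ⟶ x'), H x' → H x) {Z : C}
  (σ : ∀ x, H x ≃ (ι.obj x ⟶ Z))
  (hσ : ∀ {x x' : a} (f : x ⟶ x') (s : H x'), σ x (r f s) = ι.map f ≫ σ x' s)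
  {x' x : a} (h : x' ⟶ x) [Epi (ι.map h)]
include hσ

omit hι [HasColimitsOfSize.{w, w} C] [Preadditive a] [Linear k a] [Linear k C] [Abelian C] in
lemma injective_of_representable : Function.Injective (r h) := fun s t hst => by
  apply (σ x).injective
  rw [← cancel_epi (ι.map h), ← hσ, ← hσ, hst]

-- The hypothesis, tested on compact objects, says that `s` kills the kernel of `ι h`; in an abelian
-- category it then descends along the epimorphism.
omit [HasColimitsOfSize.{w, w} C] in
lemma exists_of_representable (s : H x')
    (hs : ∀ {z : a} (l m : z ⟶ x'), l ≫ h = m ≫ h → r l s = r m s) : ∃ t, r h t = s := by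
  have := hι.dense
  have := hι.full
  have := hι.faithful
  have := hι.additive
  have H : kernel.ι (ι.map h) ≫ σ x' s = 0 := by
    refine dense_hom_ext ι (𝟭 C) (X := kernel (ι.map h)) (e := Z) fun z ψ => ?_
    obtain ⟨l, hl⟩ := ι.map_surjective (ψ ≫ kernel.ι (ι.map h))
    have h₁ : l ≫ h = 0 ≫ h := ι.map_injective (by simp [hl])
    have h₂ := congrArg (σ z) (hs l 0 h₁)
    rw [hσ, hσ, hl, ι.map_zero, zero_comp, Category.assoc] at h₂
    exact h₂.trans comp_zero.symm
  refine ⟨(σ x).symm (Abelian.epiDesc (ι.map h) (σ x' s) H), (σ x').injective ?_⟩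
  rw [hσ, Equiv.apply_symm_apply, Abelian.comp_epiDesc]

end Representable

end CompactCovers

/-! ### Bilex presheaves are sheaves -/

section Topology

variable {k : Type w} [Field k] {a b : Type w} [SmallCategory a] [SmallCategory b]
  [Preadditive a] [Preadditive b] [Linear k a] [Linear k b]
  {C D : Type (w + 1)} [Category.{w} C] [Category.{w} D]
  [Abelian C] [Abelian D] [Linear k C] [Linear k D]
  [HasColimitsOfSize.{w, w} C] [HasColimitsOfSize.{w, w} D]
  {ι : a ⥤ C} {κ : b ⥤ D} (hι : IsCompactModel k ι) (hκ : IsCompactModel k κ)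

/-- The topology generated by pairs of epimorphisms. -/
def epiTopology : GrothendieckTopology (a × b) where
  sieves z := { S | ∃ (x' : a) (y' : b) (h : x' ⟶ z.1) (h' : y' ⟶ z.2),
    Epi (ι.map h) ∧ Epi (κ.map h') ∧ S.arrows (Y := (x', y')) (Prod.mkHom h h') }
  top_mem' z := ⟨z.1, z.2, 𝟙 _, 𝟙 _, by rw [ι.map_id]; infer_instance,
    by rw [κ.map_id]; infer_instance, trivial⟩
  pullback_stable' := by
    rintro ⟨x, y⟩ ⟨u, v⟩ S ⟨f, g⟩ ⟨x', y', h, h', hh, hh', hS⟩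
    obtain ⟨u', e, l, he, w⟩ := hι.exists_pullback h f
    obtain ⟨v', e', l', he', w'⟩ := hκ.exists_pullback h' g
    refine ⟨u', v', e, e', he, he', ?_⟩
    have := S.downward_closed hS (Prod.mkHom l l' : (u', v') ⟶ (x', y'))
    have hw : Prod.mkHom e e' ≫ Prod.mkHom f g =
        (Prod.mkHom l l' : (u', v') ⟶ (x', y')) ≫ Prod.mkHom h h' := Prod.ext w w'
    change S.arrows (Prod.mkHom e e' ≫ Prod.mkHom f g)
    rwa [hw]
  transitive' := by
    rintro ⟨x, y⟩ S ⟨x', y', h, h', hh, hh', hS⟩ R hR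
    obtain ⟨u, v, e, e', he, he', h₃⟩ := hR hS
    refine ⟨u, v, e ≫ h, e' ≫ h', ?_, ?_, h₃⟩
    · rw [ι.map_comp]
      exact epi_comp _ _
    · rw [κ.map_comp]
      exact epi_comp _ _

section Sheaf

-- Sections of `p` over `(x, y)` are morphisms from `bilexRep (x, y)`, which is right exact in `x`;
-- so `p (-, y)` is represented by an object of `C`.
omit [HasColimitsOfSize.{w, w} D] in
include hι hκ in
lemma BilexCat.exists_representation_left (p : BilexCat k ι κ) (y : b) :
    ∃ (Z : C) (σ : ∀ x, p.obj.obj (.op (x, y)) ≃ (ι.obj x ⟶ Z)),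
      ∀ {x x' : a} (f : x ⟶ x') (s : p.obj.obj (.op (x', y))),
        σ x (res p.obj f (𝟙 y) s) = ι.map f ≫ σ x' s := by
  have := hι.full
  have := hι.faithful
  have := hκ.faithful
  have := hι.additive
  have := hκ.additive
  obtain ⟨Z, ⟨i⟩⟩ := ((isRightExactOn_bilexRep_left (k := k) (ι := ι) (κ := κ) y
    ).hasFilteredElements hι p).exists_iso ι hι.compact
  refine ⟨Z, fun x => bilexEquiv.symm.trans (i.app (.op x)).toEquiv, fun {x x'} f s => ?_⟩
  have h := NatTrans.naturality_apply i.hom f.op (bilexEquiv.symm s)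
  refine Eq.trans ?_ h
  refine congrArg (i.hom.app (.op x)) ?_
  refine bilexEquiv.symm_apply_eq.2 (Eq.trans ?_ (bilexEquiv_res _ _ _).symm)
  rw [bilexEquiv.apply_symm_apply]
  rfl

omit [HasColimitsOfSize.{w, w} C] in
include hι hκ in
lemma BilexCat.exists_representation_right (p : BilexCat k ι κ) (x : a) :
    ∃ (Z : D) (σ : ∀ y, p.obj.obj (.op (x, y)) ≃ (κ.obj y ⟶ Z)),
      ∀ {y y' : b} (f : y ⟶ y') (s : p.obj.obj (.op (x, y'))),
        σ y (res p.obj (𝟙 x) f s) = κ.map f ≫ σ y' s := by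
  have := hκ.full
  have := hι.faithful
  have := hκ.faithful
  have := hι.additive
  have := hκ.additive
  obtain ⟨Z, ⟨i⟩⟩ := ((isRightExactOn_bilexRep_right (k := k) (ι := ι) (κ := κ) x
    ).hasFilteredElements hκ p).exists_iso κ hκ.compact
  refine ⟨Z, fun y => bilexEquiv.symm.trans (i.app (.op y)).toEquiv, fun {y y'} f s => ?_⟩
  have h := NatTrans.naturality_apply i.hom f.op (bilexEquiv.symm s)
  refine Eq.trans ?_ h
  refine congrArg (i.hom.app (.op y)) ?_
  refine bilexEquiv.symm_apply_eq.2 (Eq.trans ?_ (bilexEquiv_res _ _ _).symm)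
  rw [bilexEquiv.apply_symm_apply]
  rfl

-- Descent is done one variable at a time: `p` is representable in each variable, and sections
-- descend there along epimorphisms.
include hι hκ in
lemma BilexCat.isSheafFor (p : BilexCat k ι κ) {x' x : a} {y' y : b} (h : x' ⟶ x) (h' : y' ⟶ y)
    [Epi (ι.map h)] [Epi (κ.map h')] :
    Presieve.IsSheafFor (p.obj ⋙ forget (ModuleCat k))
      (Presieve.singleton (Prod.mkHom h h' : (x', y') ⟶ (x, y))) := by
  rw [Presieve.isSheafFor_singleton]
  change ∀ s : p.obj.obj (.op (x', y')), (∀ {z : a × b} (l m : z ⟶ (x', y')),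
    l ≫ Prod.mkHom h h' = m ≫ Prod.mkHom h h' → res p.obj l.1 l.2 s = res p.obj m.1 m.2 s) →
    ∃! t, res p.obj h h' t = s
  intro s hs
  have comm {u u' : a} {v v' : b} (f : u ⟶ u') (g : v ⟶ v') (s : p.obj.obj (.op (u', v'))) :
      res p.obj f g s = res p.obj f (𝟙 v) (res p.obj (𝟙 u') g s) := by
    rw [res_res]
    simp
  have comm' {u u' : a} {v v' : b} (f : u ⟶ u') (g : v ⟶ v') (s : p.obj.obj (.op (u', v'))) :
      res p.obj f g s = res p.obj (𝟙 u) g (res p.obj f (𝟙 v') s) := by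
    rw [res_res]
    simp
  have h₁ (v : b) : Function.Injective (res p.obj h (𝟙 v)) := by
    obtain ⟨Z, σ, hσ⟩ := p.exists_representation_left hι hκ v
    exact injective_of_representable (fun f s => res p.obj f (𝟙 v) s) σ hσ h
  have h₂ : Function.Injective (res p.obj (𝟙 x) h') := by
    obtain ⟨Z, σ, hσ⟩ := p.exists_representation_right hι hκ x
    exact injective_of_representable (fun f s => res p.obj (𝟙 x) f s) σ hσ h'
  obtain ⟨s', hs'⟩ : ∃ t, res p.obj h (𝟙 y') t = s := by
    obtain ⟨Z, σ, hσ⟩ := p.exists_representation_left hι hκ y'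
    exact exists_of_representable hι (fun f s => res p.obj f (𝟙 y') s) σ hσ h s
      fun {z} l m w => hs (z := (z, y')) (Prod.mkHom l (𝟙 y')) (Prod.mkHom m (𝟙 y')) (Prod.ext w rfl)
  obtain ⟨t, ht⟩ : ∃ t, res p.obj (𝟙 x) h' t = s' := by
    obtain ⟨Z, σ, hσ⟩ := p.exists_representation_right hι hκ x
    -- Compatibility of `s'` in the second variable may be checked after the injective restriction
    -- along `h`, where it is the hypothesis on `s`.
    refine exists_of_representable hκ (fun f s => res p.obj (𝟙 x) f s) σ hσ h' s'
      fun {z} l m w => h₁ _ ?_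
    rw [← comm, ← comm, comm' h l, comm' h m, hs']
    exact hs (z := (x', z)) (Prod.mkHom (𝟙 x') l) (Prod.mkHom (𝟙 x') m) (Prod.ext rfl w)
  refine ⟨t, ?_, fun t' ht' => ?_⟩
  · dsimp only
    rw [comm, ht, hs']
  · apply h₂
    apply h₁
    dsimp only at ht'
    rw [← comm, ht', ht, hs']

/-- A covering sieve contains one generated by a single pair. Passing to the larger sieve only
requires separatedness along pullbacks, which again contain such pairs. -/
theorem BilexCat.isSheaf (p : BilexCat k ι κ) : Presheaf.IsSheaf (epiTopology hι hκ) p.obj := by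
  rw [Presheaf.isSheaf_iff_isSheaf_forget _ _ (forget (ModuleCat k)), isSheaf_iff_isSheaf_of_type]
  rintro ⟨x, y⟩ S ⟨x', y', h, h', hh, hh', hS⟩
  have hle : Sieve.generate (Presieve.singleton (Prod.mkHom h h' : (x', y') ⟶ (x, y))) ≤ S := by
    rw [Sieve.generate_le_iff]
    rintro _ _ ⟨rfl, rfl⟩
    exact hS
  refine Presieve.isSheafFor_subsieve_aux _ hle ?_ fun ⟨u, v⟩ ⟨f, g⟩ hf => ?_
  · rw [← Presieve.isSheafFor_iff_generate]
    exact p.isSheafFor hι hκ h h'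
  · obtain ⟨u', e, l, he, w⟩ := hι.exists_pullback h f
    obtain ⟨v', e', l', he', w'⟩ := hκ.exists_pullback h' g
    have := (p.isSheafFor hι hκ e e').isSeparatedFor
    rw [Presieve.isSeparatedFor_singleton] at this
    intro s t₁ t₂ ht₁ ht₂
    apply this
    have hm : ((Sieve.generate (Presieve.singleton (Prod.mkHom h h' : (x', y') ⟶ (x, y)))).pullback
        (Prod.mkHom f g)).arrows (Prod.mkHom e e' : (u', v') ⟶ (u, v)) :=
      ⟨(x', y'), Prod.mkHom l l', _, Presieve.singleton_self _, (Prod.ext w w').symm⟩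
    exact (ht₁ _ hm).trans (ht₂ _ hm).symm

end Sheaf

end Topology

section Refinement

variable {k : Type w} [Field k] {a : Type w} [SmallCategory a] [Preadditive a] [Linear k a]
  {C : Type (w + 1)} [Category.{w} C] [Abelian C] [Linear k C] [HasColimitsOfSize.{w, w} C]
  {ι : a ⥤ C} (hι : IsCompactModel k ι)

omit [Linear k C] [HasColimitsOfSize.{w, w} C] [Preadditive a] in
lemma IsCokernelSequence.epi {x'' x' x : a} {g : x'' ⟶ x'} {h : x' ⟶ x}
    (hgh : IsCokernelSequence ι g h) : Epi (ι.map h) :=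
  Cofork.IsColimit.epi hgh.choose_spec.some

-- Exactness at `x'` gives the factorization after an epimorphic refinement, which can be chosen
-- compact by `exists_epi`.
include hι in
lemma IsCokernelSequence.exists_refinement {x'' x' x : a} {g : x'' ⟶ x'} {h : x' ⟶ x}
    (hgh : IsCokernelSequence ι g h) {z : a} (u : z ⟶ x') (hu : u ≫ h = 0) :
    ∃ (z' : a) (e : z' ⟶ z) (v : z' ⟶ x''), Epi (ι.map e) ∧ e ≫ u = v ≫ g := by
  have := hι.full
  have := hι.faithful
  have := hι.additive
  obtain ⟨w, ⟨hc⟩⟩ := hgh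
  obtain ⟨A, π, hπ, v, hv⟩ := (ShortComplex.exact_iff_exact_up_to_refinements _).1
    (ShortComplex.exact_of_g_is_cokernel (ShortComplex.mk _ _ w) hc) (ι.map u)
    (by dsimp; rw [← ι.map_comp, hu, ι.map_zero])
  obtain ⟨z', φ, hφ⟩ := hι.exists_epi π
  dsimp at v hv
  refine ⟨z', ι.preimage (φ ≫ π), ι.preimage (φ ≫ v), by rwa [ι.map_preimage],
    ι.map_injective ?_⟩
  simp [hv]

end Refinement

/-! ### Bilinear sheaves form an abelian category -/

section BilinearSheaves

variable {k : Type w} [Field k] {a b : Type w} [SmallCategory a] [SmallCategory b]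
  [Preadditive a] [Preadditive b] [Linear k a] [Linear k b]
  {C D : Type (w + 1)} [Category.{w} C] [Category.{w} D]
  [Abelian C] [Abelian D] [Linear k C] [Linear k D]
  [HasColimitsOfSize.{w, w} C] [HasColimitsOfSize.{w, w} D]
  {ι : a ⥤ C} {κ : b ⥤ D} {hι : IsCompactModel k ι} {hκ : IsCompactModel k κ}
  {p : (a × b)ᵒᵖ ⥤ ModuleCat.{w} k} (hp : Presheaf.IsSheaf (epiTopology hι hκ) p)
include hp

lemma isSheafFor_of_isSheaf {x' x : a} {y' y : b} (h : x' ⟶ x) (h' : y' ⟶ y)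
    [hh : Epi (ι.map h)] [hh' : Epi (κ.map h')] :
    Presieve.IsSheafFor (p ⋙ forget (ModuleCat k))
      (Presieve.singleton (Prod.mkHom h h' : (x', y') ⟶ (x, y))) := by
  rw [Presheaf.isSheaf_iff_isSheaf_forget _ _ (forget (ModuleCat k)),
    isSheaf_iff_isSheaf_of_type] at hp
  rw [Presieve.isSheafFor_iff_generate]
  exact hp _ ⟨x', y', h, h', hh, hh', Sieve.le_generate _ _ _ (Presieve.singleton_self _)⟩

lemma res_injective_of_isSheaf {x' x : a} {y' y : b} (h : x' ⟶ x) (h' : y' ⟶ y)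
    (hh : Epi (ι.map h)) (hh' : Epi (κ.map h')) : Function.Injective (res p h h') :=
  Presieve.isSeparatedFor_singleton.1 (isSheafFor_of_isSheaf hp h h').isSeparatedFor

lemma existsUnique_res_of_isSheaf {x' x : a} {y' y : b} (h : x' ⟶ x) (h' : y' ⟶ y)
    (hh : Epi (ι.map h)) (hh' : Epi (κ.map h')) (s : p.obj (.op (x', y')))
    (hs : ∀ {u : a} {v : b} (l m : u ⟶ x') (l' m' : v ⟶ y'), l ≫ h = m ≫ h → l' ≫ h' = m' ≫ h' →
      res p l l' s = res p m m' s) : ∃! t, res p h h' t = s :=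
  Presieve.isSheafFor_singleton.1 (isSheafFor_of_isSheaf hp h h') s fun l m w =>
    hs l.1 m.1 l.2 m.2 (congrArg (fun f => f.1) w) (congrArg (fun f => f.2) w)

/-- In a cokernel sequence `g`, `h`, the map `h` is a cover. If `l ≫ h = m ≫ h`, then `l - m`
factors locally through `g`, so it kills `s` by separatedness; bilinearity gives equal restrictions
along `l` and `m`, and `s` descends. -/
theorem IsBilinearPresheaf.isBilex (hb : IsBilinearPresheaf p) : IsBilex p ι κ := by
  have hid (x : a) : Epi (ι.map (𝟙 x)) := by rw [ι.map_id]; infer_instance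
  have hid' (x : b) : Epi (κ.map (𝟙 x)) := by rw [κ.map_id]; infer_instance
  have comm {u u' : a} {v v' : b} (f : u ⟶ u') (g : v ⟶ v') (s : p.obj (.op (u', v'))) :
      res p f g s = res p f (𝟙 v) (res p (𝟙 u') g s) := by
    rw [res_res]
    simp
  have comm' {u u' : a} {v v' : b} (f : u ⟶ u') (g : v ⟶ v') (s : p.obj (.op (u', v'))) :
      res p f g s = res p (𝟙 u) g (res p f (𝟙 v') s) := by
    rw [res_res]
    simp
  refine ⟨hb, fun {x'' x' x} g h hgh y s hs => ?_, fun x y'' y' y g h hgh s hs => ?_⟩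
  · refine existsUnique_res_of_isSheaf hp h (𝟙 y) hgh.epi (hid' y) s fun l m l' m' hl hl' => ?_
    have hl' : l' = m' := by simpa using hl'
    obtain ⟨z', e, v, he, w⟩ := hgh.exists_refinement hι (l - m) (by simp [hl])
    have H : res p (l - m) (𝟙 y) s = 0 := by
      apply res_injective_of_isSheaf hp e (𝟙 y) he (hid' y)
      rw [res_res, w, ← res_res, hs, map_zero, map_zero]
    have H' : res p l (𝟙 y) s = res p m (𝟙 y) s := by
      have := hb.add_left (l - m) m y s
      rwa [sub_add_cancel, H, zero_add] at this
    rw [hl', comm', H', ← comm']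
  · refine existsUnique_res_of_isSheaf hp (𝟙 x) h (hid x) hgh.epi s fun l m l' m' hl hl' => ?_
    have hl : l = m := by simpa using hl
    obtain ⟨z', e, v, he, w⟩ := hgh.exists_refinement hκ (l' - m') (by simp [hl'])
    have H : res p (𝟙 x) (l' - m') s = 0 := by
      apply res_injective_of_isSheaf hp (𝟙 x) e (hid x) he
      rw [res_res, w, ← res_res, hs, map_zero, map_zero]
    have H' : res p (𝟙 x) l' s = res p (𝟙 x) m' s := by
      have := hb.add_right x (l' - m') m' s
      rwa [sub_add_cancel, H, zero_add] at this
    rw [hl, comm, H', ← comm]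

omit hp

variable (hι hκ) in
/-- Sheaves whose underlying presheaf is bilinear. -/
def bilinearSheaves : ObjectProperty (Sheaf (epiTopology hι hκ) (ModuleCat.{w} k)) :=
  fun F => IsBilinearPresheaf F.obj

/-- Bilinearity is detected by jointly injective families. -/
lemma IsBilinearPresheaf.of_injective {J : Type*} {p : (a × b)ᵒᵖ ⥤ ModuleCat.{w} k}
    (q : J → (a × b)ᵒᵖ ⥤ ModuleCat.{w} k) (hq : ∀ j, IsBilinearPresheaf (q j))
    (t : ∀ j, p ⟶ q j)
    (ht : ∀ (x : a) (y : b) (s s' : p.obj (.op (x, y))),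
      (∀ j, ((t j).app (.op (x, y))).hom s = ((t j).app (.op (x, y))).hom s') → s = s') :
    IsBilinearPresheaf p where
  add_left f f' y s := ht _ _ _ _ fun j => by
    rw [map_add, app_res, app_res, app_res, (hq j).add_left]
  smul_left r f y s := ht _ _ _ _ fun j => by
    rw [map_smul, app_res, app_res, (hq j).smul_left]
  add_right x _ _ g g' s := ht _ _ _ _ fun j => by
    rw [map_add, app_res, app_res, app_res, (hq j).add_right]
  smul_right x _ _ r g s := ht _ _ _ _ fun j => by
    rw [map_smul, app_res, app_res, (hq j).smul_right]

instance {J : Type*} [Category* J] [HasLimitsOfShape J (ModuleCat.{w} k)]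
    [PreservesLimitsOfShape J (forget (ModuleCat.{w} k))] :
    (bilinearSheaves hι hκ).IsClosedUnderLimitsOfShape J where
  limitsOfShape_le := fun F ⟨c⟩ => by
    refine IsBilinearPresheaf.of_injective (fun j => (c.diag.obj j).obj)
      (fun j => c.prop_diag_obj j) (fun j => (c.π.app j).hom) fun x y s s' h => ?_
    have hc := isLimitOfPreserves ((evaluation _ _).obj (.op (x, y)))
      (isLimitOfPreserves (sheafToPresheaf (epiTopology hι hκ) (ModuleCat.{w} k)) c.isLimit)
    exact Concrete.isLimit_ext _ hc s s' h

/-- The image of a bilinear sheaf under a locally surjective morphism is bilinear. -/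
lemma IsBilinearPresheaf.of_isLocallySurjective {p q : (a × b)ᵒᵖ ⥤ ModuleCat.{w} k}
    (hp : IsBilinearPresheaf p) (hq : Presheaf.IsSheaf (epiTopology hι hκ) q) (π : p ⟶ q)
    [Presheaf.IsLocallySurjective (epiTopology hι hκ) π] : IsBilinearPresheaf q := by
  have cover {x : a} {y : b} (s : q.obj (.op (x, y))) : ∃ (x' : a) (y' : b) (h : x' ⟶ x)
      (h' : y' ⟶ y) (t : p.obj (.op (x', y'))), Epi (ι.map h) ∧ Epi (κ.map h') ∧
        res q h h' s = (π.app _).hom t := by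
    obtain ⟨x', y', h, h', hh, hh', t, ht⟩ :=
      Presheaf.imageSieve_mem (epiTopology hι hκ) π (U := .op (x, y)) s
    exact ⟨x', y', h, h', t, hh, hh', ht.symm⟩
  -- On a common cover, `s` lifts to a section `t` of `p`, and `f`, `f'` lift to `l`, `l'`.
  -- Identities for `f`, `f'` on `s` then follow from those for `l`, `l'` on `t`.
  have left {x x' : a} {y : b} (s : q.obj (.op (x', y))) (f f' : x ⟶ x') :
      ∃ (u z : a) (v : b) (e : u ⟶ x) (h : v ⟶ y) (l l' : u ⟶ z) (t : p.obj (.op (z, v))),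
        Epi (ι.map e) ∧ Epi (κ.map h) ∧
        res q e h (res q f (𝟙 y) s) = (π.app _).hom (res p l (𝟙 v) t) ∧
        res q e h (res q f' (𝟙 y) s) = (π.app _).hom (res p l' (𝟙 v) t) ∧
        res q e h (res q (f + f') (𝟙 y) s) = (π.app _).hom (res p (l + l') (𝟙 v) t) ∧
        ∀ r : k, res q e h (res q (r • f) (𝟙 y) s) = (π.app _).hom (res p (r • l) (𝟙 v) t) := by
    obtain ⟨z, v, h₁, h₂, t, hh₁, hh₂, ht⟩ := cover s
    obtain ⟨u₁, e₁, l₁, he₁, w₁⟩ := hι.exists_pullback h₁ f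
    -- The second pullback is taken over the first, so that both lifts have source `u₂`.
    obtain ⟨u₂, e₂, l₂, he₂, w₂⟩ := hι.exists_pullback h₁ (e₁ ≫ f')
    have key (g : x ⟶ x') (l : u₂ ⟶ z) (w : (e₂ ≫ e₁) ≫ g = l ≫ h₁) :
        res q (e₂ ≫ e₁) h₂ (res q g (𝟙 y) s) = (π.app _).hom (res p l (𝟙 v) t) := by
      rw [app_res, ← ht, res_res, res_res, w, Category.comp_id, Category.id_comp]
    have w₁' : (e₂ ≫ e₁) ≫ f = (e₂ ≫ l₁) ≫ h₁ := by simp [w₁]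
    have w₂' : (e₂ ≫ e₁) ≫ f' = l₂ ≫ h₁ := by simp [← w₂]
    refine ⟨u₂, z, v, e₂ ≫ e₁, h₂, e₂ ≫ l₁, l₂, t, ?_, hh₂, key _ _ w₁', key _ _ w₂',
      key _ _ ?_, fun r => key _ _ ?_⟩
    · rw [ι.map_comp]
      exact epi_comp _ _
    · rw [Preadditive.comp_add, Preadditive.add_comp, w₁', w₂']
    · rw [Linear.comp_smul, Linear.smul_comp, w₁']
  have right {x : a} {y y' : b} (s : q.obj (.op (x, y'))) (f f' : y ⟶ y') :
      ∃ (u : a) (v z : b) (h : u ⟶ x) (e : v ⟶ y) (l l' : v ⟶ z) (t : p.obj (.op (u, z))),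
        Epi (ι.map h) ∧ Epi (κ.map e) ∧
        res q h e (res q (𝟙 x) f s) = (π.app _).hom (res p (𝟙 u) l t) ∧
        res q h e (res q (𝟙 x) f' s) = (π.app _).hom (res p (𝟙 u) l' t) ∧
        res q h e (res q (𝟙 x) (f + f') s) = (π.app _).hom (res p (𝟙 u) (l + l') t) ∧
        ∀ r : k, res q h e (res q (𝟙 x) (r • f) s) = (π.app _).hom (res p (𝟙 u) (r • l) t) := by
    obtain ⟨u, z, h₁, h₂, t, hh₁, hh₂, ht⟩ := cover s
    obtain ⟨u₁, e₁, l₁, he₁, w₁⟩ := hκ.exists_pullback h₂ f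
    obtain ⟨u₂, e₂, l₂, he₂, w₂⟩ := hκ.exists_pullback h₂ (e₁ ≫ f')
    have key (g : y ⟶ y') (l : u₂ ⟶ z) (w : (e₂ ≫ e₁) ≫ g = l ≫ h₂) :
        res q h₁ (e₂ ≫ e₁) (res q (𝟙 x) g s) = (π.app _).hom (res p (𝟙 u) l t) := by
      rw [app_res, ← ht, res_res, res_res, w, Category.comp_id, Category.id_comp]
    have w₁' : (e₂ ≫ e₁) ≫ f = (e₂ ≫ l₁) ≫ h₂ := by simp [w₁]
    have w₂' : (e₂ ≫ e₁) ≫ f' = l₂ ≫ h₂ := by simp [← w₂]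
    refine ⟨u, u₂, z, h₁, e₂ ≫ e₁, e₂ ≫ l₁, l₂, t, hh₁, ?_, key _ _ w₁', key _ _ w₂',
      key _ _ ?_, fun r => key _ _ ?_⟩
    · rw [κ.map_comp]
      exact epi_comp _ _
    · rw [Preadditive.comp_add, Preadditive.add_comp, w₁', w₂']
    · rw [Linear.comp_smul, Linear.smul_comp, w₁']
  refine ⟨fun f f' y s => ?_, fun r f y s => ?_, fun x _ _ f f' s => ?_, fun x _ _ r f s => ?_⟩
  · obtain ⟨u, z, v, e, h, l, l', t, he, hh, h₁, h₂, h₃, -⟩ := left s f f'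
    apply res_injective_of_isSheaf hq e h he hh
    rw [map_add, h₁, h₂, h₃, hp.add_left, map_add]
  · obtain ⟨u, z, v, e, h, l, l', t, he, hh, h₁, -, -, h₃⟩ := left s f f
    apply res_injective_of_isSheaf hq e h he hh
    rw [map_smul, h₁, h₃, hp.smul_left, map_smul]
  · obtain ⟨u, v, z, e, h, l, l', t, he, hh, h₁, h₂, h₃, -⟩ := right s f f'
    apply res_injective_of_isSheaf hq e h he hh
    rw [map_add, h₁, h₂, h₃, hp.add_right, map_add]
  · obtain ⟨u, v, z, e, h, l, l', t, he, hh, h₁, -, -, h₃⟩ := right s f f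
    apply res_injective_of_isSheaf hq e h he hh
    rw [map_smul, h₁, h₃, hp.smul_right, map_smul]

/-- Cokernel projections of sheaves are epimorphisms, hence locally surjective. -/
instance : (bilinearSheaves hι hκ).IsClosedUnderCokernels where
  cokernels_le := by
    rintro _ ⟨f, c, hc, -, hY⟩
    have := Cofork.IsColimit.epi hc
    have := (Sheaf.isLocallySurjective_iff_epi' _ c.π).2 this
    exact IsBilinearPresheaf.of_isLocallySurjective hY c.pt.property c.π.hom

instance : (bilinearSheaves hι hκ).IsClosedUnderKernels where
  kernels_le := by
    rintro _ ⟨f, c, hc, hX, hY⟩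
    exact ObjectProperty.prop_of_isLimit _ hc (by rintro (_ | _) <;> assumption)

instance : (bilinearSheaves hι hκ).IsClosedUnderFiniteProducts where

instance : (bilinearSheaves hι hκ).ContainsZero where
  exists_zero := ⟨_, terminalIsTerminal.isZero, ObjectProperty.prop_terminal _⟩

noncomputable instance : Abelian (bilinearSheaves hι hκ).FullSubcategory := inferInstance

variable (hι hκ) in
/-- Bilinear presheaves which are left exact in both variables are the bilinear sheaves. -/
def BilexCat.toBilinearSheaves : BilexCat k ι κ ⥤ (bilinearSheaves hι hκ).FullSubcategory :=
  ObjectProperty.lift _ (ObjectProperty.lift _ (ObjectProperty.ι _) (BilexCat.isSheaf hι hκ))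
    fun p =>
      have := hι.faithful
      have := hκ.faithful
      have := hι.additive
      have := hκ.additive
      (BilexCat.isBilex p).toIsBilinearPresheaf

/-- Essential surjectivity is the converse inclusion `IsBilinearPresheaf.isBilex`. -/
instance : (BilexCat.toBilinearSheaves hι hκ).IsEquivalence where
  faithful := ⟨fun h => ObjectProperty.hom_ext _ (congrArg (fun f => f.hom.hom) h)⟩
  full := ⟨fun f => ⟨ObjectProperty.homMk f.hom.hom, rfl⟩⟩
  essSurj := ⟨fun F => by
    have := hι.faithful
    have := hκ.faithful
    have := hι.additive
    have := hκ.additive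
    exact ⟨⟨F.obj.obj, isLocal_bilexMorphisms_iff.2 (F.property.isBilex F.obj.property)⟩,
      ⟨Iso.refl _⟩⟩⟩

variable (hι hκ) in
/-- The Deligne-Kelly tensor product of abelian categories is abelian. -/
@[reducible]
noncomputable def BilexCat.abelian : Abelian (BilexCat k ι κ) := by
  have : HasColimitsOfSize.{w, w} (BilexCat k ι κ) := inferInstance
  have := hasFiniteColimits_of_hasColimitsOfSize (BilexCat k ι κ)
  have := HasFiniteBiproducts.of_hasFiniteCoproducts (C := BilexCat k ι κ)
  have := hasFiniteProducts_of_hasFiniteBiproducts (C := BilexCat k ι κ)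
  exact abelianOfEquivalence (BilexCat.toBilinearSheaves hι hκ)

end BilinearSheaves

/-! ### Abelianness of the relative tensor product -/

section AbelianTransfer

/-- A category is abelian if it is monadic over an abelian category through an additive right
exact functor. -/
@[reducible]
noncomputable def abelianOfMonadic {P Q : Type*} [Category* P] [Category* Q] [Abelian P]
    [Preadditive Q] [HasFiniteColimits Q] (R : Q ⥤ P) [MonadicRightAdjoint R] [R.Additive]
    [PreservesFiniteColimits R] [R.ReflectsIsomorphisms] : Abelian Q := by
  have : HasFiniteLimits Q := ⟨fun J _ _ => ⟨fun F =>
    letI := monadicCreatesLimits.{0, 0} R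
    hasLimit_of_created F R⟩⟩
  have : PreservesLimitsOfSize.{0, 0} R := (monadicAdjunction R).rightAdjoint_preservesLimits
  have : PreservesFiniteLimits R := ⟨fun J _ _ => inferInstance⟩
  -- `R` preserves finite limits as a right adjoint and finite colimits by assumption, so it carries
  -- the comparison for `f` to that for `R f`, which is invertible in `P`.
  have (X Y : Q) (f : X ⟶ Y) : IsIso (Abelian.coimageImageComparison f) := by
    have : IsIso (R.map (Abelian.coimageImageComparison f)) :=
      ((MorphismProperty.isomorphisms _).arrow_mk_iso_iff
        (Abelian.PreservesCoimageImageComparison.iso R f)).2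
          (inferInstanceAs (IsIso (Abelian.coimageImageComparison (R.map f))))
    exact isIso_of_reflects_iso _ R
  exact Abelian.ofCoimageImageComparisonIsIso

end AbelianTransfer

section RelativeTensor

/-- The bilex model serves as `C ⊠ D`: it is abelian, and `Q` is monadic over it through a
cocontinuous functor. -/
theorem isAbelian_of_isRelativeTensor {k : Type w} [Field k] {A C D Q : Type (w + 1)}
    [Category.{w} A] [Category.{w} C] [Category.{w} D] [Category.{w} Q]
    [Preadditive A] [hC₀ : Preadditive C] [hD₀ : Preadditive D] [Preadditive Q]
    [Linear k A] [Linear k C] [Linear k D] [Linear k Q]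
    [MonoidalCategory A] [MonoidalRightAction A C] [MonoidalLeftAction A D]
    [IsLocallyFinitelyPresentable.{w} A] [IsLocallyFinitelyPresentable.{w} C]
    [IsLocallyFinitelyPresentable.{w} D] [IsLocallyFinitelyPresentable.{w} Q]
    (hA : IsTensorCategory k A) (hC : IsRightModuleCategory k A C)
    (hD : IsLeftModuleCategory k A D) {S : BalancedFunctor k A C D Q} (hS : S.IsRelativeTensor)
    (hC' : IsAbelian C) (hD' : IsAbelian D) : IsAbelian Q := by
  -- The given preadditive structures become those underlying the abelian ones, as the sheaf
  -- description of the model requires.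
  obtain ⟨_, rfl⟩ := hC'
  obtain ⟨_, rfl⟩ := hD'
  obtain ⟨a, _, _, _, ι, hι⟩ := exists_isCompactModel k C
  obtain ⟨b, _, _, _, κ, hκ⟩ := exists_isCompactModel k D
  obtain ⟨T, hT⟩ := exists_isDeligneKellyTensor hι hκ
  have := hT Q
  let μ := (restrictBilinear T Q).objPreimage ⟨S.functor, S.bilinear⟩
  have hμ : IsCanonicalFunctor T S μ := ⟨(restrictBilinear T Q).objObjPreimageIso _⟩
  obtain ⟨R, hR, hR', ⟨adj⟩⟩ := exists_cocontinuous_monadic_rightAdjoint hA hC hD hT hS hμ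
  let : MonadicRightAdjoint R := ⟨_, adj, monadic_of_isCanonicalFunctor hA hC hD hT hS hμ adj⟩
  let := BilexCat.abelian hι hκ
  have := hR.additive
  have := hR.preservesColimits
  have : HasColimitsOfSize.{w, w} Q := inferInstance
  have := hasFiniteColimits_of_hasColimitsOfSize Q
  have : PreservesFiniteColimits R := PreservesColimitsOfSize.preservesFiniteColimits R
  exact ⟨abelianOfMonadic R, rfl⟩

end RelativeTensor

end RelTensor

theorem mainTheorem10 (k : Type w) [Field k]
    -- the tensor category `A`
    (A : Type (w + 1)) [Category.{w} A] [Preadditive A] [Linear k A]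
    [IsLocallyFinitelyPresentable.{w} A] [MonoidalCategory A]
    (hA : RelTensor.IsTensorCategory k A)
    -- the right module category `C`
    (C : Type (w + 1)) [Category.{w} C] [Preadditive C] [Linear k C]
    [IsLocallyFinitelyPresentable.{w} C] [MonoidalRightAction A C]
    (hC : RelTensor.IsRightModuleCategory k A C)
    -- the left module category `D`
    (D : Type (w + 1)) [Category.{w} D] [Preadditive D] [Linear k D]
    [IsLocallyFinitelyPresentable.{w} D] [MonoidalLeftAction A D]
    (hD : RelTensor.IsLeftModuleCategory k A D)
    -- the relative tensor product `Q = C ⊠_A D`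
    (Q : Type (w + 1)) [Category.{w} Q] [Preadditive Q] [Linear k Q]
    [IsLocallyFinitelyPresentable.{w} Q]
    (S : RelTensor.BalancedFunctor k A C D Q) (hS : S.IsRelativeTensor) :
    -- the canonical functor `μ : C ⊠ D ⥤ C ⊠_A D` has a right adjoint, and it is monadic
    (∀ (P : Type (w + 1)) [Category.{w} P] [Preadditive P] [Linear k P]
      [IsLocallyFinitelyPresentable.{w} P]
      (T : RelTensor.BilinearFunctor k C D P), RelTensor.IsDeligneKellyTensor T →
      ∀ μ : RelTensor.CocontinuousFunctor k P Q, RelTensor.IsCanonicalFunctor T S μ →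
        μ.obj.IsLeftAdjoint ∧
        ∀ (R : Q ⥤ P) (adj : μ.obj ⊣ R), (Monad.comparison adj).IsEquivalence) ∧
    -- if `A`, `C` and `D` are abelian, then so is `C ⊠_A D`
    (RelTensor.IsAbelian A → RelTensor.IsAbelian C → RelTensor.IsAbelian D →
      RelTensor.IsAbelian Q) := by
  refine ⟨?_, ?_⟩
  · intro P _ _ _ _ T hT μ hμ
    refine ⟨?_, fun R adj => RelTensor.monadic_of_isCanonicalFunctor hA hC hD hT hS hμ adj⟩
    obtain ⟨R, -, -, ⟨adj⟩⟩ :=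
      RelTensor.exists_cocontinuous_monadic_rightAdjoint hA hC hD hT hS hμ
    exact adj.isLeftAdjoint
  · intro _ hC' hD'
    exact RelTensor.isAbelian_of_isRelativeTensor hA hC hD hS hC' hD'
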